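/- **Setting.** A concept class $\mathcal C$ consists, for each $d\in\mathbb N$, of a nonempty domain $X_d$ of bit strings of length at most $d$ and a set $\mathcal C_d$ of concepts $c:X_d\to\{+1,-1\}$, together with a scheme that represents concepts by bit strings; $\mathrm{size}(c)$ is the length of a shortest representation of $c$. Examples are drawn from the uniform distribution on $X_d$, and $\mathrm{err}_c(h)=\Pr_{x\in X_d}[h(x)\ne c(x)]$. Throughout, $\alpha,\beta\in(0,1/2)$ and $\varepsilon>0$. *SQ learning.* An SQ oracle for $c$ answers a query $(g,\tau)$, where $g:X_d\times\{\pm1\}\to\{\pm1\}$ and $\tau\in(0,1)$, with some $v$ such that $|v-\mathbb E_{x}[g(x,c(x))]|\le\tau$. A (randomized) SQ learner for $\mathcal C$ takes inputs $d,\alpha,\beta$ and, for every $c\in\mathcal C_d$ and every SQ oracle for $c$, asks at most $\mathrm{poly}(d,\mathrm{size}(c),1/\alpha,\log(1/\beta))$ queries, each with tolerance at least $1/\mathrm{poly}(d,\mathrm{size}(c),1/\alpha,\log(1/\beta))$, and outputs $h$ with $\Pr[\mathrm{err}_c(h)\le\alpha]\ge1-\beta$. It is *nonadaptive* if it prepares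 all its queries before it receives any answer; an *adaptive* learner is one that is not required to do so. It is *efficient* if its running time and the time to evaluate each of its queries (and its hypothesis) are polynomial in $d,1/\alpha,\log(1/\beta)$. *Local learning.* An $\varepsilon$-local randomizer on $D=X_d\times\{\pm1\}$ is a randomized map $R$ with discrete output such that $\Pr[R(u)=w]\le e^{\varepsilon}\Pr[R(u')=w]$ for all $u,u'\in D$ and all $w$. An algorithm is $\varepsilon$-local if it accesses its database $z\in D^n$ only by choosing indices $i$ and randomizers $R$ and receiving samples of $R(z_i)$, where the randomizers applied to the same entry are $\varepsilon_j$-local with $\sum_j\varepsilon_j\le\varepsilon$. A local learner for $\mathcal C$ takes inputs $d,\varepsilon,\alpha,\beta$, is $\varepsilon$-local, uses a database of $n\le\mathrm{poly}(d,1/\varepsilon,1/\alpha,\log(1/\beta))$ entries and makes at most $\mathrm{poly}(d,\mathrm{size}(c),1/\varepsilon,1/\alpha,\log(1/\beta))$ such accesses; for every $c\in\mathcal C_d$, if $z_i=(x_i,c(x_i))$ with $x_i$ i.i.d. uniform on $X_d$, it outputs $h$ with $\Pr[\mathrm{err}_c(h)\le\alpha]\ge1-\beta$. It is *noninteractive*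 if it prepares all its accesses before it receives any answer; an *interactive* learner is one that is not required to do so. It is *efficient* if its running time and the time to evaluate each of its randomizers (and its hypothesis) are polynomial in $d,\mathrm{size}(c),1/\varepsilon,1/\alpha,\log(1/\beta)$. **Statement.** Under the uniform distribution: 1. the concept classes learnable by nonadaptive SQ learners are a strict subset of the concept classes learnable by adaptive SQ learners; 2. the concept classes learnable by noninteractive local learners are a strict subset of the concept classes learnable by interactive local learners; 3. the concept classes efficiently learnable by nonadaptive SQ learners are a strict subset of the concept classes efficiently learnable by adaptive SQ learners; 4. the concept classes efficiently learnable by noninteractive local learners are a strict subset of the concept classes efficiently learnable by interactive local learners. -/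

import Mathlib

namespace PrivateLearning

/-! ### Concept classes -/

/-- A concept class: an ensemble of nonempty domains `X_d` of bit strings of length at most `d`,
together with a representation scheme. `rep d s` is the concept on `X_d` represented by the
string `s`, if there is one; labels are Booleans. -/
structure ConceptClass where
  dom : ℕ → Finset (List Bool)
  dom_nonempty : ∀ d, (dom d).Nonempty
  dom_length : ∀ d, ∀ x ∈ dom d, x.length ≤ d
  rep : (d : ℕ) → List Bool → Option (dom d → Bool)

namespace ConceptClass

/-- The examples of size parameter `d`. -/
abbrev X (C : ConceptClass) (d : ℕ) : Type := C.dom d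

instance (C : ConceptClass) (d : ℕ) : Nonempty (C.X d) := (C.dom_nonempty d).to_subtype

/-- The set `C_d` of concepts. -/
def concepts (C : ConceptClass) (d : ℕ) : Set (C.X d → Bool) := {c | ∃ s, C.rep d s = some c}

/-- The length of a shortest representation of a concept. -/
noncomputable def size (C : ConceptClass) (d : ℕ) (c : C.X d → Bool) : ℕ :=
  sInf {l | ∃ s, C.rep d s = some c ∧ s.length = l}

end ConceptClass

/-- Misclassification error of `h` with respect to `c` under the uniform distribution. -/
noncomputable def err {X : Type} [Fintype X] (c h : X → Bool) : ℝ :=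
  ((Finset.univ.filter fun x => h x ≠ c x).card : ℝ) / Fintype.card X

/-- The bound `a * (1 + x) ^ k`. A quantity is bounded by a polynomial in nonnegative variables
`x₁, …, x_j` if and only if it is at most `polyBound a k (x₁ + ⋯ + x_j)` for some `a`, `k`. -/
noncomputable def polyBound (a k : ℕ) (x : ℝ) : ℝ := a * (1 + x) ^ k

/-- The admissible values of the accuracy and confidence parameters. -/
def Admissible (α β : ℝ) : Prop := α ∈ Set.Ioo (0 : ℝ) (1 / 2) ∧ β ∈ Set.Ioo (0 : ℝ) (1 / 2)

/-! ### Randomized algorithms with an oracle -/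

/-- A randomized algorithm without computational restrictions that puts queries of type `Q` to an
oracle, receives answers of type `A` and outputs an element of `H`. It either stops, or makes a
random choice from a discrete distribution, or asks a query and continues with the answer. -/
inductive Alg (Q A H : Type) : Type 1
  | output (h : H) : Alg Q A H
  | sample {ι : Type} (p : PMF ι) (k : ι → Alg Q A H) : Alg Q A H
  | query (q : Q) (k : A → Alg Q A H) : Alg Q A H

namespace Alg

variable {Q A H H' : Type}

/-- Post-processing of the output. -/
noncomputable def mapOutput (f : H → H') : Alg Q A H → Alg Q A H'
  | output h => output (f h)
  | sample p k => sample p fun i => (k i).mapOutput f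
  | query q k => query q fun a => (k a).mapOutput f

/-- Whenever the answer to each query `q` lies in `reach q`, the algorithm asks at most `t`
queries, and all of them satisfy `ok`. -/
def QueriesWithin (reach : Q → Set A) (ok : Q → Prop) : Alg Q A H → ℕ → Prop
  | output _, _ => True
  | sample p k, t => ∀ i ∈ p.support, (k i).QueriesWithin reach ok t
  | query _ _, 0 => False
  | query q k, t + 1 => ok q ∧ ∀ a ∈ reach q, (k a).QueriesWithin reach ok t

/-- The algorithm asks exactly the queries in the given list, in this order, whatever the answers
are, and makes random choices only after it has received all the answers. Only answers to `q` in
`reach q` are considered. -/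
inductive AsksList (reach : Q → Set A) : List Q → Alg Q A H → Prop
  | output (h : H) : AsksList reach [] (output h)
  | sample {ι : Type} (p : PMF ι) (k : ι → Alg Q A H)
      (hk : ∀ i ∈ p.support, AsksList reach [] (k i)) : AsksList reach [] (sample p k)
  | query (q : Q) (qs : List Q) (k : A → Alg Q A H)
      (hk : ∀ a ∈ reach q, AsksList reach qs (k a)) : AsksList reach (q :: qs) (query q k)

/-- The algorithm prepares all its queries before it receives any answer: after its initial random
choices the list of its queries is fixed. -/
inductive Nonadaptive (reach : Q → Set A) : Alg Q A H → Prop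
  | ask (qs : List Q) (P : Alg Q A H) (hP : AsksList reach qs P) : Nonadaptive reach P
  | sample {ι : Type} (p : PMF ι) (k : ι → Alg Q A H)
      (hk : ∀ i ∈ p.support, Nonadaptive reach (k i)) : Nonadaptive reach (sample p k)

end Alg

/-! ### Statistical queries -/

/-- A statistical query on labelled examples: a `±1`-valued function, with `true` standing for `+1`
and `false` for `-1`, and a tolerance in `(0, 1)`. -/
structure SQQuery (X : Type) where
  g : X → Bool → Bool
  τ : ℝ
  τ_pos : 0 < τ
  τ_lt_one : τ < 1

/-- The expectation of `g (x, c x)` for uniformly distributed `x`. -/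
noncomputable def SQQuery.expect {X : Type} [Fintype X] (q : SQQuery X) (c : X → Bool) : ℝ :=
  (∑ x, if q.g x (c x) then (1 : ℝ) else -1) / Fintype.card X

/-- The answers that an SQ oracle for target `c` may give. -/
def SQQuery.valid {X : Type} [Fintype X] (c : X → Bool) (q : SQQuery X) : Set ℝ :=
  {v | |v - q.expect c| ≤ q.τ}

/-- An oracle for statistical queries. Its answer may depend on the earlier queries, so it need not
answer the same query in the same way each time. -/
abbrev SQOracle (X : Type) := List (SQQuery X) → SQQuery X → ℝ

/-- `O` is an SQ oracle for target `c` and the uniform distribution. -/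
def SQOracle.IsFor {X : Type} [Fintype X] (O : SQOracle X) (c : X → Bool) : Prop :=
  ∀ past q, O past q ∈ SQQuery.valid c q

/-- The distribution of the output of an SQ algorithm; `past` lists the earlier queries, the latest
one first. -/
noncomputable def Alg.runSQ {X H : Type} (O : SQOracle X) :
    Alg (SQQuery X) ℝ H → List (SQQuery X) → PMF H
  | .output h, _ => PMF.pure h
  | .sample p k, past => p.bind fun i => (k i).runSQ O past
  | .query q k, past => (k (O past q)).runSQ O (q :: past)

/-- A family of SQ algorithms, one for each choice of the inputs `d`, `α`, `β`. -/
abbrev SQFamily (C : ConceptClass) :=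
  (d : ℕ) → ℝ → ℝ → Alg (SQQuery (C.X d)) ℝ (C.X d → Bool)

/-- `A` learns `C` under the uniform distribution with polynomially many statistical queries, all
of inverse polynomial tolerance, whichever SQ oracle for the target it is given. -/
def SQFamily.Learns {C : ConceptClass} (A : SQFamily C) : Prop :=
  ∃ a k : ℕ, ∀ (d : ℕ) (α β : ℝ), Admissible α β → ∀ c ∈ C.concepts d,
    (A d α β).QueriesWithin (SQQuery.valid c)
      (fun q => 1 / polyBound a k (d + C.size d c + 1 / α + Real.logb 2 (1 / β)) ≤ q.τ)
      ⌊polyBound a k (d + C.size d c + 1 / α + Real.logb 2 (1 / β))⌋₊ ∧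
    ∀ O : SQOracle (C.X d), O.IsFor c →
      ENNReal.ofReal (1 - β) ≤ ((A d α β).runSQ O []).toOuterMeasure {h | err c h ≤ α}

/-- All algorithms of the family are nonadaptive, with respect to the answers that can occur for
targets in the class. -/
def SQFamily.IsNonadaptive {C : ConceptClass} (A : SQFamily C) : Prop :=
  ∀ (d : ℕ) (α β : ℝ), Admissible α β →
    (A d α β).Nonadaptive fun q => {v | ∃ c ∈ C.concepts d, v ∈ q.valid c}

/-! ### Local algorithms -/

/-- A randomizer: to an entry of the database it assigns a discrete distribution on messages. -/
abbrev Randomizer (D : Type) := D → PMF (List Bool)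

/-- `R` is an `ε`-local randomizer. -/
def IsLocalRandomizer {D : Type} (ε : ℝ) (R : Randomizer D) : Prop :=
  ∀ u u' w, R u w ≤ ENNReal.ofReal (Real.exp ε) * R u' w

/-- A query to the oracle `LR_z`, where `z` has `n` entries: an index and a randomizer. -/
abbrev LRQuery (D : Type) (n : ℕ) := Fin n × Randomizer D

/-- The answers to a query to `LR_z` that can occur for some database `z`. -/
def LRQuery.reach {D : Type} {n : ℕ} (q : LRQuery D n) : Set (List Bool) :=
  {w | ∃ u, w ∈ (q.2 u).support}

/-- Along every run, the randomizers applied to entry `i` are `ε_j`-local with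
`∑ j, ε_j ≤ budget i`. -/
def Alg.LocalWithin {D H : Type} {n : ℕ} :
    Alg (LRQuery D n) (List Bool) H → (Fin n → ℝ) → Prop
  | .output _, _ => True
  | .sample p k, budget => ∀ i ∈ p.support, (k i).LocalWithin budget
  | .query q k, budget => ∃ e : ℝ, IsLocalRandomizer e q.2 ∧ e ≤ budget q.1 ∧
      ∀ w ∈ LRQuery.reach q,
        (k w).LocalWithin (Function.update budget q.1 (budget q.1 - e))

/-- An `ε`-local algorithm. -/
def Alg.IsLocal {D H : Type} {n : ℕ} (ε : ℝ) (P : Alg (LRQuery D n) (List Bool) H) : Prop :=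
  P.LocalWithin fun _ => ε

/-- The distribution of the output of a local algorithm on the database `z`. -/
noncomputable def Alg.runLR {D H : Type} {n : ℕ} (z : Fin n → D) :
    Alg (LRQuery D n) (List Bool) H → PMF H
  | .output h => PMF.pure h
  | .sample p k => p.bind fun i => (k i).runLR z
  | .query q k => (q.2 (z q.1)).bind fun w => (k w).runLR z

/-- A family of algorithms with access to `LR_z`, one for each choice of the inputs `d`, `ε`, `α`,
`β`, together with the size `n` of the database. -/
structure LocalFamily (C : ConceptClass) where
  n : ℕ → ℝ → ℝ → ℝ → ℕ
  alg : (d : ℕ) → (ε α β : ℝ) →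
    Alg (LRQuery (C.X d × Bool) (n d ε α β)) (List Bool) (C.X d → Bool)

/-- `A` is a local learner for `C` under the uniform distribution. Drawing `n` independent uniform
examples is the same as drawing a uniform element of `X_d ^ n`. -/
def LocalFamily.Learns {C : ConceptClass} (A : LocalFamily C) : Prop :=
  ∃ a k : ℕ, ∀ (d : ℕ) (ε α β : ℝ), 0 < ε → Admissible α β →
    (A.n d ε α β : ℝ) ≤ polyBound a k (d + 1 / ε + 1 / α + Real.logb 2 (1 / β)) ∧
    (A.alg d ε α β).IsLocal ε ∧
    ∀ c ∈ C.concepts d,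
      (A.alg d ε α β).QueriesWithin LRQuery.reach (fun _ => True)
        ⌊polyBound a k (d + C.size d c + 1 / ε + 1 / α + Real.logb 2 (1 / β))⌋₊ ∧
      ENNReal.ofReal (1 - β) ≤
        ((PMF.uniformOfFintype (Fin (A.n d ε α β) → C.X d)).bind fun x =>
          (A.alg d ε α β).runLR fun i => (x i, c (x i))).toOuterMeasure {h | err c h ≤ α}

/-- All algorithms of the family are noninteractive. -/
def LocalFamily.IsNoninteractive {C : ConceptClass} (A : LocalFamily C) : Prop :=
  ∀ (d : ℕ) (ε α β : ℝ), 0 < ε → Admissible α β →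
    (A.alg d ε α β).Nonadaptive LRQuery.reach

/-! ### Machines

Programs work on registers that hold bit strings and are used as stacks, as a multitape Turing
machine uses its tapes. Every elementary step costs one unit of time. -/

/-- Programs. `flip r` pushes a fair coin onto register `r`; `call` puts the question in registers
`0` and `1` to the oracle and stores the answer in register `2`; `test r c₀ c₁ c₂` branches to
`c₀` if register `r` is empty, to `c₁` if its top bit is `false` and to `c₂` if its top bit is
`true`; `loop r c` repeats `c` as long as register `r` is not empty. -/
inductive Cmd
  | skip
  | push (r : ℕ) (b : Bool)
  | pop (r : ℕ)
  | flip (r : ℕ)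
  | call
  | seq (c c' : Cmd)
  | test (r : ℕ) (c₀ c₁ c₂ : Cmd)
  | loop (r : ℕ) (c : Cmd)

/-- The contents of the registers; the top of a stack is the head of the list. -/
abbrev Store := ℕ → List Bool

/-- A configuration: the commands that are still to be executed, and the store. -/
abbrev Cfg := List Cmd × Store

/-- What happens in one step. -/
inductive Step
  | next (c : Cfg)
  | coin (k : Bool → Cfg)
  | ask (q r : List Bool) (k : List Bool → Cfg)

/-- Execution of one elementary step of the command `c`, to be followed by `K`. -/
def Cmd.step (c : Cmd) (K : List Cmd) (s : Store) : Step :=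
  match c with
  | skip => .next (K, s)
  | push r b => .next (K, Function.update s r (b :: s r))
  | pop r => .next (K, Function.update s r (s r).tail)
  | flip r => .coin fun b => (K, Function.update s r (b :: s r))
  | call => .ask (s 0) (s 1) fun w => (K, Function.update s 2 w)
  | seq c c' => .next (c :: c' :: K, s)
  | test r c₀ c₁ c₂ =>
      match s r with
      | [] => .next (c₀ :: K, s)
      | false :: _ => .next (c₁ :: K, s)
      | true :: _ => .next (c₂ :: K, s)
  | loop r c =>
      match s r with
      | [] => .next (K, s)
      | _ :: _ => .next (c :: loop r c :: K, s)

/-- The configuration in which `M` starts on the given inputs, held in registers `0, 1, 2, …`. -/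
def Cmd.init (M : Cmd) (inputs : List (List Bool)) : Cfg := ([M], fun r => inputs.getD r [])

/-- Deterministic computation for at most `T` steps. The output is the final content of register
`0`; there is none if the time does not suffice, a coin is flipped or the oracle is called. -/
def exec : ℕ → Cfg → Option (List Bool)
  | _, ([], s) => some (s 0)
  | 0, (_ :: _, _) => none
  | T + 1, (c :: K, s) =>
      match c.step K s with
      | .next c' => exec T c'
      | .coin _ => none
      | .ask _ _ _ => none

/-- Randomized computation for at most `T` steps: the distribution of the output. -/
noncomputable def execRandom : ℕ → Cfg → PMF (Option (List Bool))
  | _, ([], s) => PMF.pure (some (s 0))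
  | 0, (_ :: _, _) => PMF.pure none
  | T + 1, (c :: K, s) =>
      match c.step K s with
      | .next c' => execRandom T c'
      | .coin k => (PMF.uniformOfFintype Bool).bind fun b => execRandom T (k b)
      | .ask _ _ _ => PMF.pure none

/-- Randomized computation with an oracle for at most `T` steps, as an algorithm that asks pairs of
strings, is answered by strings, and outputs `none` if the time does not suffice. -/
noncomputable def execOracle :
    ℕ → Cfg → Alg (List Bool × List Bool) (List Bool) (Option (List Bool))
  | _, ([], s) => .output (some (s 0))
  | 0, (_ :: _, _) => .output none
  | T + 1, (c :: K, s) =>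
      match c.step K s with
      | .next c' => execOracle T c'
      | .coin k => .sample (PMF.uniformOfFintype Bool) fun b => execOracle T (k b)
      | .ask q r k => .query (q, r) fun w => execOracle T (k w)

/-- The number `n` in unary. -/
def unary (n : ℕ) : List Bool := List.replicate n true

/-- Whether an output string stands for `true`. -/
def accepts (o : Option (List Bool)) : Bool := o.getD [] |>.headD false

open Classical in
/-- The hypothesis on `X` that the string `s` describes when `E` is used to evaluate hypotheses;
`none` if `E` does not evaluate it in time `T` at every example. -/
noncomputable def decodeHyp (E : Cmd) (T : ℕ) (X : Finset (List Bool)) (s : List Bool) :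
    Option (X → Bool) :=
  if ∀ x : X, exec T (E.init [s, x]) ≠ none then
    some fun x => accepts (exec T (E.init [s, x]))
  else none

/-- The message for a machine that carries the answer `v` to a query of tolerance `τ`: the number
`v + 2`, which is positive, rounded down to a multiple of `τ`, as a multiple of `τ` in unary. -/
noncomputable def encodeAnswer (τ v : ℝ) : List Bool := unary ⌊(v + 2) / τ⌋₊

open Classical in
/-- The SQ algorithm on `X` that a computation performs. The machine asks the statistical query with
tolerance `1 / (l + 2)`, where `l` is the length of register `1`, whose function is described by
register `0`. The program `G` evaluates this function on a description, an example and a label, and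
`E` evaluates hypotheses. The outcome is `none` if an evaluation needs more than `T` steps. -/
noncomputable def toSQ (G E : Cmd) (T : ℕ) (X : Finset (List Bool)) :
    Alg (List Bool × List Bool) (List Bool) (Option (List Bool)) →
      Alg (SQQuery X) ℝ (Option (X → Bool))
  | .output o => .output (o.bind (decodeHyp E T X))
  | .sample p k => .sample p fun i => toSQ G E T X (k i)
  | .query q k =>
      if ∀ (x : X) (y : Bool), exec T (G.init [q.1, x, [y]]) ≠ none then
        .query
          { g := fun x y => accepts (exec T (G.init [q.1, x, [y]]))
            τ := 1 / ((q.2.length : ℝ) + 2)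
            τ_pos := by positivity
            τ_lt_one := by
              rw [div_lt_one (by positivity)]
              have : (0 : ℝ) ≤ q.2.length := Nat.cast_nonneg _
              linarith }
          fun v => toSQ G E T X (k (encodeAnswer (1 / ((q.2.length : ℝ) + 2)) v))
      else .output none

open Classical in
/-- The algorithm with access to `LR_z`, for databases with `n` entries in `X × Bool`, that a
computation performs. The machine asks for the entry whose index is the length of register `1`, and
register `0` describes the randomizer. The program `R` evaluates randomizers on a description, an
example and a label, and `E` evaluates hypotheses. The outcome is `none` if the index is out of range
or an evaluation may need more than `T` steps. -/
noncomputable def toLocal (R E : Cmd) (T n : ℕ) (X : Finset (List Bool)) :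
    Alg (List Bool × List Bool) (List Bool) (Option (List Bool)) →
      Alg (LRQuery (X × Bool) n) (List Bool) (Option (X → Bool))
  | .output o => .output (o.bind (decodeHyp E T X))
  | .sample p k => .sample p fun i => toLocal R E T n X (k i)
  | .query q k =>
      if h : q.2.length < n ∧ ∀ u : X × Bool,
          none ∉ (execRandom T (R.init [q.1, u.1, [u.2]])).support then
        .query
          (⟨q.2.length, h.1⟩,
            fun u => (execRandom T (R.init [q.1, u.1, [u.2]])).map fun o => o.getD [])
          fun w => toLocal R E T n X (k w)
      else .output none

/-- The family of SQ algorithms that the program `M` performs with running time `T`. Its inputs are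
`d`, `⌈1/α⌉` and `⌈log₂ (1/β)⌉` in unary. -/
noncomputable def machineSQ (C : ConceptClass) (M G E : Cmd) (T : ℕ → ℝ → ℝ → ℕ)
    (d : ℕ) (α β : ℝ) : Alg (SQQuery (C.X d)) ℝ (Option (C.X d → Bool)) :=
  toSQ G E (T d α β) (C.dom d)
    (execOracle (T d α β)
      (M.init [unary d, unary ⌈1 / α⌉₊, unary ⌈Real.logb 2 (1 / β)⌉₊]))

/-- The SQ learner `A` is efficient: it is implemented by a program, and the running time of this
program and the times to evaluate its queries and its hypotheses are bounded by a polynomial in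
`d`, `1/α` and `log (1/β)`. -/
def SQFamily.IsEfficient {C : ConceptClass} (A : SQFamily C) : Prop :=
  ∃ (M G E : Cmd) (T : ℕ → ℝ → ℝ → ℕ) (a k : ℕ), ∀ (d : ℕ) (α β : ℝ), Admissible α β →
    (T d α β : ℝ) ≤ polyBound a k (d + 1 / α + Real.logb 2 (1 / β)) ∧
    (∀ c ∈ C.concepts d, ∀ O : SQOracle (C.X d), O.IsFor c →
      none ∉ ((machineSQ C M G E T d α β).runSQ O []).support) ∧
    A d α β = (machineSQ C M G E T d α β).mapOutput fun o => o.getD fun _ => false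

/-- The family of algorithms with access to `LR_z` that the program `M` performs with running time
`T`. Its inputs are `d`, `⌈1/ε⌉`, `⌈1/α⌉` and `⌈log₂ (1/β)⌉` in unary. -/
noncomputable def machineLocal (C : ConceptClass) (M R E : Cmd) (T n : ℕ → ℝ → ℝ → ℝ → ℕ)
    (d : ℕ) (ε α β : ℝ) :
    Alg (LRQuery (C.X d × Bool) (n d ε α β)) (List Bool) (Option (C.X d → Bool)) :=
  toLocal R E (T d ε α β) (n d ε α β) (C.dom d)
    (execOracle (T d ε α β)
      (M.init [unary d, unary ⌈1 / ε⌉₊, unary ⌈1 / α⌉₊, unary ⌈Real.logb 2 (1 / β)⌉₊]))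

/-- The local learner `A` is efficient: it is implemented by a program, and the running time of this
program and the times to evaluate its randomizers and its hypotheses are bounded by a polynomial in
`d`, the size of the target, `1/ε`, `1/α` and `log (1/β)`. -/
def LocalFamily.IsEfficient {C : ConceptClass} (A : LocalFamily C) : Prop :=
  ∃ (M R E : Cmd) (T : ℕ → ℝ → ℝ → ℝ → ℕ) (a k : ℕ),
    ∀ (d : ℕ) (ε α β : ℝ), 0 < ε → Admissible α β →
      (∀ c ∈ C.concepts d, (T d ε α β : ℝ) ≤
        polyBound a k (d + C.size d c + 1 / ε + 1 / α + Real.logb 2 (1 / β))) ∧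
      (∀ z, none ∉ ((machineLocal C M R E T A.n d ε α β).runLR z).support) ∧
      A.alg d ε α β =
        (machineLocal C M R E T A.n d ε α β).mapOutput fun o => o.getD fun _ => false

/-! ### Classes of learnable concept classes, under the uniform distribution -/

/-- Concept classes learnable by SQ learners, which may be adaptive. -/
def AdaptiveSQ : Set ConceptClass := {C | ∃ A : SQFamily C, A.Learns}

/-- Concept classes learnable by nonadaptive SQ learners. -/
def NonadaptiveSQ : Set ConceptClass := {C | ∃ A : SQFamily C, A.Learns ∧ A.IsNonadaptive}

/-- Concept classes learnable by local learners, which may be interactive. -/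
def InteractiveLocal : Set ConceptClass := {C | ∃ A : LocalFamily C, A.Learns}

/-- Concept classes learnable by noninteractive local learners. -/
def NoninteractiveLocal : Set ConceptClass :=
  {C | ∃ A : LocalFamily C, A.Learns ∧ A.IsNoninteractive}

/-- Concept classes efficiently learnable by SQ learners, which may be adaptive. -/
def EffAdaptiveSQ : Set ConceptClass := {C | ∃ A : SQFamily C, A.Learns ∧ A.IsEfficient}

/-- Concept classes efficiently learnable by nonadaptive SQ learners. -/
def EffNonadaptiveSQ : Set ConceptClass :=
  {C | ∃ A : SQFamily C, A.Learns ∧ A.IsNonadaptive ∧ A.IsEfficient}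

/-- Concept classes efficiently learnable by local learners, which may be interactive. -/
def EffInteractiveLocal : Set ConceptClass := {C | ∃ A : LocalFamily C, A.Learns ∧ A.IsEfficient}

/-- Concept classes efficiently learnable by noninteractive local learners. -/
def EffNoninteractiveLocal : Set ConceptClass :=
  {C | ∃ A : LocalFamily C, A.Learns ∧ A.IsNoninteractive ∧ A.IsEfficient}

end PrivateLearning

/-!
A masked parity on `n` bits has a secret bit `a` and a secret vector `r`. An example consists of a
mask bit and a payload: if the mask bit is not set, the payload is an index `i` and the label is
`r i`; otherwise it is a vector `x` and the label is `a + ⟨r, x⟩`.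

An adaptive learner first finds the bits of `r`, each of them from a `1 / n` fraction of the
examples, and then asks for `a` with the query that compares the label with `⟨r, x⟩`. Locally, each
answer is a noisy vote, and the majority of polynomially many votes is correct except with
exponentially small probability.

For a nonadaptive learner, the queries do not depend on `r`. Since the parities are orthogonal, by
Bessel's inequality a fixed query, or a fixed local randomizer, distinguishes `a = 0` from `a = 1`
only for an exponentially small fraction of the vectors `r`. The two concepts with the same `r`
disagree on half of the examples, so no hypothesis is accurate for both of them, and for a random
`r` the learner fails with one of them.
-/

namespace PrivateLearning

open scoped BigOperators

/-! ### Execution of programs -/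

/-- Configuration `x` leads to configuration `y` in at most `B` elementary steps, none of which is a
coin flip or an oracle call. -/
inductive Reach : ℕ → Cfg → Cfg → Prop
  | refl (B : ℕ) (x : Cfg) : Reach B x x
  | step {B : ℕ} {c : Cmd} {K : List Cmd} {s : Store} {x y : Cfg} (h : c.step K s = .next x)
      (h' : Reach B x y) : Reach (B + 1) (c :: K, s) y

namespace Reach

theorem mono {B B' : ℕ} {x y : Cfg} (h : Reach B x y) (hB : B ≤ B') : Reach B' x y := by
  induction h generalizing B' with
  | refl => exact .refl _ _
  | step h _ ih =>
    obtain ⟨m, rfl⟩ := Nat.exists_eq_add_of_le' (Nat.one_le_of_lt hB)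
    exact .step h (ih (by omega))

theorem trans {B B' : ℕ} {x y z : Cfg} (h : Reach B x y) (h' : Reach B' y z) :
    Reach (B + B') x z := by
  induction h with
  | refl => exact h'.mono (by omega)
  | step h _ ih => exact (Reach.step h (ih h')).mono (by omega)

theorem seq (c c' : Cmd) (K : List Cmd) (s : Store) :
    Reach 1 (.seq c c' :: K, s) (c :: c' :: K, s) :=
  .step rfl (.refl 0 _)

section Branching

variable {r : ℕ} {c c₀ c₁ c₂ : Cmd} {K : List Cmd} {s : Store}

theorem test_nil (h : s r = []) : Reach 1 (.test r c₀ c₁ c₂ :: K, s) (c₀ :: K, s) :=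
  .step (by simp [Cmd.step, h]) (.refl 0 _)

theorem test_cons {b : Bool} {l : List Bool} (h : s r = b :: l) :
    Reach 1 (.test r c₀ c₁ c₂ :: K, s) (bif b then c₂ :: K else c₁ :: K, s) := by
  cases b <;> exact .step (by simp [Cmd.step, h]) (.refl 0 _)

theorem loop_nil (h : s r = []) : Reach 1 (.loop r c :: K, s) (K, s) :=
  .step (by simp [Cmd.step, h]) (.refl 0 _)

theorem loop_cons (h : s r ≠ []) : Reach 1 (.loop r c :: K, s) (c :: .loop r c :: K, s) := by
  obtain ⟨b, l, hl⟩ := List.exists_cons_of_ne_nil h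
  exact .step (by simp [Cmd.step, hl]) (.refl 0 _)

end Branching

end Reach

/-- The timed execution `F` takes every deterministic step in one unit of time. This holds for all
three modes of execution: `exec`, `execRandom` and `execOracle`. -/
def FollowsSteps {α : Type*} (F : ℕ → Cfg → α) : Prop :=
  ∀ T c K s x, Cmd.step c K s = .next x → F (T + 1) (c :: K, s) = F T x

theorem followsSteps_exec : FollowsSteps exec := fun T c K s x h => by simp [exec, h]

theorem followsSteps_execRandom : FollowsSteps execRandom := fun T c K s x h => by
  simp [execRandom, h]

theorem followsSteps_execOracle : FollowsSteps execOracle := fun T c K s x h => by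
  simp [execOracle, h]

theorem exec_nil (T : ℕ) (s : Store) : exec T ([], s) = some (s 0) := by
  cases T <;> simp [exec]

theorem execRandom_nil (T : ℕ) (s : Store) : execRandom T ([], s) = PMF.pure (some (s 0)) := by
  cases T <;> simp [execRandom]

theorem execOracle_nil (T : ℕ) (s : Store) : execOracle T ([], s) = .output (some (s 0)) := by
  cases T <;> simp [execOracle]

/-- The result of the execution `F` of the configuration `x` satisfies `P` as soon as the time
allotted to it is at least `B`. -/
def Ensures {α : Type*} (F : ℕ → Cfg → α) (B : ℕ) (x : Cfg) (P : α → Prop) : Prop :=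
  ∀ T, B ≤ T → P (F T x)

theorem Ensures.mono {α : Type*} {F : ℕ → Cfg → α} {B B' : ℕ} {x : Cfg} {P : α → Prop}
    (h : Ensures F B x P) (hB : B ≤ B') : Ensures F B' x P :=
  fun T hT => h T (hB.trans hT)

theorem Reach.ensures {α : Type*} {F : ℕ → Cfg → α} {t B : ℕ} {x y : Cfg} {P : α → Prop}
    (hxy : Reach t x y) (hF : FollowsSteps F) (hy : Ensures F B y P) :
    Ensures F (t + B) x P := by
  induction hxy with
  | refl => exact hy.mono (by omega)
  | step h _ ih =>
    intro T hT
    obtain ⟨T, rfl⟩ := Nat.exists_eq_add_of_le' (show 1 ≤ T by omega)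
    rw [hF _ _ _ _ _ h]
    exact ih hy T (by omega)

/-- The command `c` turns the store `s` into the store `s'` in at most `B` deterministic steps. -/
def Runs (c : Cmd) (s s' : Store) (B : ℕ) : Prop := ∀ K, Reach B (c :: K, s) (K, s')

namespace Runs

theorem mono {c : Cmd} {s s' : Store} {B B' : ℕ} (h : Runs c s s' B) (hB : B ≤ B') :
    Runs c s s' B' := fun K => (h K).mono hB

theorem congr_right {c : Cmd} {s s' s'' : Store} {B : ℕ} (h : Runs c s s' B) (hs : s' = s'') :
    Runs c s s'' B := hs ▸ h

theorem seq {c c' : Cmd} {s s' s'' : Store} {B B' : ℕ} (h : Runs c s s' B)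
    (h' : Runs c' s' s'' B') : Runs (.seq c c') s s'' (B + B' + 1) :=
  fun K => ((Reach.seq c c' K s).trans ((h _).trans (h' K))).mono (by omega)

theorem loop_nil {r : ℕ} {c : Cmd} {s : Store} (h : s r = []) : Runs (.loop r c) s s 1 :=
  fun _ => .loop_nil h

theorem loop_cons {r : ℕ} {c : Cmd} {s s' s'' : Store} {B B' : ℕ} (h : s r ≠ [])
    (h1 : Runs c s s' B) (h2 : Runs (.loop r c) s' s'' B') :
    Runs (.loop r c) s s'' (B + B' + 1) :=
  fun K => ((Reach.loop_cons h).trans ((h1 _).trans (h2 K))).mono (by omega)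

end Runs

/-- Whether a command is free of loops, coins and oracle calls. -/
def Cmd.isStraight : Cmd → Bool
  | .skip => true
  | .push _ _ => true
  | .pop _ => true
  | .flip _ => false
  | .call => false
  | .seq c c' => c.isStraight && c'.isStraight
  | .test _ c₀ c₁ c₂ => c₀.isStraight && c₁.isStraight && c₂.isStraight
  | .loop _ _ => false

/-- The effect of a straight command on the store; junk for other commands. -/
def Cmd.eval : Cmd → Store → Store
  | .push r b, s => Function.update s r (b :: s r)
  | .pop r, s => Function.update s r (s r).tail
  | .seq c c', s => c'.eval (c.eval s)
  | .test r c₀ c₁ c₂, s =>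
      match s r with
      | [] => c₀.eval s
      | false :: _ => c₁.eval s
      | true :: _ => c₂.eval s
  | _, s => s

/-- A bound on the running time of a straight command. It adds up all the branches of a test. -/
def Cmd.cost : Cmd → ℕ
  | .seq c c' => c.cost + c'.cost + 1
  | .test _ c₀ c₁ c₂ => c₀.cost + c₁.cost + c₂.cost + 1
  | _ => 1

theorem Cmd.runs_eval {c : Cmd} (h : c.isStraight) (s : Store) : Runs c s (c.eval s) c.cost := by
  induction c generalizing s with
  | skip | push r b | pop r => exact fun K => .step rfl (.refl _ _)
  | flip r | call | loop r c => simp [Cmd.isStraight] at h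
  | seq c c' ih ih' =>
    simp only [Cmd.isStraight, Bool.and_eq_true] at h
    exact (ih h.1 s).seq (ih' h.2 _)
  | test r c₀ c₁ c₂ ih₀ ih₁ ih₂ =>
    simp only [Cmd.isStraight, Bool.and_eq_true] at h
    intro K
    rcases hs : s r with _ | ⟨_ | _, l⟩ <;> simp only [Cmd.eval, Cmd.cost, hs]
    · exact ((Reach.test_nil hs).trans (ih₀ h.1.1 s K)).mono (by omega)
    · exact ((Reach.test_cons hs).trans (ih₁ h.1.2 s K)).mono (by omega)
    · exact ((Reach.test_cons hs).trans (ih₂ h.2 s K)).mono (by omega)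

theorem Cmd.runs_of_eval_eq {c : Cmd} {s s' : Store} {B : ℕ} (h : c.isStraight)
    (hs : c.eval s = s') (hB : c.cost ≤ B) : Runs c s s' B :=
  ((c.runs_eval h s).congr_right hs).mono hB

/-- The store whose first registers have the given contents, and whose other registers are empty. -/
def st (l : List (List Bool)) : Store := fun r => l.getD r []

theorem st_apply (l : List (List Bool)) (r : ℕ) : st l r = l.getD r [] := rfl

theorem update_st {l : List (List Bool)} {r : ℕ} (h : r < l.length) (v : List Bool) :
    Function.update (st l) r v = st (l.set r v) := by
  funext i
  rcases eq_or_ne i r with rfl | hi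
  · simp [st, h]
  · simp [st, hi, hi.symm]

/-- The registers that hold no input may be listed explicitly, so that `update_st` applies. -/
theorem Cmd.init_eq_st (M : Cmd) (inputs : List (List Bool)) (m : ℕ) :
    M.init inputs = ([M], st (inputs ++ List.replicate m [])) := by
  simp only [Cmd.init, Prod.mk.injEq, true_and]
  funext r
  simp only [st, List.getD_eq_getElem?_getD, List.getElem?_append, List.getElem?_replicate]
  split_ifs <;> simp_all

/-! ### Elementary programs -/

/-- Pop the bits of register `a` one after the other, and run `f b` for each popped bit `b`. -/
def forEach (a : ℕ) (f : Bool → Cmd) : Cmd :=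
  .loop a (.test a .skip (.seq (.pop a) (f false)) (.seq (.pop a) (f true)))

/-- In the invariant `S p l`, the bits `p` have been processed, the last one first, and the bits `l`
are still in register `a`. -/
theorem runs_forEach {a B : ℕ} {f : Bool → Cmd} (S : List Bool → List Bool → Store)
    (hS : ∀ p l, S p l a = l)
    (hf : ∀ b p l, Runs (f b) (Function.update (S p (b :: l)) a l) (S (b :: p) l) B)
    (p l : List Bool) :
    Runs (forEach a f) (S p l) (S (l.reverse ++ p) []) ((B + 4) * l.length + 1) := by
  induction l generalizing p with
  | nil => exact (Runs.loop_nil (hS p [])).mono (by simp)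
  | cons b l ih =>
    have hpop : Runs (.seq (.pop a) (f b)) (S p (b :: l)) (S (b :: p) l) (B + 2) :=
      ((Cmd.runs_of_eval_eq (c := .pop a) rfl (by simp [Cmd.eval, hS]) le_rfl).seq
        (hf b p l)).mono (by simp [Cmd.cost]; omega)
    have hbody : Runs (.test a .skip (.seq (.pop a) (f false)) (.seq (.pop a) (f true)))
        (S p (b :: l)) (S (b :: p) l) (B + 3) := fun K => by
      cases b <;> exact ((Reach.test_cons (hS p _)).trans (hpop K)).mono (by omega)
    refine ((Runs.loop_cons (by simp [hS]) hbody (ih (b :: p))).congr_right ?_).mono ?_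
    · simp
    · simp only [List.length_cons]
      linarith

/-- Empty the register `r`. -/
def clear (r : ℕ) : Cmd := forEach r fun _ => .skip

theorem runs_clear (r : ℕ) (s : Store) :
    Runs (clear r) s (Function.update s r []) (5 * (s r).length + 1) := by
  have h := runs_forEach (a := r) (f := fun _ => .skip) (fun _ l => Function.update s r l) (by simp)
    (fun _ _ _ => Cmd.runs_of_eval_eq rfl (by simp [Cmd.eval]) le_rfl) [] (s r)
  simpa [clear, Cmd.cost] using h

/-- Move the register `a` to `b`, in reverse order. -/
def moveRev (a b : ℕ) : Cmd := forEach a (.push b)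

theorem runs_moveRev {a b : ℕ} (hab : a ≠ b) (s : Store) :
    Runs (moveRev a b) s (Function.update (Function.update s a []) b ((s a).reverse ++ s b))
      (5 * (s a).length + 1) := by
  have h := runs_forEach (a := a) (f := .push b)
    (fun p l => Function.update (Function.update s a l) b (p ++ s b)) (by simp [hab])
    (fun _ _ _ => Cmd.runs_of_eval_eq rfl (by
      simp [Cmd.eval, Function.update_comm hab.symm]) le_rfl) [] (s a)
  simpa [moveRev, Cmd.cost] using h

/-- Move the register `a` to both `b` and `c`, in reverse order. -/
def moveRevBoth (a b c : ℕ) : Cmd := forEach a fun v => .seq (.push b v) (.push c v)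

theorem runs_moveRevBoth {a b c : ℕ} (hab : a ≠ b) (hac : a ≠ c) (hbc : b ≠ c) (s : Store) :
    Runs (moveRevBoth a b c) s (Function.update (Function.update (Function.update s a []) b
      ((s a).reverse ++ s b)) c ((s a).reverse ++ s c)) (7 * (s a).length + 1) := by
  have h := runs_forEach (a := a) (B := 3) (f := fun v => .seq (.push b v) (.push c v))
    (fun p l => Function.update (Function.update (Function.update s a l) b (p ++ s b)) c (p ++ s c))
    (by simp [hab, hac])
    (fun _ _ _ => Cmd.runs_of_eval_eq rfl (by
      simp [Cmd.eval, hab.symm, hac.symm, hbc.symm, Function.update_comm hab,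
        Function.update_comm hac, Function.update_comm hbc]) le_rfl) [] (s a)
  simpa [moveRevBoth, Cmd.cost] using h

/-- Put a copy of register `a` in front of the contents of `b`, using the empty register `t`. -/
def prepend (a t b : ℕ) : Cmd := .seq (moveRev a t) (moveRevBoth t a b)

theorem runs_prepend {a t b : ℕ} (hat : a ≠ t) (hab : a ≠ b) (htb : t ≠ b) {s : Store}
    (ht : s t = []) :
    Runs (prepend a t b) s (Function.update s b (s a ++ s b)) (12 * (s a).length + 3) := by
  have hmove := (runs_moveRev hat s).seq (runs_moveRevBoth hat.symm htb hab _)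
  refine (hmove.congr_right ?_).mono ?_
  · funext i
    simp only [Function.update_apply]
    split_ifs <;> simp_all
  · simp only [ht, Function.update_self, List.append_nil, List.length_reverse]
    omega

/-! ### Masked parities -/

/-- The inner product modulo two of two bit strings, of which the longer one is truncated. -/
def dot : List Bool → List Bool → Bool
  | a :: s, b :: x => xor (a && b) (dot s x)
  | _, _ => false

@[simp] theorem dot_nil_left (x : List Bool) : dot [] x = false := by simp [dot]

@[simp] theorem dot_nil_right (s : List Bool) : dot s [] = false := by cases s <;> simp [dot]

@[simp] theorem dot_cons (a b : Bool) (s x : List Bool) :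
    dot (a :: s) (b :: x) = xor (a && b) (dot s x) := rfl

theorem dot_append {s x : List Bool} (h : s.length ≤ x.length) (y : List Bool) :
    dot s (x ++ y) = dot s x := by
  induction s generalizing x with
  | nil => simp
  | cons a s ih =>
    cases x with
    | nil => simp at h
    | cons b x => simp [ih (by simpa using h)]

theorem dot_replicate_false (n : ℕ) (s : List Bool) : dot s (List.replicate n false) = false := by
  induction n generalizing s with
  | zero => simp
  | succ n ih => cases s <;> simp [List.replicate_succ, ih]

/-- The unit vector with a one at `i`, as a bit string. -/
def unitVec {n : ℕ} (i : Fin n) : List Bool := List.ofFn fun j => decide (j = i)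

theorem length_unitVec {n : ℕ} (i : Fin n) : (unitVec i).length = n := by simp [unitVec]

theorem unitVec_injective {n : ℕ} : Function.Injective (unitVec (n := n)) := by
  intro i j h
  simpa using congrFun (List.ofFn_injective h) i

theorem dot_ofFn_unitVec {n : ℕ} (r : Fin n → Bool) (i : Fin n) :
    dot (List.ofFn r) (unitVec i) = r i := by
  unfold unitVec
  induction n with
  | zero => exact i.elim0
  | succ n ih =>
    refine Fin.cases ?_ (fun i => ?_) i
    · simp [List.ofFn_succ, Fin.succ_ne_zero, dot_replicate_false]
    · simp [List.ofFn_succ, (Fin.succ_ne_zero i).symm, ih (fun j => r j.succ) i]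

/-- The string `0 … 0 1` that selects the entry `i` of another string, by `dot_selector`. -/
def selector (i : ℕ) : List Bool := List.replicate i false ++ [true]

theorem dot_selector (i : ℕ) (x : List Bool) : dot (selector i) x = x.getD i false := by
  unfold selector
  induction i generalizing x with
  | zero => cases x <;> simp
  | succ i ih => cases x <;> simp [List.replicate_succ, ih]

/-- The points of the domain, before they are encoded: a mask bit, an index and a vector. -/
abbrev MaskedPoint (n : ℕ) : Type := Bool × Fin n × (Fin n → Bool)

/-- The string that encodes a point. It starts with the mask bit. If this is set, the vector comes
next and the index serves as padding; otherwise it is the other way around. -/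
def maskedString {n : ℕ} (u : MaskedPoint n) : List Bool :=
  u.1 :: if u.1 then List.ofFn u.2.2 ++ unitVec u.2.1 else unitVec u.2.1 ++ List.ofFn u.2.2

theorem length_maskedString {n : ℕ} (u : MaskedPoint n) : (maskedString u).length = 2 * n + 1 := by
  unfold maskedString
  split_ifs <;> simp [length_unitVec] <;> omega

theorem maskedString_injective {n : ℕ} : Function.Injective (maskedString (n := n)) := by
  rintro ⟨b, i, x⟩ ⟨b', i', x'⟩ h
  simp only [maskedString, List.cons.injEq] at h
  obtain ⟨rfl, h⟩ := h
  cases b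
  · obtain ⟨hi, hx⟩ := List.append_inj (by simpa using h) (by simp [length_unitVec])
    rw [unitVec_injective hi, List.ofFn_injective hx]
  · obtain ⟨hx, hi⟩ := List.append_inj (by simpa using h) (by simp)
    rw [unitVec_injective hi, List.ofFn_injective hx]

/-- The masked parity with secret vector `r` and constant term `a`. -/
def maskedValue {n : ℕ} (a : Bool) (r : Fin n → Bool) (u : MaskedPoint n) : Bool :=
  if u.1 then xor a (dot (List.ofFn r) (List.ofFn u.2.2)) else r u.2.1

theorem dot_maskedString {n : ℕ} (a : Bool) (r : Fin n → Bool) (u : MaskedPoint n) :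
    dot (a :: List.ofFn r) (maskedString u) = maskedValue a r u := by
  obtain ⟨_ | _, i, x⟩ := u
  · simp [maskedString, maskedValue, dot_append, length_unitVec, dot_ofFn_unitVec]
  · simp [maskedString, maskedValue, dot_append]

/-- The number of secret bits of a masked parity, apart from the constant term. -/
def dim (d : ℕ) : ℕ := (d - 1) / 2

theorem two_mul_dim_le (d : ℕ) : 2 * dim d ≤ d := by
  unfold dim
  omega

theorem dim_two_mul_add_one (n : ℕ) : dim (2 * n + 1) = n := by
  unfold dim
  omega

/-- The class of masked parities. The concept with representation `a :: r` has the value `r i` at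
points with index `i` whose mask bit is not set, and the value `a + ⟨r, x⟩` at points with vector
`x` whose mask bit is set. -/
def maskedParity : ConceptClass where
  dom d := if dim d = 0 then {[]} else Finset.univ.image (maskedString (n := dim d))
  dom_nonempty d := by
    split_ifs with h
    · simp
    · have : NeZero (dim d) := ⟨h⟩
      simp
  dom_length d x hx := by
    split_ifs at hx with h
    · simp_all
    · obtain ⟨u, -, rfl⟩ := Finset.mem_image.1 hx
      rw [length_maskedString]
      unfold dim at h ⊢
      omega
  rep d s := if dim d ≠ 0 ∧ s.length = dim d + 1 then some fun x => dot s x else none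

theorem maskedParity_rep (d : ℕ) (s : List Bool) : maskedParity.rep d s =
    if dim d ≠ 0 ∧ s.length = dim d + 1 then some (fun x => dot s x.1) else none := rfl

theorem maskedParity_mem_concepts {d : ℕ} {c : maskedParity.X d → Bool} :
    c ∈ maskedParity.concepts d ↔
      dim d ≠ 0 ∧ ∃ s : List Bool, s.length = dim d + 1 ∧ c = fun x => dot s x.1 := by
  change (∃ s, maskedParity.rep d s = some c) ↔ _
  simp only [maskedParity_rep, Option.ite_none_right_eq_some, Option.some.injEq, and_assoc,
    exists_and_left, eq_comm (b := c)]

theorem maskedParity_size_le {d : ℕ} {c : maskedParity.X d → Bool}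
    (h : c ∈ maskedParity.concepts d) : maskedParity.size d c ≤ d := by
  obtain ⟨hd, s, hs, rfl⟩ := maskedParity_mem_concepts.1 h
  have hle : maskedParity.size d (fun x => dot s x.1) ≤ s.length :=
    Nat.sInf_le ⟨s, by rw [maskedParity_rep, if_pos ⟨hd, hs⟩], rfl⟩
  unfold dim at hd hs
  omega

/-- The correspondence between points and their encodings. -/
noncomputable def maskedEquiv (d : ℕ) (h : dim d ≠ 0) :
    MaskedPoint (dim d) ≃ maskedParity.X d :=
  (Equiv.ofInjective _ (maskedString_injective (n := dim d))).trans
    (Equiv.subtypeEquivRight fun x => by simp [maskedParity, h])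

theorem coe_maskedEquiv {d : ℕ} (h : dim d ≠ 0) (u : MaskedPoint (dim d)) :
    (maskedEquiv d h u : List Bool) = maskedString u := rfl

/-! ### Parities are orthogonal -/

/-- The sign that belongs to a bit. -/
def sign (b : Bool) : ℝ := if b then -1 else 1

theorem sign_xor (a b : Bool) : sign (xor a b) = sign a * sign b := by
  cases a <;> cases b <;> simp [sign]

/-- The character of the group of bit vectors that belongs to `r`. -/
def character {n : ℕ} (r x : Fin n → Bool) : ℝ := sign (dot (List.ofFn r) (List.ofFn x))

theorem character_eq_prod {n : ℕ} (r x : Fin n → Bool) :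
    character r x = ∏ j, sign (r j && x j) := by
  unfold character
  induction n with
  | zero => simp [sign]
  | succ n ih => simp [List.ofFn_succ, sign_xor, ih, Fin.prod_univ_succ]

theorem sum_character_mul_character {n : ℕ} (x y : Fin n → Bool) :
    ∑ r, character r x * character r y = if x = y then 2 ^ n else 0 := by
  simp only [character_eq_prod, ← Finset.prod_mul_distrib]
  rw [← Fintype.prod_sum (fun j (b : Bool) => sign (b && x j) * sign (b && y j))]
  split_ifs with h
  · subst h
    have hfactor (j : Fin n) : ∑ b, sign (b && x j) * sign (b && x j) = 2 := by
      cases x j <;> norm_num [sign]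
    rw [Finset.prod_congr rfl fun j _ => hfactor j]
    simp
  · obtain ⟨j, hj⟩ := Function.ne_iff.1 h
    refine Finset.prod_eq_zero (Finset.mem_univ j) ?_
    revert hj
    cases x j <;> cases y j <;> simp [sign]

theorem sum_sq_expect_character_mul {n : ℕ} (F : (Fin n → Bool) → ℝ) :
    ∑ r, (𝔼 x, character r x * F x) ^ 2 = 𝔼 x, F x ^ 2 := by
  have hsum : ∑ r, (∑ x, character r x * F x) ^ 2 = 2 ^ n * ∑ x, F x ^ 2 := calc
    _ = ∑ r, ∑ x, ∑ y, F x * F y * (character r x * character r y) := by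
      refine Finset.sum_congr rfl fun r _ => ?_
      rw [sq, Finset.sum_mul_sum]
      exact Finset.sum_congr rfl fun x _ => Finset.sum_congr rfl fun y _ => by ring
    _ = ∑ x, ∑ y, F x * F y * ∑ r, character r x * character r y := by
      rw [Finset.sum_comm]
      refine Finset.sum_congr rfl fun x _ => ?_
      rw [Finset.sum_comm]
      simp only [Finset.mul_sum]
    _ = _ := by
      simp only [sum_character_mul_character, mul_ite, mul_zero, Finset.sum_ite_eq,
        Finset.mem_univ, if_true, Finset.mul_sum]
      exact Finset.sum_congr rfl fun x _ => by ring
  simp only [Fintype.expect_eq_sum_div_card, div_pow, ← Finset.sum_div, hsum, Fintype.card_pi,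
    Fintype.card_bool, Finset.prod_const, Finset.card_univ, Fintype.card_fin]
  push_cast
  field_simp

theorem expect_maskedPoint {n : ℕ} (f : MaskedPoint n → ℝ) :
    𝔼 u, f u = ((𝔼 x, 𝔼 i, f (true, i, x)) + 𝔼 x, 𝔼 i, f (false, i, x)) / 2 := by
  rw [← Finset.univ_product_univ, Finset.expect_product]
  simp only [← Finset.univ_product_univ, Finset.expect_product]
  rw [Fintype.expect_eq_sum_div_card, Fintype.sum_bool, Fintype.card_bool, Nat.cast_ofNat]
  congr 2 <;> exact Finset.expect_comm ..

section Target

variable {X : Type} [Fintype X] {n : ℕ} (e : MaskedPoint n ≃ X)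

/-- The masked parity with constant term `a` and secret vector `r`, on a copy of the domain. -/
def target (a : Bool) (r : Fin n → Bool) (x : X) : Bool := maskedValue a r (e.symm x)

theorem expect_target (f : X → Bool → ℝ) (a : Bool) (r : Fin n → Bool) :
    𝔼 x, f x (target e a r x) = 𝔼 u, f (e u) (maskedValue a r u) :=
  (Fintype.expect_equiv e _ _ fun u => by simp [target]).symm

theorem expect_target_sub_expect_target (f : X → Bool → ℝ) (r : Fin n → Bool) :
    (𝔼 x, f x (target e false r x)) - 𝔼 x, f x (target e true r x) =
      (𝔼 x, character r x * 𝔼 i, (f (e (true, i, x)) false - f (e (true, i, x)) true)) / 2 := by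
  have hmasked (i : Fin n) (x : Fin n → Bool) :
      f (e (true, i, x)) (maskedValue false r (true, i, x)) -
        f (e (true, i, x)) (maskedValue true r (true, i, x)) =
      character r x * (f (e (true, i, x)) false - f (e (true, i, x)) true) := by
    simp only [maskedValue, if_true, character]
    cases dot (List.ofFn r) (List.ofFn x) <;> simp [sign]
  have hunmasked (i : Fin n) (x : Fin n → Bool) :
      maskedValue false r (false, i, x) = maskedValue true r (false, i, x) := by simp [maskedValue]
  simp_rw [Finset.mul_expect, ← hmasked, Finset.expect_sub_distrib, expect_target,
    expect_maskedPoint, hunmasked]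
  ring

/-- This is Bessel's inequality: the bound holds for the sum over `r`, and not just for its mean. -/
theorem sum_sq_expect_target_sub_le [NeZero n] {f : X → Bool → ℝ} {M : ℝ}
    (hM : ∀ x, |f x false - f x true| ≤ M) :
    ∑ r, ((𝔼 x, f x (target e false r x)) - 𝔼 x, f x (target e true r x)) ^ 2 ≤ M ^ 2 / 4 := by
  have hF (x : Fin n → Bool) :
      (𝔼 i, (f (e (true, i, x)) false - f (e (true, i, x)) true)) ^ 2 ≤ M ^ 2 :=
    sq_le_sq' (neg_le.1 <| (neg_le_abs _).trans <| (Finset.abs_expect_le _ _).trans <|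
        Finset.expect_le Finset.univ_nonempty fun i _ => hM _) <|
      (le_abs_self _).trans <| (Finset.abs_expect_le _ _).trans <|
        Finset.expect_le Finset.univ_nonempty fun i _ => hM _
  simp only [expect_target_sub_expect_target, div_pow]
  rw [← Finset.sum_div, sum_sq_expect_character_mul]
  have hmean := Finset.expect_le Finset.univ_nonempty fun x _ => hF x
  linarith

theorem err_eq_expect (c h : X → Bool) : err c h = 𝔼 x, if h x ≠ c x then (1 : ℝ) else 0 := by
  rw [err, Fintype.expect_eq_sum_div_card, Finset.sum_boole]

/-- At every point with mask bit set, `h` errs for exactly one of the two values of the constant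
term. -/
theorem half_le_err_add_err [NeZero n] (r : Fin n → Bool) (h : X → Bool) :
    1 / 2 ≤ err (target e false r) h + err (target e true r) h := by
  have hmask : 𝔼 u : MaskedPoint n, (if u.1 then (1 : ℝ) else 0) = 1 / 2 := by
    simp [expect_maskedPoint]
  simp only [err_eq_expect, expect_target e fun x b => if h x ≠ b then (1 : ℝ) else 0]
  rw [← hmask, ← Finset.expect_add_distrib]
  refine Finset.expect_le_expect fun ⟨b, i, x⟩ _ => ?_
  cases b
  · simp only [Bool.false_eq_true, if_false]
    positivity
  · simp only [maskedValue, if_true]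
    cases h (e (true, i, x)) <;> cases dot (List.ofFn r) (List.ofFn x) <;> simp

end Target

/-! ### Success probabilities over all targets -/

theorem toOuterMeasure_add_le_one {H : Type*} (p : PMF H) {S S' : Set H} (h : Disjoint S S') :
    p.toOuterMeasure S + p.toOuterMeasure S' ≤ 1 := by
  rw [PMF.toOuterMeasure_apply, PMF.toOuterMeasure_apply, ← ENNReal.tsum_add, ← p.tsum_coe]
  refine ENNReal.tsum_le_tsum fun x => ?_
  by_cases hx : x ∈ S
  · simp [hx, Set.disjoint_left.1 h hx]
  · simpa [hx] using Set.indicator_le_self _ _ x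

theorem toOuterMeasure_le_one {H : Type*} (p : PMF H) (S : Set H) : p.toOuterMeasure S ≤ 1 := by
  simpa using toOuterMeasure_add_le_one p (disjoint_bot_right (a := S))

theorem bind_congr_of_mem_support {α β : Type*} {p : PMF α} {f g : α → PMF β}
    (h : ∀ i ∈ p.support, f i = g i) : p.bind f = p.bind g := by
  ext b
  rw [PMF.bind_apply, PMF.bind_apply]
  refine tsum_congr fun i => ?_
  by_cases hi : i ∈ p.support
  · rw [h i hi]
  · rw [(p.apply_eq_zero_iff i).2 hi, zero_mul, zero_mul]

theorem tsum_mul_le_of_mem_support {α : Type*} {p : PMF α} {f : α → ENNReal} {b : ENNReal}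
    (h : ∀ i ∈ p.support, f i ≤ b) : ∑' i, p i * f i ≤ b := by
  calc ∑' i, p i * f i ≤ ∑' i, p i * b := by
        refine ENNReal.tsum_le_tsum fun i => ?_
        by_cases hi : i ∈ p.support
        · gcongr
          exact h i hi
        · simp [(p.apply_eq_zero_iff i).2 hi]
    _ = b := by rw [ENNReal.tsum_mul_right, p.tsum_coe, one_mul]

namespace Alg

variable {Q A H : Type} {reach : Q → Set A}

theorem Nonadaptive.le_of_forall_asksList {V : Alg Q A H → ENNReal} {b : ENNReal}
    {good : Alg Q A H → Prop}
    (hV : ∀ {ι : Type} (p : PMF ι) (k : ι → Alg Q A H), V (.sample p k) = ∑' i, p i * V (k i))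
    (hgood : ∀ {ι : Type} (p : PMF ι) (k : ι → Alg Q A H), good (.sample p k) →
      ∀ i ∈ p.support, good (k i))
    (h : ∀ qs P, P.AsksList reach qs → good P → V P ≤ b)
    {P : Alg Q A H} (hP : P.Nonadaptive reach) (hPgood : good P) : V P ≤ b := by
  induction hP with
  | ask qs P hP => exact h qs P hP hPgood
  | sample p k _ ih =>
    rw [hV]
    exact tsum_mul_le_of_mem_support fun i hi => ih i hi (hgood p k hPgood i hi)

theorem QueriesWithin.mono {ok ok' : Q → Prop} {P : Alg Q A H} {t t' : ℕ}
    (hok : 0 < t → ∀ q, ok q → ok' q) (ht : t ≤ t')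
    (h : P.QueriesWithin reach ok t) : P.QueriesWithin reach ok' t' := by
  induction P generalizing t t' with
  | output _ => trivial
  | sample p k ih => exact fun i hi => ih i hok ht (h i hi)
  | query q k ih =>
    obtain _ | t := t
    · exact h.elim
    · obtain ⟨t', rfl⟩ := Nat.exists_eq_add_of_le' (Nat.one_le_of_lt ht)
      exact ⟨hok (by omega) q h.1, fun a ha => ih a (fun _ => hok (by omega)) (by omega) (h.2 a ha)⟩

theorem AsksList.length_le {reach' : Q → Set A} {ok : Q → Prop}
    (hr : ∀ q, (reach' q ∩ reach q).Nonempty) {qs : List Q} {P : Alg Q A H}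
    (hP : P.AsksList reach qs) {t : ℕ} (h : P.QueriesWithin reach' ok t) :
    qs.length ≤ t ∧ ∀ q ∈ qs, ok q := by
  induction hP generalizing t with
  | output h => simp
  | sample p k _ _ => simp
  | query q qs k _ ih =>
    obtain _ | t := t
    · exact h.elim
    · obtain ⟨a, ha', ha⟩ := hr q
      obtain ⟨hlen, hok⟩ := ih a ha (h.2 a ha')
      exact ⟨by simpa using hlen, by simpa using ⟨h.1, hok⟩⟩

end Alg

section Success

variable {X : Type} [Fintype X] {n : ℕ} (e : MaskedPoint n ≃ X)

theorem disjoint_err_le [NeZero n] (r : Fin n → Bool) :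
    Disjoint {h | err (target e false r) h ≤ 1 / 5} {h | err (target e true r) h ≤ 1 / 5} := by
  rw [Set.disjoint_left]
  intro h (hfalse : err (target e false r) h ≤ 1 / 5) (htrue : err (target e true r) h ≤ 1 / 5)
  linarith [half_le_err_add_err e r h]

/-- The sum over all masked parities of the probability that the hypothesis has error at most `1/5`,
if `μ r a` is the distribution of the hypothesis for the target with secret vector `r` and constant
term `a`. -/
noncomputable def totalSuccess (μ : (Fin n → Bool) → Bool → PMF (X → Bool)) : ENNReal :=
  ∑ r, ((μ r false).toOuterMeasure {h | err (target e false r) h ≤ 1 / 5} +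
    (μ r true).toOuterMeasure {h | err (target e true r) h ≤ 1 / 5})

theorem totalSuccess_bind {ι : Type*} (p : PMF ι)
    (μ : ι → (Fin n → Bool) → Bool → PMF (X → Bool)) :
    totalSuccess e (fun r a => p.bind fun i => μ i r a) = ∑' i, p i * totalSuccess e (μ i) := by
  simp only [totalSuccess, PMF.toOuterMeasure_bind_apply, ← ENNReal.tsum_add, ← mul_add,
    Finset.mul_sum]
  exact (Summable.tsum_finsetSum fun _ _ => ENNReal.summable).symm

theorem le_totalSuccess {μ : (Fin n → Bool) → Bool → PMF (X → Bool)}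
    (h : ∀ r a, ENNReal.ofReal (1 - 1 / 5) ≤
      (μ r a).toOuterMeasure {h | err (target e a r) h ≤ 1 / 5}) :
    ENNReal.ofReal (8 / 5 * 2 ^ n) ≤ totalSuccess e μ := by
  calc ENNReal.ofReal (8 / 5 * 2 ^ n)
      = ∑ _ : Fin n → Bool, (ENNReal.ofReal (1 - 1 / 5) + ENNReal.ofReal (1 - 1 / 5)) := by
        rw [← ENNReal.ofReal_add (by norm_num) (by norm_num), Finset.sum_const, nsmul_eq_mul,
          ← ENNReal.ofReal_natCast, ← ENNReal.ofReal_mul (by positivity)]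
        congr 1
        simp only [Finset.card_univ, Fintype.card_pi, Fintype.card_bool, Finset.prod_const,
          Fintype.card_fin, Nat.cast_pow, Nat.cast_ofNat]
        ring
    _ ≤ _ := Finset.sum_le_sum fun r _ => add_le_add (h r _) (h r _)

/-- Beyond the `2 ^ n` successes of a learner that guesses the constant term, `δ r` bounds what the
learner gains from information on the constant term if the secret vector is `r`. -/
theorem totalSuccess_le {μ : (Fin n → Bool) → Bool → PMF (X → Bool)} {δ : (Fin n → Bool) → ENNReal}
    (h : ∀ r, (μ r false).toOuterMeasure {h | err (target e false r) h ≤ 1 / 5} +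
      (μ r true).toOuterMeasure {h | err (target e true r) h ≤ 1 / 5} ≤ 1 + δ r)
    {b : ℝ} (hb : 0 ≤ b) (hδ : ∑ r, δ r ≤ ENNReal.ofReal b) :
    totalSuccess e μ ≤ ENNReal.ofReal (2 ^ n + b) := by
  calc totalSuccess e μ ≤ ∑ r, (1 + δ r) := Finset.sum_le_sum fun r _ => h r
    _ = 2 ^ n + ∑ r, δ r := by simp [Finset.sum_add_distrib]
    _ ≤ 2 ^ n + ENNReal.ofReal b := by gcongr
    _ = ENNReal.ofReal (2 ^ n + b) := by
      rw [ENNReal.ofReal_add (by positivity) hb, ENNReal.ofReal_pow zero_le_two,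
        ENNReal.ofReal_ofNat]

end Success

theorem target_maskedEquiv {d : ℕ} (hd : dim d ≠ 0) (a : Bool) (r : Fin (dim d) → Bool) :
    target (maskedEquiv d hd) a r = fun x => dot (a :: List.ofFn r) x.1 := by
  funext x
  obtain ⟨u, rfl⟩ := (maskedEquiv d hd).surjective x
  rw [target, Equiv.symm_apply_apply, coe_maskedEquiv, dot_maskedString]

theorem target_mem_concepts {d : ℕ} (hd : dim d ≠ 0) (a : Bool) (r : Fin (dim d) → Bool) :
    target (maskedEquiv d hd) a r ∈ maskedParity.concepts d :=
  maskedParity_mem_concepts.2 ⟨hd, _, by simp, target_maskedEquiv hd a r⟩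

theorem exists_pow_lt_sqrt_two_pow (A : ℝ) (j : ℕ) : ∃ n : ℕ, n ≠ 0 ∧ A * (n : ℝ) ^ j < √2 ^ n := by
  have hlim := (tendsto_pow_const_div_const_pow_of_one_lt j Real.one_lt_sqrt_two).const_mul A
  rw [mul_zero] at hlim
  obtain ⟨n, hn, hn1⟩ :=
    ((hlim.eventually (gt_mem_nhds one_pos)).and (Filter.eventually_ge_atTop 1)).exists
  refine ⟨n, by omega, ?_⟩
  rwa [← mul_div_assoc, div_lt_one (by positivity)] at hn

theorem polyBound_le_mul_pow {a k : ℕ} {x y : ℝ} (hx : 0 ≤ x) (hy : 1 ≤ y) (h : x ≤ 4 * y + 10) :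
    polyBound a k x ≤ a * 15 ^ k * y ^ k := by
  rw [polyBound, mul_assoc, ← mul_pow]
  gcongr
  linarith

theorem admissible_fifth : Admissible (1 / 5) (1 / 5) := by
  constructor <;> constructor <;> norm_num

theorem logb_two_five_mem_Icc : Real.logb 2 (1 / (1 / 5)) ∈ Set.Icc 0 3 := by
  refine ⟨Real.logb_nonneg (by norm_num) (by norm_num), ?_⟩
  rw [Real.logb_le_iff_le_rpow (by norm_num) (by norm_num)]
  norm_num

/-! ### Nonadaptive SQ learners cannot learn masked parities -/

theorem SQQuery.expect_mem_valid {X : Type} [Fintype X] (q : SQQuery X) (c : X → Bool) :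
    q.expect c ∈ q.valid c := by
  simp [SQQuery.valid, q.τ_pos.le]

theorem Alg.AsksList.runSQ_congr {X H : Type} {reach : SQQuery X → Set ℝ} {O O' : SQOracle X}
    {qs : List (SQQuery X)} {P : Alg (SQQuery X) ℝ H} (hP : P.AsksList reach qs)
    (hreach : ∀ past q, O past q ∈ reach q) (hO : ∀ past, ∀ q ∈ qs, O past q = O' past q)
    (past : List (SQQuery X)) : P.runSQ O past = P.runSQ O' past := by
  induction hP generalizing past with
  | output h => rfl
  | sample p k _ ih => exact bind_congr_of_mem_support fun i hi => ih i hi hO past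
  | query q qs k _ ih =>
    simp only [Alg.runSQ]
    rw [← hO past q (by simp)]
    exact ih _ (hreach past q) (fun past q hq => hO past q (by simp [hq])) _

section HidingOracle

variable {X : Type} [Fintype X] {n : ℕ} (e : MaskedPoint n ≃ X)

/-- Whether the answer to `q` must depend on the constant term if the secret vector is `r`. -/
def Reveals (q : SQQuery X) (r : Fin n → Bool) : Prop :=
  q.τ < |q.expect (target e false r) - q.expect (target e true r)|

open Classical in
/-- The SQ oracle that hides the constant term of the target whenever it can. -/
noncomputable def hidingOracle (r : Fin n → Bool) (a : Bool) : SQOracle X := fun _ q =>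
  if Reveals e q r then q.expect (target e a r) else q.expect (target e false r)

theorem hidingOracle_isFor (r : Fin n → Bool) (a : Bool) :
    (hidingOracle e r a).IsFor (target e a r) := by
  intro past q
  unfold hidingOracle
  split_ifs with h
  · exact q.expect_mem_valid _
  · cases a
    · exact q.expect_mem_valid _
    · exact not_lt.1 h

theorem runSQ_hidingOracle {H : Type} {reach : SQQuery X → Set ℝ}
    (hreach : ∀ q a r, q.valid (target e a r) ⊆ reach q) {r : Fin n → Bool}
    {qs : List (SQQuery X)} {P : Alg (SQQuery X) ℝ H} (hP : P.AsksList reach qs)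
    (hq : ∀ q ∈ qs, ¬Reveals e q r) (past : List (SQQuery X)) :
    P.runSQ (hidingOracle e r false) past = P.runSQ (hidingOracle e r true) past :=
  hP.runSQ_congr (fun past q => hreach q _ _ (hidingOracle_isFor e r false past q))
    (fun past q hmem => by simp [hidingOracle, hq q hmem]) past

open Classical in
/-- By orthogonality of parities, a query is revealing for few secret vectors. -/
theorem card_reveals_le [NeZero n] {q : SQQuery X} {τ : ℝ} (hτ : 0 < τ) (hq : τ ≤ q.τ) :
    ((Finset.univ.filter (Reveals e q)).card : ℝ) ≤ 1 / τ ^ 2 := by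
  have hsum : ∑ r, (q.expect (target e false r) - q.expect (target e true r)) ^ 2 ≤ 1 := by
    have hM (x : X) :
        |(if q.g x false then (1 : ℝ) else -1) - if q.g x true then 1 else -1| ≤ 2 := by
      split_ifs <;> norm_num
    have hsq := sum_sq_expect_target_sub_le e (f := fun x y => if q.g x y then 1 else -1) hM
    simp only [Fintype.expect_eq_sum_div_card] at hsq
    exact hsq.trans_eq (by norm_num)
  rw [le_div_iff₀ (by positivity), ← nsmul_eq_mul, ← Finset.sum_const]
  refine (Finset.sum_le_sum fun r hr => ?_).trans
    ((Finset.sum_le_univ_sum_of_nonneg fun r => sq_nonneg _).trans hsum)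
  rw [← sq_abs (_ - _)]
  exact pow_le_pow_left₀ hτ.le (hq.trans (Finset.mem_filter.1 hr).2.le) 2

open Classical in
theorem card_exists_reveals_le [NeZero n] {qs : List (SQQuery X)} {τ : ℝ} (hτ : 0 < τ)
    (hqs : ∀ q ∈ qs, τ ≤ q.τ) :
    ((Finset.univ.filter fun r => ∃ q ∈ qs, Reveals e q r).card : ℝ) ≤ qs.length * (1 / τ ^ 2) := by
  have hunion : (Finset.univ.filter fun r => ∃ q ∈ qs, Reveals e q r) =
      qs.toFinset.biUnion fun q => Finset.univ.filter (Reveals e q) := by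
    ext r
    simp
  rw [hunion]
  calc ((qs.toFinset.biUnion fun q => Finset.univ.filter (Reveals e q)).card : ℝ)
      ≤ ∑ q ∈ qs.toFinset, ((Finset.univ.filter (Reveals e q)).card : ℝ) := by
        exact_mod_cast Finset.card_biUnion_le
    _ ≤ ∑ q ∈ qs.toFinset, 1 / τ ^ 2 := Finset.sum_le_sum fun q hq =>
        card_reveals_le e hτ (hqs q (by simpa using hq))
    _ = (qs.toFinset.card : ℝ) * (1 / τ ^ 2) := by simp
    _ ≤ qs.length * (1 / τ ^ 2) := by
        gcongr
        exact List.toFinset_card_le qs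

variable [NeZero n] {reach : SQQuery X → Set ℝ}
  (hreach : ∀ q a r, q.valid (target e a r) ⊆ reach q) {P : Alg (SQQuery X) ℝ (X → Bool)}
  {τ : ℝ} (hτ : 0 < τ) {m : ℕ}
  (hQ : ∀ a r, P.QueriesWithin (SQQuery.valid (target e a r)) (fun q => τ ≤ q.τ) m)

include hreach hτ hQ

theorem totalSuccess_runSQ_le_of_asksList {qs : List (SQQuery X)} (hP : P.AsksList reach qs) :
    totalSuccess e (fun r a => P.runSQ (hidingOracle e r a) []) ≤
      ENNReal.ofReal (2 ^ n + m * (1 / τ ^ 2)) := by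
  classical
  obtain ⟨hlen, hok⟩ := hP.length_le (fun q => ⟨q.expect (target e false fun _ => false),
    q.expect_mem_valid _, hreach q _ _ (q.expect_mem_valid _)⟩) (hQ false fun _ => false)
  refine totalSuccess_le e (δ := fun r => if ∃ q ∈ qs, Reveals e q r then 1 else 0) (fun r => ?_)
    (by positivity) ?_
  · split_ifs with hr
    · exact add_le_add (toOuterMeasure_le_one _ _) (toOuterMeasure_le_one _ _)
    · rw [add_zero, runSQ_hidingOracle e hreach hP fun q hq hrev => hr ⟨q, hq, hrev⟩]
      exact toOuterMeasure_add_le_one _ (disjoint_err_le e r)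
  · rw [Finset.sum_boole, ← ENNReal.ofReal_natCast]
    refine ENNReal.ofReal_le_ofReal ((card_exists_reveals_le e hτ hok).trans ?_)
    gcongr

theorem totalSuccess_runSQ_le (hP : P.Nonadaptive reach) :
    totalSuccess e (fun r a => P.runSQ (hidingOracle e r a) []) ≤
      ENNReal.ofReal (2 ^ n + m * (1 / τ ^ 2)) :=
  hP.le_of_forall_asksList (V := fun P => totalSuccess e fun r a => P.runSQ (hidingOracle e r a) [])
    (good := fun P => ∀ a r, P.QueriesWithin (SQQuery.valid (target e a r)) (fun q => τ ≤ q.τ) m)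
    (fun p k => totalSuccess_bind e p fun i r a => (k i).runSQ (hidingOracle e r a) [])
    (fun _ _ hgood i hi a r => hgood a r i hi)
    (fun _ _ hasks hgood => totalSuccess_runSQ_le_of_asksList e hreach hτ hgood hasks) hQ

end HidingOracle

theorem polyBound_fifth_le (a k : ℕ) {d : ℕ} {c : maskedParity.X d → Bool}
    (hc : c ∈ maskedParity.concepts d) (hd : d = 2 * dim d + 1) (hn : (1 : ℝ) ≤ dim d) :
    polyBound a k (d + maskedParity.size d c + 1 / (1 / 5) + Real.logb 2 (1 / (1 / 5))) ≤
      (a * 15 ^ k + 1) * (dim d : ℝ) ^ k := by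
  obtain ⟨hlog, hlog'⟩ := logb_two_five_mem_Icc
  have hsize : (maskedParity.size d c : ℝ) ≤ d := by exact_mod_cast maskedParity_size_le hc
  have hd : (d : ℝ) = 2 * dim d + 1 := by exact_mod_cast hd
  refine (polyBound_le_mul_pow (y := dim d) (by positivity) hn (by linarith)).trans ?_
  gcongr
  linarith

theorem maskedParity_not_mem_nonadaptiveSQ : maskedParity ∉ NonadaptiveSQ := by
  rintro ⟨A, ⟨a, k, hA⟩, hna⟩
  obtain ⟨n, hn, hlt⟩ := exists_pow_lt_sqrt_two_pow (2 * (a * 15 ^ k + 1) ^ 3) (3 * k)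
  obtain ⟨d, rfl, hdn⟩ : ∃ d, n = dim d ∧ d = 2 * n + 1 :=
    ⟨2 * n + 1, (dim_two_mul_add_one n).symm, rfl⟩
  have : NeZero (dim d) := ⟨hn⟩
  set P : ℝ := (a * 15 ^ k + 1) * (dim d : ℝ) ^ k with hP
  have hn1 : (1 : ℝ) ≤ dim d := by exact_mod_cast Nat.one_le_iff_ne_zero.2 hn
  have hPpos : 0 < P := by positivity
  have hbound (c) (hc : c ∈ maskedParity.concepts d) : polyBound a k
      (d + maskedParity.size d c + 1 / (1 / 5) + Real.logb 2 (1 / (1 / 5))) ≤ P :=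
    polyBound_fifth_le a k hc hdn hn1
  have hQ (b) (r) : (A d (1 / 5) (1 / 5)).QueriesWithin
      (SQQuery.valid (target (maskedEquiv d hn) b r)) (fun q => 1 / P ≤ q.τ) ⌊P⌋₊ := by
    have hc := target_mem_concepts hn b r
    refine (hA d _ _ admissible_fifth _ hc).1.mono (fun hpos q hq => le_trans ?_ hq)
      (Nat.floor_le_floor (hbound _ hc))
    exact one_div_le_one_div_of_le (zero_lt_one.trans_le (Nat.floor_pos.1 hpos)) (hbound _ hc)
  have hupper := totalSuccess_runSQ_le (maskedEquiv d hn)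
    (reach := fun q => {v | ∃ c ∈ maskedParity.concepts d, v ∈ q.valid c})
    (fun q b r v hv => ⟨_, target_mem_concepts hn b r, hv⟩) (one_div_pos.2 hPpos) hQ
    (hna d _ _ admissible_fifth)
  have hlower := le_totalSuccess (maskedEquiv d hn) fun r b =>
    (hA d _ _ admissible_fifth _ (target_mem_concepts hn b r)).2 _ (hidingOracle_isFor _ r b)
  have hcontra := (ENNReal.ofReal_le_ofReal_iff (by positivity)).1 (hlower.trans hupper)
  have hcube : (⌊P⌋₊ : ℝ) * (1 / (1 / P) ^ 2) ≤ P ^ 3 := by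
    have := mul_le_mul_of_nonneg_right (Nat.floor_le hPpos.le) (sq_nonneg P)
    simp only [one_div, inv_pow, inv_inv]
    linarith
  have hgrowth : 2 * P ^ 3 < 2 ^ dim d := calc
    2 * P ^ 3 = 2 * (a * 15 ^ k + 1) ^ 3 * (dim d : ℝ) ^ (3 * k) := by rw [hP]; ring
    _ < √2 ^ dim d := hlt
    _ ≤ 2 ^ dim d := by gcongr; rw [Real.sqrt_le_left] <;> norm_num
  have : (0 : ℝ) < 2 ^ dim d := by positivity
  linarith

/-! ### Noninteractive local learners cannot learn masked parities -/

theorem uniform_bind_update {ι X H : Type*} [Fintype ι] [DecidableEq ι] [Fintype X] [Nonempty X]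
    (j : ι) (g : (ι → X) → PMF H) :
    ((PMF.uniformOfFintype (ι → X)).bind fun x =>
      (PMF.uniformOfFintype X).bind fun u => g (Function.update x j u)) =
      (PMF.uniformOfFintype (ι → X)).bind g := by
  ext h
  simp only [PMF.bind_apply, PMF.uniformOfFintype_apply, tsum_fintype, ← Finset.mul_sum]
  congr 1
  let swap : Equiv.Perm ((ι → X) × X) :=
    Function.Involutive.toPerm (fun p => (Function.update p.1 j p.2, p.1 j)) fun p => by simp
  have hswap : ∑ x : ι → X, ∑ u : X, g (Function.update x j u) h =
      ∑ x : ι → X, ∑ _u : X, g x h := by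
    rw [← Fintype.sum_prod_type', ← Fintype.sum_prod_type']
    exact Equiv.sum_comp swap fun p : (ι → X) × X => g p.1 h
  rw [hswap, Finset.sum_comm, Finset.sum_const, nsmul_eq_mul, ← mul_assoc, Finset.card_univ,
    ENNReal.inv_mul_cancel (by simp) (by simp), one_mul]

theorem bind_map_cons_apply {α : Type*} (p : PMF α) (E : PMF (List α)) (w : α) (ws : List α) :
    (p.bind fun w => E.map (w :: ·)) (w :: ws) = p w * E ws := by
  classical
  rw [PMF.bind_apply, tsum_eq_single w, PMF.map_apply, tsum_eq_single ws]
  · simp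
  · intro ws' h
    simp [h.symm]
  · intro w' h
    simp [PMF.map_apply, h.symm]

theorem bind_map_cons_apply_nil {α : Type*} (p : PMF α) (E : PMF (List α)) :
    (p.bind fun w => E.map (w :: ·)) [] = 0 := by
  simp [PMF.bind_apply, PMF.map_apply]

/-- The distribution of the list of answers to those of the queries that concern the entry `i`, if
this entry is `u`. -/
noncomputable def entryRun {D : Type} {N : ℕ} (i : Fin N) :
    List (LRQuery D N) → D → PMF (List (List Bool))
  | [], _ => PMF.pure []
  | q :: qs, u =>
      if q.1 = i then (q.2 u).bind fun w => (entryRun i qs u).map (w :: ·) else entryRun i qs u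

theorem Alg.AsksList.exists_runLR_update_eq {D H : Type} {N : ℕ} {qs : List (LRQuery D N)}
    {P : Alg (LRQuery D N) (List Bool) H} (hP : P.AsksList LRQuery.reach qs)
    (z : Fin N → D) (i : Fin N) :
    ∃ B : List (List Bool) → PMF H,
      ∀ u, P.runLR (Function.update z i u) = (entryRun i qs u).bind B := by
  induction hP with
  | output h => exact ⟨fun _ => PMF.pure h, fun u => by simp [entryRun, Alg.runLR]⟩
  | sample p k _ ih =>
    refine ⟨fun _ => p.bind fun j => (k j).runLR z, fun u => ?_⟩
    simp only [entryRun, Alg.runLR, PMF.pure_bind]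
    refine bind_congr_of_mem_support fun j hj => ?_
    obtain ⟨B, hB⟩ := ih j hj
    have hz := hB (z i)
    rw [Function.update_eq_self] at hz
    rw [hz, hB u]
    simp [entryRun]
  | query q qs k _ ih =>
    have hcont (w) : ∃ B : List (List Bool) → PMF H, w ∈ LRQuery.reach q →
        ∀ u, (k w).runLR (Function.update z i u) = (entryRun i qs u).bind B := by
      by_cases hw : w ∈ LRQuery.reach q
      · exact (ih w hw).imp fun B hB _ => hB
      · exact ⟨fun _ => (k w).runLR z, fun h => (hw h).elim⟩
    choose B hB using hcont
    by_cases hi : q.1 = i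
    · refine ⟨fun l => B (l.headD []) l.tail, fun u => ?_⟩
      simp only [entryRun, Alg.runLR, if_pos hi, PMF.bind_bind, PMF.bind_map]
      rw [hi, Function.update_self]
      exact bind_congr_of_mem_support fun w hw => hB w ⟨u, hw⟩ u
    · refine ⟨fun l => (q.2 (z q.1)).bind fun w => B w l, fun u => ?_⟩
      simp only [entryRun, Alg.runLR, if_neg hi]
      rw [PMF.bind_comm, Function.update_of_ne hi]
      exact bind_congr_of_mem_support fun w hw => hB w ⟨z q.1, hw⟩ u

theorem Alg.AsksList.entryRun_le {D H : Type} {N : ℕ} {qs : List (LRQuery D N)}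
    {P : Alg (LRQuery D N) (List Bool) H} (hP : P.AsksList LRQuery.reach qs)
    {budget : Fin N → ℝ} (hb : ∀ i, 0 ≤ budget i) (hL : P.LocalWithin budget)
    (i : Fin N) (u u' : D) (ws : List (List Bool)) :
    entryRun i qs u ws ≤ ENNReal.ofReal (Real.exp (budget i)) * entryRun i qs u' ws := by
  induction hP generalizing budget ws with
  | output _ | sample _ _ _ =>
    exact le_mul_of_one_le_left' (ENNReal.one_le_ofReal.2 (Real.one_le_exp (hb i)))
  | query q qs k _ ih =>
    obtain ⟨e, he, hle, hk⟩ := hL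
    obtain ⟨w₀, hw₀⟩ := (q.2 u).support_nonempty
    have hrest (ws) := ih w₀ ⟨u, hw₀⟩ (fun j => ?_) (hk w₀ ⟨u, hw₀⟩) ws
    · by_cases hi : q.1 = i
      · simp only [entryRun, if_pos hi]
        cases ws with
        | nil => simp only [bind_map_cons_apply_nil, mul_zero, le_refl]
        | cons w ws =>
          simp only [hi, Function.update_self] at hrest
          rw [bind_map_cons_apply, bind_map_cons_apply]
          refine (mul_le_mul' (he u u' w) (hrest ws)).trans_eq ?_
          rw [mul_mul_mul_comm, ← ENNReal.ofReal_mul (Real.exp_pos _).le, ← Real.exp_add,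
            add_sub_cancel]
      · simpa only [entryRun, if_neg hi, Function.update_of_ne (Ne.symm hi)] using hrest ws
    · rcases eq_or_ne j q.1 with rfl | hj
      · simpa using hle
      · simpa [hj] using hb j

/-- The `ℓ¹` distance of two discrete distributions, which is twice their statistical distance. -/
noncomputable def l1Dist {α : Type*} (p q : PMF α) : ENNReal :=
  ∑' w, ENNReal.ofReal |(p w).toReal - (q w).toReal|

theorem apply_le_apply_add_ofReal_abs {α : Type*} (p q : PMF α) (w : α) :
    p w ≤ q w + ENNReal.ofReal |(p w).toReal - (q w).toReal| := by
  calc p w = ENNReal.ofReal (p w).toReal := (ENNReal.ofReal_toReal (p.apply_ne_top w)).symm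
    _ ≤ ENNReal.ofReal ((q w).toReal + |(p w).toReal - (q w).toReal|) := by
      gcongr
      linarith [le_abs_self ((p w).toReal - (q w).toReal)]
    _ = q w + ENNReal.ofReal |(p w).toReal - (q w).toReal| := by
      rw [ENNReal.ofReal_add ENNReal.toReal_nonneg (abs_nonneg _),
        ENNReal.ofReal_toReal (q.apply_ne_top w)]

theorem toOuterMeasure_bind_le_add_l1Dist {α H : Type*} (p q : PMF α) (B : α → PMF H) (S : Set H) :
    (p.bind B).toOuterMeasure S ≤ (q.bind B).toOuterMeasure S + l1Dist p q := by
  rw [PMF.toOuterMeasure_bind_apply, PMF.toOuterMeasure_bind_apply, l1Dist, ← ENNReal.tsum_add]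
  refine ENNReal.tsum_le_tsum fun w => ?_
  calc p w * (B w).toOuterMeasure S
      ≤ (q w + ENNReal.ofReal |(p w).toReal - (q w).toReal|) * (B w).toOuterMeasure S := by
        gcongr
        exact apply_le_apply_add_ofReal_abs p q w
    _ ≤ _ := by
      rw [add_mul]
      gcongr
      exact mul_le_of_le_one_right' (toOuterMeasure_le_one _ _)

theorem sum_abs_le_of_sum_sq_le {n : ℕ} {D : (Fin n → Bool) → ℝ} {M : ℝ} (hM : 0 ≤ M)
    (h : ∑ r, D r ^ 2 ≤ M ^ 2) : ∑ r, |D r| ≤ √2 ^ n * M := by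
  refine abs_le_of_sq_le_sq ?_ (by positivity) |> (le_abs_self _).trans
  calc (∑ r, |D r|) ^ 2 ≤ 2 ^ n * ∑ r, D r ^ 2 := by
        simpa using sq_sum_le_card_mul_sum_sq (s := Finset.univ) (f := fun r => |D r|)
    _ ≤ 2 ^ n * M ^ 2 := by gcongr
    _ = (√2 ^ n * M) ^ 2 := by
      rw [mul_pow, ← pow_mul, mul_comm n, pow_mul, Real.sq_sqrt zero_le_two]

section LocalOutput

variable {X : Type} [Fintype X] [Nonempty X] {N : ℕ}

/-- The distribution of the answers that concern the entry `i`, if this entry is a random example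
of `c`. -/
noncomputable def entryDist (qs : List (LRQuery (X × Bool) N)) (i : Fin N) (c : X → Bool) :
    PMF (List (List Bool)) :=
  (PMF.uniformOfFintype X).bind fun x => entryRun i qs (x, c x)

/-- The distribution of the output of a local algorithm if entry `i` of the database is a random
example of `c i`. -/
noncomputable def localOutput {H : Type} (P : Alg (LRQuery (X × Bool) N) (List Bool) H)
    (c : Fin N → X → Bool) : PMF H :=
  (PMF.uniformOfFintype (Fin N → X)).bind fun x => P.runLR fun i => (x i, c i (x i))

variable {H : Type} {qs : List (LRQuery (X × Bool) N)}
  {P : Alg (LRQuery (X × Bool) N) (List Bool) H}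

theorem Alg.AsksList.localOutput_update_le (hP : P.AsksList LRQuery.reach qs)
    (c : Fin N → X → Bool) (j : Fin N) (c' : X → Bool) (S : Set H) :
    (localOutput P (Function.update c j c')).toOuterMeasure S ≤
      (localOutput P c).toOuterMeasure S + l1Dist (entryDist qs j c') (entryDist qs j (c j)) := by
  have hresample (b : X → Bool) :
      (localOutput P (Function.update c j b)).toOuterMeasure S =
        ∑' x, PMF.uniformOfFintype (Fin N → X) x * ((PMF.uniformOfFintype X).bind fun u =>
          P.runLR (Function.update (fun i => (x i, c i (x i))) j (u, b u))).toOuterMeasure S := by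
    have hupdate (x : Fin N → X) (u : X) :
        (fun i => (Function.update x j u i, Function.update c j b i (Function.update x j u i))) =
          Function.update (fun i => (x i, c i (x i))) j (u, b u) := by
      funext i
      rcases eq_or_ne i j with rfl | hi <;> simp [*]
    rw [localOutput, ← uniform_bind_update j, PMF.toOuterMeasure_bind_apply]
    simp only [hupdate]
  have hself := hresample (c j)
  rw [Function.update_eq_self] at hself
  rw [hresample, hself, ← one_mul (l1Dist _ _), ← (PMF.uniformOfFintype (Fin N → X)).tsum_coe,
    ← ENNReal.tsum_mul_right, ← ENNReal.tsum_add]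
  refine ENNReal.tsum_le_tsum fun x => ?_
  rw [← mul_add]
  gcongr
  obtain ⟨B, hB⟩ := hP.exists_runLR_update_eq (fun i => (x i, c i (x i))) j
  simpa only [hB, entryDist, PMF.bind_bind] using
    toOuterMeasure_bind_le_add_l1Dist (entryDist qs j c') (entryDist qs j (c j)) B S

theorem Alg.AsksList.localOutput_le (hP : P.AsksList LRQuery.reach qs) (c c' : X → Bool)
    (S : Set H) :
    (localOutput P fun _ => c).toOuterMeasure S ≤ (localOutput P fun _ => c').toOuterMeasure S +
      ∑ i, l1Dist (entryDist qs i c) (entryDist qs i c') := by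
  have hybrid (s : Finset (Fin N)) :
      (localOutput P (s.piecewise (fun _ => c) fun _ => c')).toOuterMeasure S ≤
        (localOutput P fun _ => c').toOuterMeasure S +
          ∑ i ∈ s, l1Dist (entryDist qs i c) (entryDist qs i c') := by
    induction s using Finset.induction_on with
    | empty => simp
    | insert j s hj ih =>
      rw [Finset.piecewise_insert, Finset.sum_insert hj, add_comm (l1Dist _ _), ← add_assoc]
      refine (hP.localOutput_update_le _ j c S).trans ?_
      rw [Finset.piecewise_eq_of_notMem _ _ _ hj]
      gcongr
  simpa using hybrid Finset.univ

theorem entryDist_apply_toReal (qs : List (LRQuery (X × Bool) N)) (i : Fin N) (c : X → Bool)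
    (ws : List (List Bool)) :
    (entryDist qs i c ws).toReal = 𝔼 x, (entryRun i qs (x, c x) ws).toReal := by
  rw [entryDist, PMF.bind_apply, tsum_fintype, ENNReal.toReal_sum
    (fun x _ => ENNReal.mul_ne_top (PMF.apply_ne_top _ _) (PMF.apply_ne_top _ _)),
    Fintype.expect_eq_sum_div_card, Finset.sum_div]
  refine Finset.sum_congr rfl fun x _ => ?_
  rw [ENNReal.toReal_mul, PMF.uniformOfFintype_apply, ENNReal.toReal_inv, ENNReal.toReal_natCast,
    mul_comm, div_eq_mul_inv]

variable {n : ℕ} [NeZero n] (e : MaskedPoint n ≃ X)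

theorem Alg.AsksList.sum_abs_entryDist_sub_le (hP : P.AsksList LRQuery.reach qs) {ε : ℝ}
    (hε : 0 ≤ ε) (hL : P.IsLocal ε) (i : Fin N) (u : X × Bool) (ws : List (List Bool)) :
    ∑ r, |(entryDist qs i (target e false r) ws).toReal -
        (entryDist qs i (target e true r) ws).toReal| ≤
      √2 ^ n * (Real.exp ε / 2 * (entryRun i qs u ws).toReal) := by
  have hle (u') : (entryRun i qs u' ws).toReal ≤ Real.exp ε * (entryRun i qs u ws).toReal := by
    simpa [ENNReal.toReal_ofReal (Real.exp_pos ε).le] using ENNReal.toReal_mono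
      (ENNReal.mul_ne_top ENNReal.ofReal_ne_top (PMF.apply_ne_top _ _))
      (hP.entryRun_le (fun _ => hε) hL i u' u ws)
  refine sum_abs_le_of_sum_sq_le (by positivity) ?_
  simp only [entryDist_apply_toReal]
  refine (sum_sq_expect_target_sub_le e (f := fun x y => (entryRun i qs (x, y) ws).toReal)
    fun x => abs_sub_le_of_nonneg_of_le ENNReal.toReal_nonneg (hle _) ENNReal.toReal_nonneg
      (hle _)).trans_eq ?_
  ring

theorem Alg.AsksList.sum_l1Dist_le (hP : P.AsksList LRQuery.reach qs) {ε : ℝ} (hε : 0 ≤ ε)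
    (hL : P.IsLocal ε) (i : Fin N) :
    ∑ r, l1Dist (entryDist qs i (target e false r)) (entryDist qs i (target e true r)) ≤
      ENNReal.ofReal (√2 ^ n * Real.exp ε / 2) := by
  obtain ⟨x₀⟩ := ‹Nonempty X›
  simp only [l1Dist]
  rw [← Summable.tsum_finsetSum fun _ _ => ENNReal.summable,
    ← mul_one (ENNReal.ofReal _), ← (entryRun i qs (x₀, false)).tsum_coe, ← ENNReal.tsum_mul_left]
  refine ENNReal.tsum_le_tsum fun ws => ?_
  rw [← ENNReal.ofReal_sum_of_nonneg fun r _ => abs_nonneg _,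
    ← ENNReal.ofReal_toReal (PMF.apply_ne_top (entryRun i qs (x₀, false)) ws),
    ← ENNReal.ofReal_mul (by positivity)]
  refine ENNReal.ofReal_le_ofReal
    ((hP.sum_abs_entryDist_sub_le e hε hL i (x₀, false) ws).trans_eq ?_)
  ring

theorem totalSuccess_localOutput_le {P : Alg (LRQuery (X × Bool) N) (List Bool) (X → Bool)}
    (hP : P.Nonadaptive LRQuery.reach) {ε : ℝ} (hε : 0 ≤ ε) (hL : P.IsLocal ε) :
    totalSuccess e (fun r a => localOutput P fun _ => target e a r) ≤
      ENNReal.ofReal (2 ^ n + N * (√2 ^ n * Real.exp ε / 2)) := by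
  refine Alg.Nonadaptive.le_of_forall_asksList (good := Alg.IsLocal ε)
    (V := fun P => totalSuccess e (fun r a => localOutput P fun _ => target e a r))
    (fun p k => ?_) (fun p k h => h) (fun qs P hP hL => ?_) hP hL
  · rw [← totalSuccess_bind]
    congr! with r a
    exact PMF.bind_comm _ _ _
  · refine totalSuccess_le e
      (δ := fun r => ∑ i,
        l1Dist (entryDist qs i (target e false r)) (entryDist qs i (target e true r)))
      (fun r => ?_) (by positivity) ?_
    · refine (add_le_add_left (hP.localOutput_le _ (target e true r) _) _).trans ?_
      rw [add_right_comm]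
      gcongr
      exact toOuterMeasure_add_le_one _ (disjoint_err_le e r)
    · rw [Finset.sum_comm]
      refine (Finset.sum_le_sum fun i _ => hP.sum_l1Dist_le e hε hL i).trans_eq ?_
      rw [Finset.sum_const, Finset.card_univ, Fintype.card_fin, nsmul_eq_mul,
        ENNReal.ofReal_mul (by positivity), ENNReal.ofReal_natCast]

end LocalOutput

theorem maskedParity_not_mem_noninteractiveLocal : maskedParity ∉ NoninteractiveLocal := by
  rintro ⟨A, ⟨a, k, hA⟩, hna⟩
  obtain ⟨n, hn, hlt⟩ := exists_pow_lt_sqrt_two_pow (3 * (a * 15 ^ k)) k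
  obtain ⟨d, rfl, hdn⟩ : ∃ d, n = dim d ∧ d = 2 * n + 1 :=
    ⟨2 * n + 1, (dim_two_mul_add_one n).symm, rfl⟩
  have : NeZero (dim d) := ⟨hn⟩
  have hn1 : (1 : ℝ) ≤ dim d := by exact_mod_cast Nat.one_le_iff_ne_zero.2 hn
  obtain ⟨hN, hloc, hsucc⟩ := hA d 1 (1 / 5) (1 / 5) one_pos admissible_fifth
  set N : ℕ := A.n d 1 (1 / 5) (1 / 5)
  have hN_lt : (N : ℝ) ≤ √2 ^ dim d / 3 := by
    obtain ⟨hlog, hlog'⟩ := logb_two_five_mem_Icc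
    have hd : (d : ℝ) = 2 * dim d + 1 := by exact_mod_cast hdn
    have := hN.trans (polyBound_le_mul_pow (y := dim d) (by positivity) hn1 (by linarith))
    linarith
  have hupper := totalSuccess_localOutput_le (maskedEquiv d hn)
    (hna d 1 (1 / 5) (1 / 5) one_pos admissible_fifth) zero_le_one hloc
  have hlower := le_totalSuccess (maskedEquiv d hn)
    (μ := fun r b => localOutput (A.alg d 1 (1 / 5) (1 / 5)) fun _ => target (maskedEquiv d hn) b r)
    fun r b => (hsucc _ (target_mem_concepts hn b r)).2
  have hcontra := (ENNReal.ofReal_le_ofReal_iff (by positivity)).1 (hlower.trans hupper)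
  have hadvantage : (N : ℝ) * (√2 ^ dim d * Real.exp 1 / 2) ≤ 1.4 / 3 * 2 ^ dim d := calc
    (N : ℝ) * (√2 ^ dim d * Real.exp 1 / 2)
      ≤ (√2 ^ dim d / 3) * (√2 ^ dim d * 2.8 / 2) := by
        gcongr
        exact Real.exp_one_lt_d9.le.trans (by norm_num)
    _ = 1.4 / 3 * (√2 * √2) ^ dim d := by rw [mul_pow]; ring
    _ = 1.4 / 3 * 2 ^ dim d := by rw [Real.mul_self_sqrt zero_le_two]
  linarith [pow_pos (zero_lt_two (α := ℝ)) (dim d)]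

/-! ### Programs that evaluate hypotheses, queries and randomizers -/

/-- A bit as the content of a register: `[]` for `false`. -/
def bit (b : Bool) : List Bool := if b then [true] else []

theorem accepts_bit (b : Bool) : accepts (some (bit b)) = b := by
  cases b <;> rfl

/-- Negate the bit in register `r`. -/
def toggle (r : ℕ) : Cmd := .test r (.push r true) (.pop r) (.pop r)

/-- Add the product of the top bits of the registers `0` and `1` to the bit in register `4`, and
remove these top bits. -/
def dotStep : Cmd :=
  .seq (.test 0 .skip (.pop 1) (.seq (.test 1 .skip .skip (toggle 4)) (.pop 1))) (.pop 0)

/-- Add the inner product of the registers `0` and `1` to the bit in register `4`. -/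
def dotProg : Cmd := .loop 0 dotStep

theorem runs_dotProg (v x : List Bool) (b : Bool) (l2 l3 : List Bool) (tail : List (List Bool)) :
    Runs dotProg (st (v :: x :: l2 :: l3 :: bit b :: tail))
      (st ([] :: x.drop v.length :: l2 :: l3 :: bit (xor b (dot v x)) :: tail))
      (15 * v.length + 1) := by
  induction v generalizing x b with
  | nil =>
    have hnil : Runs dotProg (st ([] :: x :: l2 :: l3 :: bit b :: tail)) _ 1 := Runs.loop_nil rfl
    simpa using hnil
  | cons a v ih =>
    have hstep : Runs dotStep (st ((a :: v) :: x :: l2 :: l3 :: bit b :: tail))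
        (st (v :: x.tail :: l2 :: l3 :: bit (xor b (a && x.headD false)) :: tail)) 14 := by
      refine Cmd.runs_of_eval_eq rfl ?_ (by simp [Cmd.cost, dotStep, toggle])
      rcases a with _ | _ <;> rcases x with _ | ⟨_ | _, x⟩ <;> rcases b with _ | _ <;>
        simp [dotStep, toggle, Cmd.eval, st_apply, update_st, bit]
    refine ((Runs.loop_cons (by simp [st_apply]) hstep (ih _ _)).congr_right ?_).mono ?_
    · cases x <;> simp
    · simp only [List.length_cons]
      omega

theorem Runs.exec_eq {c : Cmd} {s s' : Store} {B T : ℕ} (h : Runs c s s' B) (hT : B ≤ T) :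
    exec T ([c], s) = some (s' 0) :=
  (h []).ensures (B := 0) (P := (· = some (s' 0))) followsSteps_exec
    (fun T _ => exec_nil T s') T (by omega)

/-- The program that evaluates parities. -/
def evalProg : Cmd := .seq dotProg (.test 4 .skip .skip (.push 0 true))

theorem exec_evalProg (v x : List Bool) {T : ℕ} (hT : 15 * v.length + 10 ≤ T) :
    exec T (evalProg.init [v, x]) = some (bit (dot v x)) := by
  rw [Cmd.init_eq_st _ _ 3]
  have hcopy : Runs (.test 4 .skip .skip (.push 0 true))
      (st [[], x.drop v.length, [], [], bit (xor false (dot v x))])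
      (st [bit (dot v x), x.drop v.length, [], [], bit (dot v x)]) 4 := by
    refine Cmd.runs_of_eval_eq rfl ?_ le_rfl
    cases dot v x <;> simp [Cmd.eval, st_apply, update_st, bit]
  exact ((runs_dotProg v x false [] [] []).seq hcopy).exec_eq (by omega)

theorem decodeHyp_evalProg {T : ℕ} (X : Finset (List Bool)) (v : List Bool)
    (hT : 15 * v.length + 10 ≤ T) :
    decodeHyp evalProg T X v = some fun x => dot v x.1 := by
  simp [decodeHyp, exec_evalProg v _ hT, accepts_bit]

/-- What the example `(x, y)` contributes to the answer to the query with mode `m` and vector `v`.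
In mode `false` only examples matter whose mask bit is not set and whose index is selected by `v`,
and their label is a bit of the secret vector. In mode `true` only examples matter whose mask bit is
set, and their label is corrected by the inner product with `v`, which leaves the constant term if
`v` is the secret vector. -/
def contribution (m : Bool) (v x : List Bool) (y : Bool) : Option Bool :=
  if x.head? = some m ∧ (m || dot v x.tail) then some (xor y (m && dot v x.tail)) else none

/-- Leave register `5` empty if and only if the mask bit of the example is the mode, and keep the
mode in register `6`. -/
def maskProg : Cmd :=
  .test 0 .skip (.test 1 (.push 5 true) .skip (.push 5 true))
    (.seq (.push 6 true) (.test 1 (.push 5 true) (.push 5 true) .skip))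

/-- Given the inner product in register `4`, mark in register `5` an index that is not selected, and
turn register `4` into the contribution of the example. -/
def correctProg : Cmd :=
  .seq (.test 6 (.test 4 (.push 5 true) .skip (.pop 4)) .skip .skip)
    (.test 2 .skip .skip (toggle 4))

/-- Compute the contribution of an example in register `4`, and leave register `5` empty if and only
if there is one. -/
def contributionProg : Cmd :=
  .seq maskProg (.seq (.seq (.pop 0) (.pop 1)) (.seq dotProg correctProg))

theorem runs_contributionProg (m : Bool) (v x : List Bool) (y : Bool) (l8 : List Bool) :
    ∃ l1 b l5 l6, Runs contributionProg (st [m :: v, x, [y], [], [], [], [], [], l8])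
        (st [[], l1, [y], [], bit b, l5, l6, [], l8]) (15 * v.length + 40) ∧
      contribution m v x y = if l5 = [] then some b else none := by
  set l5 : List Bool := if x.head? = some m then [] else [true] with hl5
  have hmask : Runs maskProg (st [m :: v, x, [y], [], [], [], [], [], l8])
      (st [m :: v, x, [y], [], [], l5, bit m, [], l8]) 12 := by
    refine Cmd.runs_of_eval_eq rfl ?_ (by simp [Cmd.cost, maskProg])
    rcases m with _ | _ <;> rcases x with _ | ⟨_ | _, x⟩ <;>
      simp [maskProg, Cmd.eval, st_apply, update_st, bit, hl5]
  have hpop : Runs (.seq (.pop 0) (.pop 1)) (st [m :: v, x, [y], [], [], l5, bit m, [], l8])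
      (st [v, x.tail, [y], [], bit false, l5, bit m, [], l8]) 3 :=
    Cmd.runs_of_eval_eq rfl (by simp [Cmd.eval, st_apply, update_st, bit]) le_rfl
  have hdot := runs_dotProg v x.tail false [y] [] [l5, bit m, [], l8]
  set l5' : List Bool := if m || dot v x.tail then l5 else true :: l5 with hl5'
  have hcorrect : Runs correctProg
      (st [[], x.tail.drop v.length, [y], [], bit (xor false (dot v x.tail)), l5, bit m, [], l8])
      (st [[], x.tail.drop v.length, [y], [], bit (xor y (m && dot v x.tail)), l5', bit m, [], l8])
      20 := by
    refine Cmd.runs_of_eval_eq rfl ?_ (by simp [Cmd.cost, correctProg, toggle])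
    rw [hl5']
    rcases m with _ | _ <;> rcases y with _ | _ <;> rcases dot v x.tail with _ | _ <;>
      simp [correctProg, Cmd.eval, st_apply, update_st, bit, toggle]
  refine ⟨_, _, _, _, (hmask.seq (hpop.seq (hdot.seq hcorrect))).mono (by omega), ?_⟩
  rw [hl5', hl5, contribution]
  cases m || dot v x.tail <;> simp

/-- The program that evaluates statistical queries: `+1` for the examples that contribute `true`. -/
def queryProg : Cmd :=
  .seq (.pop 0) (.seq contributionProg
    (.test 5 (.test 4 .skip .skip (.push 0 true)) .skip .skip))

theorem exec_queryProg (m : Bool) (v x : List Bool) (y : Bool) {T : ℕ}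
    (hT : 15 * v.length + 60 ≤ T) :
    exec T (queryProg.init [false :: m :: v, x, [y]]) =
      some (bit ((contribution m v x y).getD false)) := by
  rw [Cmd.init_eq_st _ _ 6]
  have hpop : Runs (.pop 0) (st [false :: m :: v, x, [y], [], [], [], [], [], []])
      (st [m :: v, x, [y], [], [], [], [], [], []]) 1 :=
    Cmd.runs_of_eval_eq rfl (by simp [Cmd.eval, st_apply, update_st]) le_rfl
  obtain ⟨l1, b, l5, l6, hruns, hcontribution⟩ := runs_contributionProg m v x y []
  have hcopy : Runs (.test 5 (.test 4 .skip .skip (.push 0 true)) .skip .skip)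
      (st [[], l1, [y], [], bit b, l5, l6, [], []])
      (st [bit ((contribution m v x y).getD false), l1, [y], [], bit b, l5, l6, [], []]) 10 := by
    refine Cmd.runs_of_eval_eq rfl ?_ (by simp [Cmd.cost])
    rw [hcontribution]
    rcases l5 with _ | ⟨_ | _, l5⟩ <;> rcases b with _ | _ <;>
      simp [Cmd.eval, st_apply, update_st, bit]
  exact (hpop.seq (hruns.seq hcopy)).exec_eq (by omega)

theorem ensures_execRandom_nil (s : Store) :
    Ensures execRandom 0 ([], s) (· = PMF.pure (some (s 0))) :=
  fun T _ => execRandom_nil T s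

theorem ensures_execRandom_flip {B r : ℕ} {K : List Cmd} {s : Store}
    {p : Bool → PMF (Option (List Bool))}
    (h : ∀ b, Ensures execRandom B (K, Function.update s r (b :: s r)) (· = p b)) :
    Ensures execRandom (B + 1) (.flip r :: K, s) (· = (PMF.uniformOfFintype Bool).bind p) := by
  intro T hT
  obtain ⟨T, rfl⟩ := Nat.exists_eq_add_of_le' (Nat.one_le_of_lt hT)
  simp only [execRandom, Cmd.step]
  exact congrArg _ (funext fun b => h b T (by omega))

theorem ensures_execRandom_flip_zero (tail : List (List Bool)) :
    Ensures execRandom 1 ([.flip 0], st ([] :: tail))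
      (· = (PMF.uniformOfFintype Bool).map fun b => some [b]) := by
  rw [← PMF.bind_pure_comp]
  refine ensures_execRandom_flip (B := 0) fun b => ?_
  simpa [st_apply, update_st] using
    ensures_execRandom_nil (Function.update (st ([] :: tail)) 0 (b :: st ([] :: tail) 0))

/-- The given bit if there is one and all of `k` coins show `true`, and a fair coin otherwise. -/
noncomputable def noisy (o : Option Bool) : ℕ → PMF Bool
  | 0 => o.elim (PMF.uniformOfFintype Bool) PMF.pure
  | k + 1 => (PMF.uniformOfFintype Bool).bind fun b =>
      if b then noisy o k else PMF.uniformOfFintype Bool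

/-- Flip a coin for each leading `true` in register `0`, and mark in register `8` whether one of
them shows `false`. -/
def coinStep : Cmd :=
  .test 0 (.pop 3) (.seq (.pop 3) (.pop 0))
    (.seq (.pop 0) (.seq (.flip 7) (.test 7 .skip (.seq (.pop 7) (.push 8 true)) (.pop 7))))

/-- Output the bit in register `4`, or a fair coin if register `5` or register `8` is marked. -/
def chooseProg : Cmd :=
  .test 8 (.test 5 (.test 4 (.push 0 false) .skip (.push 0 true)) (.flip 0) (.flip 0))
    (.flip 0) (.flip 0)

/-- The program that evaluates randomizers. -/
def randomizerProg : Cmd :=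
  .seq (.push 3 true) (.seq (.loop 3 coinStep) (.seq contributionProg chooseProg))

theorem ensures_chooseProg (l1 l2 l3 : List Bool) (b : Bool) (l5 l6 l7 l8 : List Bool) :
    Ensures execRandom 8 ([chooseProg], st [[], l1, l2, l3, bit b, l5, l6, l7, l8])
      (· = (if l8 = [] then noisy (if l5 = [] then some b else none) 0 else
        PMF.uniformOfFintype Bool).map fun b => some [b]) := by
  rcases l8 with _ | ⟨c, l8⟩
  · refine ((Reach.test_nil rfl).ensures (B := 6) followsSteps_execRandom ?_).mono (by omega)
    rcases l5 with _ | ⟨c, l5⟩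
    · have hpush : Runs (.test 4 (.push 0 false) .skip (.push 0 true))
          (st [[], l1, l2, l3, bit b, [], l6, l7, []])
          (st [[b], l1, l2, l3, bit b, [], l6, l7, []]) 4 := by
        refine Cmd.runs_of_eval_eq rfl ?_ le_rfl
        cases b <;> simp [Cmd.eval, st_apply, update_st, bit]
      refine ((Reach.test_nil rfl).trans (hpush [])).ensures (B := 0) followsSteps_execRandom ?_
        |>.mono (by omega)
      simpa [noisy, PMF.pure_map, st_apply] using ensures_execRandom_nil
        (st [[b], l1, l2, l3, bit b, [], l6, l7, []])
    · refine ((Reach.test_cons rfl).ensures (B := 1) followsSteps_execRandom ?_).mono (by omega)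
      simpa [noisy] using ensures_execRandom_flip_zero _
  · refine ((Reach.test_cons rfl).ensures (B := 1) followsSteps_execRandom ?_).mono (by omega)
    simpa using ensures_execRandom_flip_zero _

theorem ensures_coinLoop {B : ℕ} {K : List Cmd} {w l1 l2 : List Bool} {o : Option Bool}
    {f : Bool → Option (List Bool)}
    (h : ∀ l8, Ensures execRandom B (K, st [w, l1, l2, [], [], [], [], [], l8])
      (· = (if l8 = [] then noisy o 0 else PMF.uniformOfFintype Bool).map f))
    (k : ℕ) (l8 : List Bool) :
    Ensures execRandom (B + 15 * k + 6)
      (.loop 3 coinStep :: K, st [unary k ++ false :: w, l1, l2, [true], [], [], [], [], l8])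
      (· = (if l8 = [] then noisy o k else PMF.uniformOfFintype Bool).map f) := by
  induction k generalizing l8 with
  | zero =>
    have hpop : Runs (.seq (.pop 3) (.pop 0))
        (st [false :: w, l1, l2, [true], [], [], [], [], l8])
        (st [w, l1, l2, [], [], [], [], [], l8]) 3 :=
      Cmd.runs_of_eval_eq rfl (by simp [Cmd.eval, st_apply, update_st]) le_rfl
    exact ((((Reach.loop_cons (by simp [st_apply])).trans (Reach.test_cons rfl)).trans
      (hpop _)).trans (Reach.loop_nil rfl)).ensures followsSteps_execRandom (h l8)
      |>.mono (by omega)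
  | succ k ih =>
    set s := st [unary k ++ false :: w, l1, l2, [true], [], [], [], [], l8]
    have hpop : Runs (.pop 0)
        (st [unary (k + 1) ++ false :: w, l1, l2, [true], [], [], [], [], l8]) s 1 :=
      Cmd.runs_of_eval_eq rfl
        (by simp [Cmd.eval, st_apply, update_st, unary, List.replicate_succ, s]) le_rfl
    have hcoin (b : Bool) : Runs (.test 7 .skip (.seq (.pop 7) (.push 8 true)) (.pop 7))
        (Function.update s 7 (b :: s 7)) (st [unary k ++ false :: w, l1, l2, [true], [], [], [], [],
          if b then l8 else true :: l8]) 6 := by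
      refine Cmd.runs_of_eval_eq rfl ?_ le_rfl
      cases b <;> simp [Cmd.eval, st_apply, update_st, s]
    have hflip := ensures_execRandom_flip fun b =>
      (hcoin b _).ensures followsSteps_execRandom (ih (if b then l8 else true :: l8))
    have hreach : Reach (1 + (1 + (1 + (1 + 1)))) (.loop 3 coinStep :: K,
          st [unary (k + 1) ++ false :: w, l1, l2, [true], [], [], [], [], l8])
        (.flip 7 :: .test 7 .skip (.seq (.pop 7) (.push 8 true)) (.pop 7) ::
          .loop 3 coinStep :: K, s) :=
      (Reach.loop_cons (List.cons_ne_nil true [])).trans ((Reach.test_cons (b := true) rfl).trans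
        ((Reach.seq _ _ _ _).trans ((hpop _).trans (Reach.seq _ _ _ _))))
    convert (hreach.ensures followsSteps_execRandom hflip).mono
      (show _ ≤ B + 15 * (k + 1) + 6 by omega) using 3
    rw [← PMF.map_bind]
    congr 1
    by_cases hl8 : l8 = []
    · simp [hl8, noisy]
    · have hmarked (b : Bool) : (if b then l8 else true :: l8) ≠ [] := by cases b <;> simp [hl8]
      simp [hl8, hmarked]

theorem execRandom_randomizerProg (k : ℕ) (m : Bool) (v x : List Bool) (y : Bool) {T : ℕ}
    (hT : 15 * v.length + 15 * k + 70 ≤ T) :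
    execRandom T (randomizerProg.init [unary k ++ false :: m :: v, x, [y]]) =
      (noisy (contribution m v x y) k).map fun b => some [b] := by
  rw [Cmd.init_eq_st _ _ 6]
  have hpush : Runs (.push 3 true)
      (st [unary k ++ false :: m :: v, x, [y], [], [], [], [], [], []])
      (st [unary k ++ false :: m :: v, x, [y], [true], [], [], [], [], []]) 1 :=
    Cmd.runs_of_eval_eq rfl (by simp [Cmd.eval, st_apply, update_st]) le_rfl
  have hanswer (l8 : List Bool) : Ensures execRandom (15 * v.length + 50)
      ([.seq contributionProg chooseProg], st [m :: v, x, [y], [], [], [], [], [], l8])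
      (· = (if l8 = [] then noisy (contribution m v x y) 0 else PMF.uniformOfFintype Bool).map
        fun b => some [b]) := by
    obtain ⟨l1, b, l5, l6, hruns, hcontribution⟩ := runs_contributionProg m v x y l8
    rw [hcontribution]
    exact (((Reach.seq _ _ _ _).trans (hruns _)).ensures followsSteps_execRandom
      (ensures_chooseProg _ _ _ _ _ _ _ _)).mono (by omega)
  have hloop := ensures_coinLoop hanswer k []
  rw [if_pos rfl] at hloop
  exact (((Reach.seq _ _ _ _).trans (hpush _)).trans (Reach.seq _ _ _ _)).ensures
    followsSteps_execRandom hloop T (by omega)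

/-! ### What examples of masked parities reveal -/

theorem contribution_selector {n : ℕ} (a : Bool) (r : Fin n → Bool) (i : Fin n)
    (u : MaskedPoint n) :
    contribution false (selector i) (maskedString u) (dot (a :: List.ofFn r) (maskedString u))
      = if u.1 = false ∧ u.2.1 = i then some (r i) else none := by
  obtain ⟨_ | _, j, x⟩ := u
  · have hget : (unitVec j ++ List.ofFn x)[(i : ℕ)]?.getD false = decide (i = j) := by
      rw [List.getElem?_append_left (by simp [length_unitVec])]
      simp [unitVec]
    by_cases hj : i = j
    · subst hj
      rw [dot_maskedString]
      simp [contribution, maskedString, maskedValue, dot_selector, hget]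
    · simp [contribution, maskedString, dot_selector, hget, hj, Ne.symm hj]
  · simp [contribution, maskedString]

theorem contribution_ofFn {n : ℕ} (a : Bool) (r : Fin n → Bool) (u : MaskedPoint n) :
    contribution true (List.ofFn r) (maskedString u) (dot (a :: List.ofFn r) (maskedString u))
      = if u.1 = true then some a else none := by
  obtain ⟨_ | _, j, x⟩ := u
  · simp [contribution, maskedString]
  · simp [contribution, maskedString, dot_append]

/-- The query with mode `m` and vector `v` reveals the bit `b` of the target: a fraction of at least
`1 / (2 n)` of the examples contributes to it, and all of these contribute `b`. -/
def RevealsBit (d : ℕ) (c : maskedParity.X d → Bool) (m : Bool) (v : List Bool) (b : Bool) : Prop :=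
  ∃ p : ℝ, 1 / (2 * dim d) ≤ p ∧ ∀ g : Option Bool → ℝ,
    𝔼 x : maskedParity.X d, g (contribution m v x.1 (c x)) = p * g (some b) + (1 - p) * g none

theorem expect_maskedParity {d : ℕ} (hd : dim d ≠ 0) (f : List Bool → ℝ) :
    𝔼 x : maskedParity.X d, f x = 𝔼 u : MaskedPoint (dim d), f (maskedString u) :=
  (Fintype.expect_equiv (maskedEquiv d hd) _ _ fun u => by rw [coe_maskedEquiv]).symm

theorem revealsBit_selector {d : ℕ} (a : Bool) (r : Fin (dim d) → Bool) (i : Fin (dim d)) :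
    RevealsBit d (fun x => dot (a :: List.ofFn r) x.1) false (selector i) (r i) := by
  have hd : dim d ≠ 0 := i.pos.ne'
  have : NeZero (dim d) := ⟨hd⟩
  refine ⟨1 / (2 * dim d), le_rfl, fun g => ?_⟩
  have hindex : 𝔼 j, (if j = i then g (some (r i)) else g none)
      = 1 / dim d * g (some (r i)) + (1 - 1 / dim d) * g none := by
    calc 𝔼 j, (if j = i then g (some (r i)) else g none)
        = 𝔼 j, ((if j = i then g (some (r i)) - g none else 0) + g none) := by
          refine Finset.expect_congr rfl fun j _ => ?_
          split_ifs <;> simp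
      _ = 1 / dim d * g (some (r i)) + (1 - 1 / dim d) * g none := by
          simp [Finset.expect_add_distrib, Finset.expect_ite_eq', NNRat.smul_def]
          ring
  rw [expect_maskedParity hd fun x =>
    g (contribution false (selector i) x (dot (a :: List.ofFn r) x)), expect_maskedPoint]
  simp only [contribution_selector, Bool.true_eq_false, false_and, if_false, true_and, apply_ite g,
    Fintype.expect_const, hindex]
  ring

theorem revealsBit_ofFn {d : ℕ} (hd : dim d ≠ 0) (a : Bool) (r : Fin (dim d) → Bool) :
    RevealsBit d (fun x => dot (a :: List.ofFn r) x.1) true (List.ofFn r) a := by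
  have : NeZero (dim d) := ⟨hd⟩
  have hd_one : (1 : ℝ) ≤ dim d := by exact_mod_cast Nat.one_le_iff_ne_zero.2 hd
  refine ⟨1 / 2, one_div_le_one_div_of_le (by norm_num) (by linarith), fun g => ?_⟩
  rw [expect_maskedParity hd fun x =>
    g (contribution true (List.ofFn r) x (dot (a :: List.ofFn r) x)), expect_maskedPoint]
  simp only [contribution_ofFn, Bool.false_eq_true, if_false, if_true, Fintype.expect_const]
  ring

/-- The mode and the vector of the query for the bit that precedes the known last bits `l` of a
representation of length `n + 1`. -/
def nextQuery (n : ℕ) (l : List Bool) : Bool × List Bool :=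
  if l.length < n then (false, selector (n - 1 - l.length)) else (true, l)

theorem length_nextQuery_le {n : ℕ} {l : List Bool} (h : l.length ≤ n) :
    (nextQuery n l).2.length ≤ n := by
  unfold nextQuery
  split_ifs <;> simp [selector] <;> omega

theorem revealsBit_nextQuery {d : ℕ} (hd : dim d ≠ 0) {b : Bool} {l t : List Bool}
    (ht : t.length = dim d + 1) (h : b :: l <:+ t) :
    RevealsBit d (fun x => dot t x.1) (nextQuery (dim d) l).1 (nextQuery (dim d) l).2 b := by
  obtain ⟨a, t, rfl⟩ := List.exists_cons_of_length_eq_add_one ht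
  obtain ⟨r, rfl⟩ : ∃ r : Fin (dim d) → Bool, List.ofFn r = t :=
    ⟨fun i => t[i.1]'(by simp at ht; omega), List.ext_getElem (by simpa using ht.symm) (by simp)⟩
  rcases List.suffix_cons_iff.1 h with heq | hsuffix
  · obtain ⟨rfl, rfl⟩ := List.cons.inj heq
    simpa [nextQuery] using revealsBit_ofFn hd b r
  · have hlen : l.length + 1 ≤ dim d := by simpa using hsuffix.length_le
    have hb : r ⟨dim d - 1 - l.length, by omega⟩ = b := by
      have hget := hsuffix.getElem (i := 0) (by simp)
      simpa [Nat.sub_sub, Nat.add_comm] using hget.symm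
    rw [nextQuery, if_pos (by omega), ← hb]
    exact revealsBit_selector a r ⟨_, _⟩

/-! ### The learning program -/

@[simp]
theorem length_unary (n : ℕ) : (unary n).length = n := List.length_replicate

theorem runs_clear_st {r : ℕ} {l : List (List Bool)} {u : List Bool} (hu : st l r = u)
    (hr : r < l.length) : Runs (clear r) (st l) (st (l.set r [])) (5 * u.length + 1) := by
  rw [← update_st hr, ← hu]
  exact runs_clear r _

theorem runs_prepend_st {a t b : ℕ} {l : List (List Bool)} {u : List Bool} (hu : st l a = u)
    (ht : st l t = []) (hb : b < l.length) (hat : a ≠ t := by decide) (hab : a ≠ b := by decide)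
    (htb : t ≠ b := by decide) :
    Runs (prepend a t b) (st l) (st (l.set b (u ++ st l b))) (12 * u.length + 3) := by
  rw [← update_st hb, ← hu]
  exact runs_prepend hat hab htb ht

/-- Put the separator and the mode `m` in front of the vector in register `0`, and the coins in
register `7` in front of these. -/
def header (m : Bool) : Cmd := .seq (.seq (.push 0 m) (.push 0 false)) (prepend 7 6 0)

/-- Replace the contents of register `0` by those of register `5`. -/
def copyKnown : Cmd := .seq (clear 0) (prepend 5 6 0)

/-- Decrease the counter in register `4` and prepare the query for the bit with this index. -/
def indexPrep : Cmd :=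
  .seq (.pop 4) (.seq (clear 0) (.seq (.push 0 true) (.seq (prepend 4 6 0) (header false))))

/-- Learn the bits of a representation from the last to the first, and collect them in register
`5`. The command `bitProg` puts the query in register `0` to the oracle, as often as necessary, and
pushes the resulting bit onto register `5`. -/
def learnProg (bitProg : Cmd) : Cmd :=
  .seq (.loop 4 (.seq indexPrep bitProg))
    (.seq (.seq copyKnown (header true)) (.seq bitProg copyKnown))

/-- The stores that occur at the main stations of the learning programs. -/
def mainStore (l0 l1 l2 l3 : List Bool) (i : ℕ) (l5 : List Bool) (k : ℕ) (l8 : List Bool)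
    (tail : List (List Bool)) : Store :=
  st (l0 :: l1 :: l2 :: l3 :: List.replicate i false :: l5 :: [] :: unary k :: l8 :: [] :: [] ::
    [] :: tail)

section

variable (l0 l1 l2 l3 l5 l8 : List Bool) (i k : ℕ) (tail : List (List Bool))

theorem runs_header (m : Bool) :
    Runs (header m) (mainStore l0 l1 l2 l3 i l5 k l8 tail)
      (mainStore (unary k ++ false :: m :: l0) l1 l2 l3 i l5 k l8 tail) (12 * k + 7) := by
  have hpush : Runs (.seq (.push 0 m) (.push 0 false)) (mainStore l0 l1 l2 l3 i l5 k l8 tail)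
      (mainStore (false :: m :: l0) l1 l2 l3 i l5 k l8 tail) 3 :=
    Cmd.runs_of_eval_eq rfl (by simp [Cmd.eval, st_apply, update_st, mainStore]) le_rfl
  have hcoins := runs_prepend_st (u := unary k) (a := 7) (t := 6) (b := 0)
    (l := (false :: m :: l0) :: l1 :: l2 :: l3 :: List.replicate i false :: l5 :: [] :: unary k ::
      l8 :: [] :: [] :: [] :: tail) rfl rfl (by simp)
  exact (hpush.seq hcoins).mono (by simp; omega)

theorem runs_copyKnown :
    Runs copyKnown (mainStore l0 l1 l2 l3 i l5 k l8 tail)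
      (mainStore l5 l1 l2 l3 i l5 k l8 tail) (5 * l0.length + 12 * l5.length + 5) := by
  have hclear := runs_clear_st (u := l0) (r := 0)
    (l := l0 :: l1 :: l2 :: l3 :: List.replicate i false :: l5 :: [] :: unary k ::
      l8 :: [] :: [] :: [] :: tail) rfl (by simp)
  have hcopy := runs_prepend_st (u := l5) (a := 5) (t := 6) (b := 0)
    (l := [] :: l1 :: l2 :: l3 :: List.replicate i false :: l5 :: [] :: unary k ::
      l8 :: [] :: [] :: [] :: tail) rfl rfl (by simp)
  refine ((hclear.seq hcopy).congr_right ?_).mono (by omega)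
  simp [mainStore, st_apply]

theorem runs_indexPrep :
    Runs indexPrep (mainStore l0 l1 l2 l3 (i + 1) l5 k l8 tail)
      (mainStore (unary k ++ false :: false :: selector i) l1 l2 l3 i l5 k l8 tail)
      (5 * l0.length + 12 * i + 12 * k + 20) := by
  have hpop : Runs (.pop 4) (mainStore l0 l1 l2 l3 (i + 1) l5 k l8 tail)
      (mainStore l0 l1 l2 l3 i l5 k l8 tail) 1 :=
    Cmd.runs_of_eval_eq rfl (by simp [Cmd.eval, st_apply, update_st, mainStore]) le_rfl
  have hclear : Runs (clear 0) (mainStore l0 l1 l2 l3 i l5 k l8 tail)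
      (mainStore [] l1 l2 l3 i l5 k l8 tail) (5 * l0.length + 1) :=
    runs_clear_st rfl (by simp)
  have hpush : Runs (.push 0 true) (mainStore [] l1 l2 l3 i l5 k l8 tail)
      (mainStore [true] l1 l2 l3 i l5 k l8 tail) 1 :=
    Cmd.runs_of_eval_eq rfl (by simp [Cmd.eval, st_apply, update_st, mainStore]) le_rfl
  have hcopy : Runs (prepend 4 6 0) (mainStore [true] l1 l2 l3 i l5 k l8 tail)
      (mainStore (selector i) l1 l2 l3 i l5 k l8 tail) (12 * i + 3) :=
    (runs_prepend_st (u := List.replicate i false) rfl rfl (by simp)).mono (by simp)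
  have hheader := runs_header (selector i) l1 l2 l3 l5 l8 i k tail false
  exact (hpop.seq (hclear.seq (hpush.seq (hcopy.seq hheader)))).mono (by omega)

end

section

/-- The command `bitProg` learns the next bit: with the bits `l` of which `Known l` holds in
register `5` and the query for the next bit in register `0`, it arranges `Good l` within `C` steps,
provided that the rest of the computation arranges `Good (b :: l)` for all the bits `b` for which
`Known (b :: l)` holds. Register `1` contains `l1 j` when `j` bits are known. -/
def LearnsBit (bitProg : Cmd) (n k C : ℕ) (l1 : ℕ → List Bool) (l3 l8 : List Bool)
    (tail : List (List Bool)) (Known : List Bool → Prop)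
    (Good : List Bool → Alg (List Bool × List Bool) (List Bool) (Option (List Bool)) → Prop) :
    Prop :=
  ∀ l, Known l → l.length ≤ n → ∀ l2 i K B,
    let q := unary k ++ false :: (nextQuery n l).1 :: (nextQuery n l).2
    (∀ l2' b, Known (b :: l) → Ensures execOracle B
      (K, mainStore q (l1 (l.length + 1)) l2' l3 i (b :: l) k l8 tail) (Good (b :: l))) →
    Ensures execOracle (B + C) (bitProg :: K, mainStore q (l1 l.length) l2 l3 i l k l8 tail)
      (Good l)

variable {bitProg : Cmd} {n k C : ℕ} {l1 : ℕ → List Bool} {l3 l8 : List Bool}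
  {tail : List (List Bool)} {Known : List Bool → Prop}
  {Good : List Bool → Alg (List Bool × List Bool) (List Bool) (Option (List Bool)) → Prop}

theorem LearnsBit.ensures_lastBit (hbit : LearnsBit bitProg n k C l1 l3 l8 tail Known Good)
    (hout : ∀ l, Known l → l.length = n + 1 → Good l (.output (some l))) {l : List Bool}
    (hl : Known l) (hn : l.length = n) {l0 : List Bool} (hl0 : l0.length ≤ n + k + 2)
    (l2 : List Bool) :
    Ensures execOracle (C + 40 * (n + k + 2))
      ([.seq (.seq copyKnown (header true)) (.seq bitProg copyKnown)],
        mainStore l0 (l1 l.length) l2 l3 0 l k l8 tail) (Good l) := by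
  have hquery : nextQuery n l = (true, l) := if_neg hn.not_lt
  have hprep := (runs_copyKnown l0 (l1 l.length) l2 l3 l l8 0 k tail).seq
    (runs_header _ _ _ _ _ _ _ _ _ true)
    |>.mono (B' := 17 * n + 17 * k + 24) (by omega)
  refine (((Reach.seq _ _ _ _).trans ((hprep _).trans (Reach.seq _ _ _ _))).ensures
    followsSteps_execOracle ?_).mono (B := _ + (22 * n + 5 * k + 35 + C)) (by omega)
  have hafter := hbit l hl hn.le l2 0 [copyKnown] (22 * n + 5 * k + 35)
  simp only [hquery] at hafter
  refine hafter fun l2' b hb => ?_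
  have hcopy := runs_copyKnown (unary k ++ false :: true :: l) (l1 (l.length + 1)) l2' l3 (b :: l)
    l8 0 k tail
  refine ((hcopy []).ensures followsSteps_execOracle (B := 0) fun T _ => ?_).mono
    (by simp [hn]; omega)
  rw [execOracle_nil]
  exact hout _ hb (by simp [hn])

theorem LearnsBit.ensures_loop (hbit : LearnsBit bitProg n k C l1 l3 l8 tail Known Good)
    (hout : ∀ l, Known l → l.length = n + 1 → Good l (.output (some l))) {l : List Bool} {i : ℕ}
    (hl : Known l) (hi : l.length + i = n) {l0 : List Bool} (hl0 : l0.length ≤ n + k + 2)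
    (l2 : List Bool) :
    Ensures execOracle ((i + 1) * (C + 40 * (n + k + 2)) + 1)
      ([.loop 4 (.seq indexPrep bitProg),
        .seq (.seq copyKnown (header true)) (.seq bitProg copyKnown)],
        mainStore l0 (l1 l.length) l2 l3 i l k l8 tail) (Good l) := by
  induction i generalizing l l0 l2 with
  | zero =>
    exact ((Reach.loop_nil rfl).ensures followsSteps_execOracle
      (hbit.ensures_lastBit hout hl hi hl0 l2)).mono (by omega)
  | succ i ih =>
    have hquery : nextQuery n l = (false, selector i) := by
      rw [nextQuery, if_pos (by omega), show n - 1 - l.length = i by omega]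
    have hprep := runs_indexPrep l0 (l1 l.length) l2 l3 l l8 i k tail
      |>.mono (B' := 17 * n + 17 * k + 30) (by omega)
    refine (((Reach.loop_cons (List.cons_ne_nil _ _)).trans ((Reach.seq _ _ _ _).trans
      (hprep _))).ensures followsSteps_execOracle ?_).mono
      (B := _ + ((i + 1) * (C + 40 * (n + k + 2)) + 1 + C)) (by linarith)
    have hafter := hbit l hl (by omega) l2 i
    simp only [hquery] at hafter
    refine hafter _ _ fun l2' b hb => ih hb (by simp; omega) ?_ l2'
    simp [selector]
    omega

theorem LearnsBit.ensures_learnProg (hbit : LearnsBit bitProg n k C l1 l3 l8 tail Known Good)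
    (hout : ∀ l, Known l → l.length = n + 1 → Good l (.output (some l))) (hnil : Known [])
    (l2 : List Bool) :
    Ensures execOracle ((n + 1) * (C + 40 * (n + k + 2)) + 2)
      ([learnProg bitProg], mainStore [] (l1 0) l2 l3 n [] k l8 tail) (Good []) :=
  ((Reach.seq _ _ _ _).ensures followsSteps_execOracle
    (hbit.ensures_loop hout hnil (zero_add n) (Nat.zero_le _) l2)).mono (by omega)

end

/-- For every two elements of register `0`, push one onto register `4` and eight onto
register `1`. -/
def halveProg : Cmd :=
  .loop 0 (.seq (.pop 0) (.test 0 .skip .skip (.seq (.seq (.pop 0) (.push 4 false))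
    (.seq (.seq (.seq (.push 1 true) (.push 1 true)) (.seq (.push 1 true) (.push 1 true)))
      (.seq (.seq (.push 1 true) (.push 1 true)) (.seq (.push 1 true) (.push 1 true)))))))

theorem runs_halveProg (m i j : ℕ) (l2 l3 : List Bool) (tail : List (List Bool)) :
    Runs halveProg
      (st (unary m :: unary j :: l2 :: l3 :: List.replicate i false :: tail))
      (st ([] :: unary (8 * (m / 2) + j) :: l2 :: l3 :: List.replicate (m / 2 + i) false :: tail))
      (30 * m + 1) := by
  induction m using Nat.twoStepInduction generalizing i j with
  | zero => exact ((Runs.loop_nil rfl).congr_right (by simp [unary])).mono (by omega)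
  | one =>
    refine (Runs.loop_cons (List.cons_ne_nil _ _) (Cmd.runs_of_eval_eq
      (s' := st ([] :: unary j :: l2 :: l3 :: List.replicate i false :: tail)) rfl ?_ le_rfl)
      ((Runs.loop_nil rfl).congr_right (by simp))).mono (by simp [Cmd.cost])
    simp [Cmd.eval, st_apply, update_st, unary]
  | more m ih _ =>
    refine ((Runs.loop_cons (List.cons_ne_nil _ _) (Cmd.runs_of_eval_eq
      (s' := st (unary m :: unary (j + 8) :: l2 :: l3 :: List.replicate (i + 1) false :: tail))
      rfl ?_ le_rfl) (ih (i + 1) (j + 8))).congr_right ?_).mono (by simp [Cmd.cost]; omega)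
    · simp [Cmd.eval, st_apply, update_st, unary, List.replicate_succ]
    · rw [show 8 * (m / 2) + (j + 8) = 8 * ((m + 2) / 2) + j by omega,
        show m / 2 + (i + 1) = (m + 2) / 2 + i by omega]

/-! ### The SQ learner -/

theorem Alg.runSQ_mapOutput {X H H' : Type} (O : SQOracle X) (f : H → H')
    (P : Alg (SQQuery X) ℝ H) (past : List (SQQuery X)) :
    (P.mapOutput f).runSQ O past = (P.runSQ O past).map f := by
  induction P generalizing past with
  | output h => simp [Alg.mapOutput, Alg.runSQ, PMF.pure_map]
  | sample p k ih => simp [Alg.mapOutput, Alg.runSQ, PMF.map_bind, ih]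
  | query q k ih => simp [Alg.mapOutput, Alg.runSQ, ih]

theorem Alg.QueriesWithin.mapOutput {Q A H H' : Type} {reach : Q → Set A} {ok : Q → Prop}
    (f : H → H') {P : Alg Q A H} {t : ℕ} (h : P.QueriesWithin reach ok t) :
    (P.mapOutput f).QueriesWithin reach ok t := by
  induction P generalizing t with
  | output _ => trivial
  | sample p k ih => exact fun i hi => ih i (h i hi)
  | query q k ih =>
    cases t with
    | zero => exact h.elim
    | succ t => exact ⟨h.1, fun a ha => ih a (h.2 a ha)⟩

theorem length_update_le {s : Store} {r : ℕ} {v : List Bool} (hv : v.length ≤ (s r).length + 1)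
    (j : ℕ) : (Function.update s r v j).length ≤ (s j).length + 1 := by
  rcases eq_or_ne j r with rfl | hj
  · simpa using hv
  · simp [hj]

theorem Cmd.length_le_of_step_eq_next {c : Cmd} {K : List Cmd} {s : Store} {x : Cfg}
    (h : c.step K s = .next x) (j : ℕ) : (x.2 j).length ≤ (s j).length + 1 := by
  cases c with
  | skip | seq c c' => cases h; exact Nat.le_succ _
  | push r b | pop r => cases h; exact length_update_le (by simp; try omega) j
  | flip r | call => cases h
  | test r c₀ c₁ c₂ | loop r c =>
    simp only [Cmd.step] at h
    split at h <;> cases h <;> exact Nat.le_succ _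

theorem Cmd.length_le_of_step_eq_coin {c : Cmd} {K : List Cmd} {s : Store} {k : Bool → Cfg}
    (h : c.step K s = .coin k) (b : Bool) (j : ℕ) : ((k b).2 j).length ≤ (s j).length + 1 := by
  cases c with
  | flip r => cases h; exact length_update_le le_rfl j
  | skip | seq | push | pop | call => cases h
  | test r c₀ c₁ c₂ | loop r c =>
    simp only [Cmd.step] at h
    split at h <;> cases h

theorem Cmd.eq_of_step_eq_ask {c : Cmd} {K : List Cmd} {s : Store} {q r : List Bool}
    {k : List Bool → Cfg} (h : c.step K s = .ask q r k) : r = s 1 ∧ ∀ w, (k w).2 1 = s 1 := by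
  cases c with
  | call => cases h; simp
  | skip | seq | push | pop | flip => cases h
  | test r c₀ c₁ c₂ | loop r c =>
    simp only [Cmd.step] at h
    split at h <;> cases h

/-- A machine asks at most one query per step, and it cannot ask for a tolerance below the inverse
of the number of steps, since register `1` grows by at most one bit per step. -/
theorem queriesWithin_toSQ (G E : Cmd) (T₀ : ℕ) (X : Finset (List Bool)) (reach : SQQuery X → Set ℝ)
    (T : ℕ) (x : Cfg) (τ : ℝ) (hτ : τ ≤ 1 / ((T : ℝ) + (x.2 1).length + 2)) :
    (toSQ G E T₀ X (execOracle T x)).QueriesWithin reach (fun q => τ ≤ q.τ) T := by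
  induction T generalizing x with
  | zero =>
    obtain ⟨_ | ⟨c, K⟩, s⟩ := x <;> simp [execOracle, toSQ, Alg.QueriesWithin]
  | succ T ih =>
    obtain ⟨_ | ⟨c, K⟩, s⟩ := x
    · simp [execOracle, toSQ, Alg.QueriesWithin]
    · have hrest (y : Cfg) (hy : (y.2 1).length ≤ (s 1).length + 1) :
          (toSQ G E T₀ X (execOracle T y)).QueriesWithin reach (fun q => τ ≤ q.τ) T := by
        refine ih y (hτ.trans (one_div_le_one_div_of_le (by positivity) ?_))
        have hy' : ((y.2 1).length : ℝ) ≤ (s 1).length + 1 := by exact_mod_cast hy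
        push_cast
        linarith
      cases hstep : c.step K s with
      | next y =>
        simp only [execOracle, hstep]
        exact (hrest y (Cmd.length_le_of_step_eq_next hstep 1)).mono (fun _ _ h => h) T.le_succ
      | coin k =>
        simp only [execOracle, hstep]
        exact fun b _ => (hrest (k b) (Cmd.length_le_of_step_eq_coin hstep b 1)).mono
          (fun _ _ h => h) T.le_succ
      | ask q r k =>
        obtain ⟨rfl, hk⟩ := Cmd.eq_of_step_eq_ask hstep
        simp only [execOracle, hstep, toSQ]
        split_ifs with hG
        · refine ⟨hτ.trans (one_div_le_one_div_of_le (by positivity) ?_),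
            fun a _ => hrest _ (by rw [hk]; omega)⟩
          push_cast
          linarith [(Nat.cast_nonneg T : (0 : ℝ) ≤ T)]
        · trivial

/-- The statistical query with mode `m`, vector `v` and tolerance `1 / (l + 2)`. -/
noncomputable def valueQuery (X : Finset (List Bool)) (m : Bool) (v : List Bool) (l : ℕ) :
    SQQuery X where
  g x y := (contribution m v x y).getD false
  τ := 1 / ((l : ℝ) + 2)
  τ_pos := by positivity
  τ_lt_one := by
    rw [div_lt_one (by positivity)]
    linarith [(Nat.cast_nonneg l : (0 : ℝ) ≤ l)]

theorem RevealsBit.exists_expect_valueQuery_eq {d : ℕ} {c : maskedParity.X d → Bool} {m b : Bool}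
    {v : List Bool} (hb : RevealsBit d c m v b) (l : ℕ) :
    ∃ p : ℝ, 1 / (2 * dim d) ≤ p ∧
      (valueQuery (maskedParity.dom d) m v l).expect c = if b then 2 * p - 1 else -1 := by
  obtain ⟨p, hp, hg⟩ := hb
  refine ⟨p, hp, ?_⟩
  have hexpect := hg fun o => if o.getD false = true then 1 else -1
  rw [Fintype.expect_eq_sum_div_card] at hexpect
  refine hexpect.trans ?_
  cases b <;> simp <;> ring

theorem RevealsBit.exists_encodeAnswer_eq {d : ℕ} (hd : dim d ≠ 0) {c : maskedParity.X d → Bool}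
    {m b : Bool} {v : List Bool} (hb : RevealsBit d c m v b) {a : ℝ}
    (ha : a ∈ (valueQuery (maskedParity.dom d) m v (8 * dim d)).valid c) :
    ∃ N, encodeAnswer (1 / (((8 * dim d : ℕ) : ℝ) + 2)) a = unary N ∧
      if b then 8 * dim d + 5 ≤ N else N ≤ 8 * dim d + 3 := by
  have hn : (0 : ℝ) < dim d := Nat.cast_pos.2 (Nat.pos_of_ne_zero hd)
  obtain ⟨p, hp, hexpect⟩ := hb.exists_expect_valueQuery_eq (8 * dim d)
  rw [SQQuery.valid, Set.mem_ofPred_eq, hexpect, abs_le] at ha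
  obtain ⟨hlower, hupper⟩ : -(1 / (((8 * dim d : ℕ) : ℝ) + 2)) ≤ _ ∧ _ ≤ 1 / (_ + 2) := ha
  refine ⟨_, rfl, ?_⟩
  push_cast at *
  rw [div_div_eq_mul_div, div_one]
  have hcancel : 1 / (8 * (dim d : ℝ) + 2) * (8 * dim d + 2) = 1 := by field_simp
  cases b with
  | false =>
    rw [if_neg (by simp), ← Nat.lt_succ_iff, Nat.floor_lt' (by simp)]
    push_cast
    have hmul := mul_le_mul_of_nonneg_right hupper (by positivity : 0 ≤ 8 * (dim d : ℝ) + 2)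
    simp only [Bool.false_eq_true, if_false] at hmul
    linarith
  | true =>
    rw [if_pos rfl]
    refine Nat.le_floor ?_
    push_cast
    have hmul := mul_le_mul_of_nonneg_right hlower (by positivity : 0 ≤ 8 * (dim d : ℝ) + 2)
    have hp' : 1 ≤ p * (2 * dim d) := (div_le_iff₀ (by positivity)).1 hp
    simp only [if_true] at hmul
    have hp0 : 0 < p := lt_of_lt_of_le (by positivity) hp
    linarith

/-- Run as an SQ algorithm with the oracle `O`, the computation has the hypothesis `h` as its
outcome. -/
def SQOutputs {X : Finset (List Bool)} (O : SQOracle X) (T₀ : ℕ) (h : X → Bool)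
    (P : Alg (List Bool × List Bool) (List Bool) (Option (List Bool))) : Prop :=
  ∀ past, (toSQ queryProg evalProg T₀ X P).runSQ O past = PMF.pure (some h)

theorem sqOutputs_output {X : Finset (List Bool)} (O : SQOracle X) {T₀ : ℕ} {t : List Bool}
    (hT : 15 * t.length + 10 ≤ T₀) : SQOutputs O T₀ (fun x => dot t x.1) (.output (some t)) := by
  intro past
  simp [toSQ, Alg.runSQ, decodeHyp_evalProg X t hT]

theorem ensures_sqOutputs_call {X : Finset (List Bool)} {O : SQOracle X} {c h : X → Bool}
    (hO : O.IsFor c) {T₀ B : ℕ} {K : List Cmd} {s : Store} {m : Bool} {v : List Bool}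
    (hs : s 0 = false :: m :: v) (hT : 15 * v.length + 60 ≤ T₀)
    (hK : ∀ a ∈ (valueQuery X m v (s 1).length).valid c, Ensures execOracle B
      (K, Function.update s 2 (encodeAnswer (1 / (((s 1).length : ℝ) + 2)) a)) (SQOutputs O T₀ h)) :
    Ensures execOracle (1 + B) (.call :: K, s) (SQOutputs O T₀ h) := by
  intro T hBT past
  obtain ⟨T, rfl⟩ : ∃ T', T = T' + 1 := ⟨T - 1, by omega⟩
  simp only [execOracle, Cmd.step, toSQ, hs, exec_queryProg m v _ _ hT, accepts_bit]
  rw [if_pos (by simp)]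
  exact hK _ (hO past (valueQuery X m v (s 1).length)) T (by omega) _

/-- Shorten register `b` by the length of register `a`. -/
def dropLength (a b : ℕ) : Cmd := forEach a fun _ => .pop b

theorem runs_dropLength {a b : ℕ} (hab : a ≠ b) (s : Store) :
    Runs (dropLength a b) s
      (Function.update (Function.update s a []) b ((s b).drop (s a).length))
      (5 * (s a).length + 1) := by
  have h := runs_forEach (a := a) (f := fun _ => .pop b)
    (fun p l => Function.update (Function.update s a l) b ((s b).drop p.length)) (by simp [hab])
    (fun _ _ _ => Cmd.runs_of_eval_eq rfl (by
      simp [Cmd.eval, Function.update_comm hab.symm]) le_rfl) [] (s a)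
  simpa [dropLength, Cmd.cost] using h

/-- Put the query in register `0` to the SQ oracle and push the bit that it reveals onto
register `5`. -/
def sqBitProg : Cmd :=
  .seq .call (.seq (prepend 1 6 9) (.seq (dropLength 9 2)
    (.seq (.seq (.seq (.pop 2) (.pop 2)) (.seq (.pop 2) (.pop 2)))
      (.test 2 (.push 5 false) .skip (.push 5 true)))))

theorem runs_decodeAnswer {n N : ℕ} {b : Bool} (hN : if b then n + 5 ≤ N else N ≤ n + 3)
    (l0 l3 l5 l8 : List Bool) (i k : ℕ) (tail : List (List Bool)) :
    Runs (.seq (prepend 1 6 9) (.seq (dropLength 9 2)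
        (.seq (.seq (.seq (.pop 2) (.pop 2)) (.seq (.pop 2) (.pop 2)))
          (.test 2 (.push 5 false) .skip (.push 5 true)))))
      (mainStore l0 (unary n) (unary N) l3 i l5 k l8 tail)
      (mainStore l0 (unary n) (unary (N - n - 4)) l3 i (b :: l5) k l8 tail) (17 * n + 20) := by
  have hcopy : Runs (prepend 1 6 9) (mainStore l0 (unary n) (unary N) l3 i l5 k l8 tail)
      (st (l0 :: unary n :: unary N :: l3 :: List.replicate i false :: l5 :: [] :: unary k :: l8 ::
        unary n :: [] :: [] :: tail)) (12 * n + 3) := by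
    refine ((runs_prepend_st rfl rfl (by simp)).congr_right ?_).mono (by simp [st_apply])
    simp [st_apply]
  have hdrop : Runs (dropLength 9 2)
      (st (l0 :: unary n :: unary N :: l3 :: List.replicate i false :: l5 :: [] :: unary k :: l8 ::
        unary n :: [] :: [] :: tail))
      (mainStore l0 (unary n) (unary (N - n)) l3 i l5 k l8 tail) (5 * n + 1) := by
    refine ((runs_dropLength (by decide) _).congr_right ?_).mono (by simp [st_apply])
    simp [mainStore, update_st, st_apply, unary]
  have hpush : Runs (.seq (.seq (.seq (.pop 2) (.pop 2)) (.seq (.pop 2) (.pop 2)))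
        (.test 2 (.push 5 false) .skip (.push 5 true)))
      (mainStore l0 (unary n) (unary (N - n)) l3 i l5 k l8 tail)
      (mainStore l0 (unary n) (unary (N - n - 4)) l3 i (b :: l5) k l8 tail) 14 := by
    refine Cmd.runs_of_eval_eq rfl ?_ (by simp [Cmd.cost])
    cases b with
    | false =>
      rw [if_neg (by simp)] at hN
      simp [Cmd.eval, mainStore, st_apply, update_st, unary, show N - n - 4 = 0 by omega,
        show N - n - 1 - 1 - 1 - 1 = 0 by omega]
    | true =>
      obtain ⟨j, rfl⟩ := Nat.exists_eq_add_of_le (by simpa using hN)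
      simp [Cmd.eval, mainStore, st_apply, update_st, unary, show n + 5 + j - n = j + 5 by omega,
        List.replicate_succ]
  exact (hcopy.seq (hdrop.seq hpush)).mono (by omega)

theorem exists_cons_suffix {α : Type*} {l t : List α} (hl : l <:+ t) (hlt : l.length < t.length) :
    ∃ b, b :: l <:+ t := by
  obtain ⟨p, rfl⟩ := hl
  rcases p.eq_nil_or_concat with rfl | ⟨p, b, rfl⟩
  · simp at hlt
  · exact ⟨b, p, by simp⟩

theorem learnsBit_sqBitProg {d : ℕ} (hd : dim d ≠ 0) {t : List Bool} (ht : t.length = dim d + 1)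
    {O : SQOracle (maskedParity.X d)} (hO : O.IsFor fun x => dot t x.1) {T₀ : ℕ}
    (hT : 15 * dim d + 75 ≤ T₀) (h : maskedParity.X d → Bool) (l3 l8 : List Bool)
    (tail : List (List Bool)) :
    LearnsBit sqBitProg (dim d) 0 (136 * dim d + 30) (fun _ => unary (8 * dim d)) l3 l8 tail
      (fun l => l <:+ t) fun _ => SQOutputs O T₀ h := by
  intro l hl hn l2 i K B q hK
  obtain ⟨b, hb⟩ := exists_cons_suffix hl (by omega)
  refine ((Reach.seq _ _ _ _).ensures followsSteps_execOracle
    (ensures_sqOutputs_call hO rfl ?_ fun a ha => ?_)).mono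
    (B := 1 + (1 + (17 * (8 * dim d) + 20 + B))) (by omega)
  · have := length_nextQuery_le hn
    omega
  rw [show (mainStore q (unary (8 * dim d)) l2 l3 i l 0 l8 tail 1).length = 8 * dim d from
    length_unary _] at ha ⊢
  obtain ⟨N, hN, hbN⟩ := (revealsBit_nextQuery hd ht hb).exists_encodeAnswer_eq hd ha
  rw [hN, show Function.update (mainStore q (unary (8 * dim d)) l2 l3 i l 0 l8 tail) 2 (unary N)
    = mainStore q (unary (8 * dim d)) (unary N) l3 i l 0 l8 tail by simp [mainStore, update_st]]
  exact (runs_decodeAnswer hbN q l3 l l8 i 0 tail K).ensures followsSteps_execOracle (hK _ b hb)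

/-- The program of the SQ learner. -/
def sqProg : Cmd := .seq (clear 1) (.seq (.pop 0) (.seq halveProg (learnProg sqBitProg)))

theorem reach_learnProg_of_sqProg (d A L : ℕ) :
    Reach (5 * A + 30 * d + 8) (sqProg.init [unary d, unary A, unary L])
      ([learnProg sqBitProg],
        mainStore [] (unary (8 * dim d)) (unary L) [] (dim d) [] 0 [] []) := by
  rw [Cmd.init_eq_st _ _ 9]
  have hclear : Runs (clear 1) (st ([unary d, unary A, unary L] ++ List.replicate 9 []))
      (st (unary d :: [] :: unary L :: List.replicate 9 [])) (5 * A + 1) :=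
    (runs_clear_st rfl (by simp)).mono (by simp [st_apply])
  have hpop : Runs (.pop 0) (st (unary d :: [] :: unary L :: List.replicate 9 []))
      (st (unary (d - 1) :: unary 0 :: unary L :: List.replicate 9 [])) 1 :=
    Cmd.runs_of_eval_eq rfl (by simp [Cmd.eval, st_apply, update_st, unary]) le_rfl
  have hhalve := runs_halveProg (d - 1) 0 0 (unary L) [] (List.replicate 7 [])
  exact ((Reach.seq _ _ _ _).trans ((hclear _).trans ((Reach.seq _ _ _ _).trans
    ((hpop _).trans ((Reach.seq _ _ _ _).trans (hhalve _)))))).mono (by omega)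

theorem ensures_sqOutputs_sqProg {d : ℕ} (hd : dim d ≠ 0) {t : List Bool}
    (ht : t.length = dim d + 1) {O : SQOracle (maskedParity.X d)}
    (hO : O.IsFor fun x => dot t x.1) {T₀ : ℕ} (hT : 15 * dim d + 75 ≤ T₀) (A L : ℕ) :
    Ensures execOracle (200 * (d + A + 3) ^ 2) (sqProg.init [unary d, unary A, unary L])
      (SQOutputs O T₀ fun x => dot t x.1) := by
  refine ((reach_learnProg_of_sqProg d A L).ensures followsSteps_execOracle
    ((learnsBit_sqBitProg hd ht hO hT (fun x => dot t x.1) [] [] []).ensures_learnProg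
      (fun l hl hlen => ?_) t.nil_suffix (unary L))).mono ?_
  · rw [hl.eq_of_length (hlen.trans ht.symm)]
    exact sqOutputs_output O (by omega)
  · have hdim := two_mul_dim_le d
    nlinarith [Nat.zero_le (d * A), Nat.zero_le (A * A)]

/-- The step bound of the machine of the SQ learner. -/
noncomputable def sqTime (d : ℕ) (α _β : ℝ) : ℕ := 200 * (d + ⌈1 / α⌉₊ + 3) ^ 2

/-- The SQ learner for masked parities; `fun _ => false` stands for an undecodable hypothesis. -/
noncomputable def sqLearner : SQFamily maskedParity := fun d α β =>
  (machineSQ maskedParity sqProg queryProg evalProg sqTime d α β).mapOutput fun o =>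
    o.getD fun _ => false

theorem Admissible.one_div_pos {α β : ℝ} (h : Admissible α β) : 0 < 1 / α :=
  _root_.one_div_pos.2 h.1.1

theorem Admissible.logb_pos {α β : ℝ} (h : Admissible α β) : 0 < Real.logb 2 (1 / β) := by
  refine Real.logb_pos one_lt_two ?_
  rw [lt_div_iff₀ h.2.1]
  linarith [h.2.2]

theorem err_self {X : Type} [Fintype X] (c : X → Bool) : err c c = 0 := by
  simp [err]

theorem sqTime_add_le {d : ℕ} {α β : ℝ} (h : Admissible α β) {x : ℝ}
    (hx : d + 1 / α + Real.logb 2 (1 / β) ≤ x) :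
    (sqTime d α β : ℝ) + ⌈1 / α⌉₊ + 2 ≤ polyBound 3300 2 x := by
  have hα := h.one_div_pos
  have hβ := h.logb_pos
  have hceil := (Nat.ceil_lt_add_one hα.le).le
  unfold sqTime polyBound
  push_cast
  set A : ℝ := (⌈1 / α⌉₊ : ℝ)
  have : 0 ≤ A := Nat.cast_nonneg _
  have : (0 : ℝ) ≤ d := Nat.cast_nonneg _
  have hsq : ((d : ℝ) + A + 3) ^ 2 ≤ (4 * (1 + x)) ^ 2 := by
    gcongr
    linarith
  nlinarith

theorem runSQ_machineSQ {d : ℕ} (α β : ℝ) {c : maskedParity.X d → Bool}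
    (hc : c ∈ maskedParity.concepts d) {O : SQOracle (maskedParity.X d)} (hO : O.IsFor c) :
    (machineSQ maskedParity sqProg queryProg evalProg sqTime d α β).runSQ O []
      = PMF.pure (some c) := by
  obtain ⟨hd, t, ht, rfl⟩ := maskedParity_mem_concepts.1 hc
  refine ensures_sqOutputs_sqProg hd ht hO ?_ _ _ _ le_rfl []
  have hdim := two_mul_dim_le d
  unfold sqTime
  nlinarith [Nat.zero_le (d * ⌈1 / α⌉₊), Nat.zero_le (⌈1 / α⌉₊ * ⌈1 / α⌉₊)]

theorem sqLearner_queriesWithin {d : ℕ} {α β : ℝ} (h : Admissible α β) {x : ℝ}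
    (hx : d + 1 / α + Real.logb 2 (1 / β) ≤ x) (reach : SQQuery (maskedParity.X d) → Set ℝ) :
    (sqLearner d α β).QueriesWithin reach (fun q => 1 / polyBound 3300 2 x ≤ q.τ)
      ⌊polyBound 3300 2 x⌋₊ := by
  have htime := sqTime_add_le h hx
  refine ((queriesWithin_toSQ _ _ _ _ _ _ _ _ ?_).mono (fun _ _ h => h) ?_).mapOutput _
  · refine one_div_le_one_div_of_le (by positivity) (le_trans (le_of_eq ?_) htime)
    simp [Cmd.init, unary]
  · exact Nat.le_floor (by linarith [(Nat.cast_nonneg _ : (0 : ℝ) ≤ ⌈1 / α⌉₊)])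

theorem maskedParity_mem_effAdaptiveSQ : maskedParity ∈ EffAdaptiveSQ := by
  refine ⟨sqLearner, ⟨3300, 2, fun d α β hαβ c hc => ⟨?_, fun O hO => ?_⟩⟩,
    sqProg, queryProg, evalProg, sqTime, 3300, 2, fun d α β hαβ =>
      ⟨?_, fun c hc O hO => ?_, rfl⟩⟩
  · have : (0 : ℝ) ≤ maskedParity.size d c := Nat.cast_nonneg _
    exact sqLearner_queriesWithin hαβ (by linarith) _
  · rw [sqLearner, Alg.runSQ_mapOutput, runSQ_machineSQ α β hc hO, PMF.pure_map,
      PMF.toOuterMeasure_pure_apply, if_pos (by simpa [err_self] using hαβ.1.1.le),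
      ← ENNReal.ofReal_one]
    exact ENNReal.ofReal_le_ofReal (by linarith [hαβ.2.1])
  · linarith [sqTime_add_le hαβ (le_refl (d + 1 / α + _)), (Nat.cast_nonneg _ : (0 : ℝ) ≤ ⌈1 / α⌉₊)]
  · rw [runSQ_machineSQ α β hc hO]
    simp

/-! ### Noisy bits -/

theorem noisy_toReal (o : Option Bool) (k : ℕ) (b : Bool) : (noisy o k b).toReal =
    1 / 2 + (1 / 2) ^ k * o.elim 0 fun b' => if b' = b then 1 / 2 else -1 / 2 := by
  induction k with
  | zero =>
    cases o with
    | none => simp [noisy]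
    | some b' =>
      by_cases h : b = b'
      · norm_num [noisy, h]
      · norm_num [noisy, h, Ne.symm h]
  | succ k ih =>
    rw [noisy, PMF.bind_apply, tsum_fintype, Fintype.sum_bool, ENNReal.toReal_add
      (ENNReal.mul_ne_top (PMF.apply_ne_top _ _) (PMF.apply_ne_top _ _))
      (ENNReal.mul_ne_top (PMF.apply_ne_top _ _) (PMF.apply_ne_top _ _)),
      ENNReal.toReal_mul, ENNReal.toReal_mul]
    simp only [if_true, Bool.false_eq_true, if_false, ih, PMF.uniformOfFintype_apply]
    simp
    ring

theorem abs_noisy_sub_le (o : Option Bool) (k : ℕ) (b : Bool) :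
    |(noisy o k b).toReal - 1 / 2| ≤ (1 / 2) ^ k / 2 := by
  have h : (0 : ℝ) < (1 / 2) ^ k := by positivity
  rw [noisy_toReal, add_sub_cancel_left, abs_mul, abs_of_pos h, div_eq_mul_inv _ (2 : ℝ)]
  refine mul_le_mul_of_nonneg_left ?_ h.le
  cases o with
  | none => simp
  | some b' =>
    simp only [Option.elim_some]
    split_ifs <;> norm_num [abs_of_neg]

theorem noisy_apply_le {k : ℕ} {ε : ℝ} (hk : k ≠ 0) (hε : 4 * (1 / 2) ^ k ≤ ε)
    (o o' : Option Bool) (b : Bool) :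
    noisy o k b ≤ ENNReal.ofReal (Real.exp ε) * noisy o' k b := by
  rw [← ENNReal.ofReal_toReal (PMF.apply_ne_top (noisy o k) b),
    ← ENNReal.ofReal_toReal (PMF.apply_ne_top (noisy o' k) b),
    ← ENNReal.ofReal_mul (Real.exp_pos _).le]
  refine ENNReal.ofReal_le_ofReal ?_
  have hupper := (abs_le.1 (abs_noisy_sub_le o k b)).2
  have hlower := (abs_le.1 (abs_noisy_sub_le o' k b)).1
  have hhalf : ((1 : ℝ) / 2) ^ k ≤ 1 / 2 :=
    pow_le_of_le_one (by norm_num) (by norm_num) hk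
  have hpos : (0 : ℝ) < (1 / 2) ^ k := by positivity
  set t : ℝ := (1 / 2) ^ k
  calc (noisy o k b).toReal ≤ 1 / 2 + t / 2 := by linarith
    _ ≤ (1 + 4 * t) * (1 / 2 - t / 2) := by nlinarith
    _ ≤ Real.exp ε * (noisy o' k b).toReal :=
      mul_le_mul (by linarith [Real.add_one_le_exp ε]) (by linarith) (by linarith)
        (Real.exp_pos _).le

theorem map_apply_le_mul {α β : Type*} {p q : PMF α} {a : ENNReal} (h : ∀ x, p x ≤ a * q x)
    (f : α → β) (y : β) : p.map f y ≤ a * q.map f y := by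
  simp only [PMF.map_apply, ← ENNReal.tsum_mul_left]
  refine ENNReal.tsum_le_tsum fun x => ?_
  split_ifs
  · exact h x
  · exact zero_le

theorem isLocalRandomizer_noisy {D : Type} (o : D → Option Bool) {k : ℕ} {ε : ℝ} (hk : k ≠ 0)
    (hε : 4 * (1 / 2) ^ k ≤ ε) :
    IsLocalRandomizer ε fun u => (noisy (o u) k).map fun b => [b] := fun _ _ =>
  map_apply_le_mul (noisy_apply_le hk hε _ _) _

/-- The probability that the noisy answer to a query about a random example of `c` is `b`. -/
noncomputable def answerProb {X : Finset (List Bool)} (c : X → Bool) (m : Bool) (v : List Bool)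
    (k : ℕ) (b : Bool) : ℝ :=
  𝔼 x : X, (noisy (contribution m v x.1 (c x)) k b).toReal

theorem answerProb_nonneg {X : Finset (List Bool)} (c : X → Bool) (m : Bool) (v : List Bool)
    (k : ℕ) (b : Bool) : 0 ≤ answerProb c m v k b :=
  Finset.expect_nonneg fun _ _ => ENNReal.toReal_nonneg

theorem uniform_bind_noisy_apply {X : Finset (List Bool)} [Nonempty X] (c : X → Bool) (m : Bool)
    (v : List Bool) (k : ℕ) (b : Bool) :
    ((PMF.uniformOfFintype X).bind fun x => noisy (contribution m v x.1 (c x)) k) b =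
      ENNReal.ofReal (answerProb c m v k b) := by
  rw [← ENNReal.ofReal_toReal (PMF.apply_ne_top _ b)]
  congr 1
  rw [PMF.bind_apply, tsum_fintype, ENNReal.toReal_sum
    (fun x _ => ENNReal.mul_ne_top (PMF.apply_ne_top _ _) (PMF.apply_ne_top _ _)), answerProb,
    Fintype.expect_eq_sum_div_card, Finset.sum_div]
  refine Finset.sum_congr rfl fun x _ => ?_
  rw [ENNReal.toReal_mul, PMF.uniformOfFintype_apply, ENNReal.toReal_inv, ENNReal.toReal_natCast]
  ring

theorem RevealsBit.exists_answerProb_eq {d : ℕ} {c : maskedParity.X d → Bool} {m b : Bool}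
    {v : List Bool} (h : RevealsBit d c m v b) (k : ℕ) :
    ∃ g : ℝ, (1 / 2) ^ k / (4 * dim d) ≤ g ∧
      answerProb c m v k b = 1 / 2 + g ∧ answerProb c m v k (!b) = 1 / 2 - g := by
  obtain ⟨p, hp, hg⟩ := h
  refine ⟨p * (1 / 2) ^ k / 2, ?_, ?_, ?_⟩
  · calc ((1 : ℝ) / 2) ^ k / (4 * dim d) = 1 / (2 * dim d) * (1 / 2) ^ k / 2 := by
          rw [div_mul_eq_mul_div, one_mul, div_div]
          congr 1
          ring
      _ ≤ p * (1 / 2) ^ k / 2 := by gcongr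
  · rw [answerProb, hg fun o => (noisy o k b).toReal, noisy_toReal, noisy_toReal]
    simp
    ring
  · rw [answerProb, hg fun o => (noisy o k (!b)).toReal, noisy_toReal, noisy_toReal]
    simp
    ring

/-! ### Local algorithms that use each entry of the database once -/

/-- Starting with the entry `j`, the algorithm puts one query to each entry in turn, with an
`ε`-local randomizer. It makes no random choices of its own and does not fail. -/
def SinglePass {D H : Type} {N : ℕ} (ε : ℝ) :
    Alg (LRQuery D N) (List Bool) (Option H) → ℕ → Prop
  | .output o, _ => o ≠ none
  | .sample _ _, _ => False
  | .query q k, j => (q.1 : ℕ) = j ∧ IsLocalRandomizer ε q.2 ∧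
      ∀ w ∈ LRQuery.reach q, SinglePass ε (k w) (j + 1)

section

variable {D H : Type} {N : ℕ} {ε : ℝ} {P : Alg (LRQuery D N) (List Bool) (Option H)} {j : ℕ}

theorem SinglePass.localWithin (hP : SinglePass ε P j) {budget : Fin N → ℝ}
    (hb : ∀ i : Fin N, j ≤ i → budget i = ε) : P.LocalWithin budget := by
  induction P generalizing j budget with
  | output _ => trivial
  | sample _ _ => exact hP.elim
  | query q k ih =>
    obtain ⟨hindex, hlocal, hrest⟩ := hP
    refine ⟨ε, hlocal, (hb q.1 hindex.ge).ge, fun w hw => ih w (hrest w hw) fun i hi => ?_⟩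
    rw [Function.update_of_ne]
    · exact hb i (by omega)
    · rintro rfl
      omega

theorem SinglePass.none_notMem (hP : SinglePass ε P j) (z : Fin N → D) :
    none ∉ (P.runLR z).support := by
  induction P generalizing j with
  | output o => simpa [Alg.runLR, eq_comm, SinglePass] using hP
  | sample _ _ => exact hP.elim
  | query q k ih =>
    simp only [Alg.runLR, PMF.mem_support_bind_iff, not_exists, not_and]
    exact fun w hw => ih w (hP.2.2 w ⟨_, hw⟩)

theorem SinglePass.runLR_update (hP : SinglePass ε P j) (z : Fin N → D) {i : Fin N}
    (hi : (i : ℕ) < j) (u : D) : P.runLR (Function.update z i u) = P.runLR z := by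
  induction P generalizing j with
  | output _ => rfl
  | sample _ _ => exact hP.elim
  | query q k ih =>
    obtain ⟨hindex, -, hrest⟩ := hP
    have hne : q.1 ≠ i := by
      rintro rfl
      omega
    simp only [Alg.runLR, Function.update_of_ne hne]
    exact bind_congr_of_mem_support fun w hw => ih w (hrest w ⟨_, hw⟩) (by omega)

end

/-- The output of an algorithm each of whose queries is put to a fresh random example of `c`. -/
noncomputable def freshRun {X H : Type} [Fintype X] [Nonempty X] {N : ℕ} (c : X → Bool) :
    Alg (LRQuery (X × Bool) N) (List Bool) H → PMF H
  | .output h => PMF.pure h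
  | .sample p k => p.bind fun i => freshRun c (k i)
  | .query q k => ((PMF.uniformOfFintype X).bind fun x => q.2 (x, c x)).bind fun w =>
      freshRun c (k w)

theorem SinglePass.localOutput_eq {X H : Type} [Fintype X] [Nonempty X] {N : ℕ} {ε : ℝ}
    {c : X → Bool} {P : Alg (LRQuery (X × Bool) N) (List Bool) (Option H)} {j : ℕ}
    (hP : SinglePass ε P j) : localOutput P (fun _ => c) = freshRun c P := by
  unfold localOutput
  induction P generalizing j with
  | output o => simp [Alg.runLR, freshRun]
  | sample _ _ => exact hP.elim
  | query q k ih =>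
    obtain ⟨hindex, -, hrest⟩ := hP
    rw [← uniform_bind_update q.1]
    simp only [Alg.runLR, freshRun, Function.update_self, PMF.bind_bind]
    rw [PMF.bind_comm]
    congr 1
    funext u
    rw [PMF.bind_comm]
    refine bind_congr_of_mem_support fun w hw => ?_
    have hexamples (x : Fin N → X) :
        (fun i => (Function.update x q.1 u i, c (Function.update x q.1 u i))) =
          Function.update (fun i => (x i, c (x i))) q.1 (u, c u) := by
      funext i
      rcases eq_or_ne i q.1 with rfl | hi
      · simp
      · simp [hi]
    simp only [hexamples, (hrest w ⟨_, hw⟩).runLR_update _ (show (q.1 : ℕ) < j + 1 by omega)]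
    exact ih w (hrest w ⟨_, hw⟩)

theorem Alg.runLR_mapOutput {D H H' : Type} {N : ℕ} (z : Fin N → D) (f : H → H')
    (P : Alg (LRQuery D N) (List Bool) H) : (P.mapOutput f).runLR z = (P.runLR z).map f := by
  induction P with
  | output h => simp [Alg.mapOutput, Alg.runLR, PMF.pure_map]
  | sample p k ih => simp [Alg.mapOutput, Alg.runLR, PMF.map_bind, ih]
  | query q k ih => simp [Alg.mapOutput, Alg.runLR, PMF.map_bind, ih]

theorem Alg.LocalWithin.mapOutput {D H H' : Type} {N : ℕ} (f : H → H')
    {P : Alg (LRQuery D N) (List Bool) H} {budget : Fin N → ℝ} (h : P.LocalWithin budget) :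
    (P.mapOutput f).LocalWithin budget := by
  induction P generalizing budget with
  | output _ => trivial
  | sample p k ih => exact fun i hi => ih i (h i hi)
  | query q k ih =>
    obtain ⟨e, hlocal, hle, hrest⟩ := h
    exact ⟨e, hlocal, hle, fun w hw => ih w (hrest w hw)⟩

theorem queriesWithin_toLocal (R E : Cmd) (T₀ N : ℕ) (X : Finset (List Bool))
    (reach : LRQuery (X × Bool) N → Set (List Bool)) (T : ℕ) (x : Cfg) :
    (toLocal R E T₀ N X (execOracle T x)).QueriesWithin reach (fun _ => True) T := by
  induction T generalizing x with
  | zero =>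
    obtain ⟨_ | ⟨c, K⟩, s⟩ := x <;> simp [execOracle, toLocal, Alg.QueriesWithin]
  | succ T ih =>
    obtain ⟨_ | ⟨c, K⟩, s⟩ := x
    · simp [execOracle, toLocal, Alg.QueriesWithin]
    · have hrest (y : Cfg) : (toLocal R E T₀ N X (execOracle T y)).QueriesWithin reach
          (fun _ => True) (T + 1) := (ih y).mono (fun _ _ h => h) T.le_succ
      cases hstep : c.step K s with
      | next y =>
        simp only [execOracle, hstep]
        exact hrest y
      | coin k =>
        simp only [execOracle, hstep]
        exact fun b _ => hrest (k b)
      | ask q r k =>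
        simp only [execOracle, hstep, toLocal]
        split_ifs
        · exact ⟨trivial, fun a _ => ih _⟩
        · trivial

/-- Run as a local algorithm, the computation uses each entry once, from the entry `j` on, and, if
`H` holds, it fails to output `c` with probability at most `φ`. Only the first part is claimed about
the branches on which a majority vote has gone wrong. -/
def LocalSucceeds {X : Finset (List Bool)} [Nonempty X] (c : X → Bool) (ε : ℝ) (T₀ N : ℕ)
    (H : Prop) (φ : ℝ) (j : ℕ) (P : Alg (List Bool × List Bool) (List Bool) (Option (List Bool))) :
    Prop :=
  SinglePass ε (toLocal randomizerProg evalProg T₀ N X P) j ∧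
    (H → (freshRun c (toLocal randomizerProg evalProg T₀ N X P)).toOuterMeasure {o | o ≠ some c} ≤
      ENNReal.ofReal φ)

section

variable {X : Finset (List Bool)} [Nonempty X] {c : X → Bool} {ε : ℝ} {T₀ N : ℕ} {H : Prop}
  {φ : ℝ} {j : ℕ} {P : Alg (List Bool × List Bool) (List Bool) (Option (List Bool))}

theorem LocalSucceeds.mono (h : LocalSucceeds c ε T₀ N H φ j P) {H' : Prop} {φ' : ℝ} (hH : H' → H)
    (hφ : H' → φ ≤ φ') : LocalSucceeds c ε T₀ N H' φ' j P :=
  ⟨h.1, fun hH' => (h.2 (hH hH')).trans (ENNReal.ofReal_le_ofReal (hφ hH'))⟩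

theorem LocalSucceeds.of_one_le (h : LocalSucceeds c ε T₀ N H φ j P) {φ' : ℝ} (hφ : 1 ≤ φ')
    (H' : Prop) : LocalSucceeds c ε T₀ N H' φ' j P :=
  ⟨h.1, fun _ => (toOuterMeasure_le_one _ _).trans
    (ENNReal.ofReal_one ▸ ENNReal.ofReal_le_ofReal hφ)⟩

theorem localSucceeds_output {t : List Bool} (hT : 15 * t.length + 10 ≤ T₀)
    (hH : H → c = fun x => dot t x.1) (j : ℕ) :
    LocalSucceeds c ε T₀ N H 0 j (.output (some t)) := by
  simp only [LocalSucceeds, toLocal, Option.bind_some, decodeHyp_evalProg X t hT]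
  refine ⟨by simp [SinglePass], fun h => ?_⟩
  rw [freshRun, PMF.toOuterMeasure_pure_apply, if_neg (by simp [← hH h])]
  exact zero_le

theorem ensures_localSucceeds_call {B k : ℕ} {K : List Cmd} {s : Store} {m : Bool} {v : List Bool}
    (hs : s 0 = unary k ++ false :: m :: v) (hj : (s 1).length = j) (hjN : j < N)
    (hT : 15 * v.length + 15 * k + 70 ≤ T₀) (hk : k ≠ 0) (hε : 4 * (1 / 2) ^ k ≤ ε)
    {φ : Bool → ℝ} (hφ : ∀ b, 0 ≤ φ b)
    (hK : ∀ b, Ensures execOracle B (K, Function.update s 2 [b])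
      (LocalSucceeds c ε T₀ N H (φ b) (j + 1))) :
    Ensures execOracle (1 + B) (.call :: K, s) (LocalSucceeds c ε T₀ N H
      (answerProb c m v k true * φ true + answerProb c m v k false * φ false) j) := by
  intro T hBT
  obtain ⟨T, rfl⟩ : ∃ T', T = T' + 1 := ⟨T - 1, by omega⟩
  have hanswer (u : X × Bool) : execRandom T₀ (randomizerProg.init [s 0, u.1, [u.2]]) =
      (noisy (contribution m v u.1 u.2) k).map fun b => some [b] := by
    rw [hs, execRandom_randomizerProg k m v _ _ hT]
  have hdefined : (s 1).length < N ∧ ∀ u : X × Bool,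
      none ∉ (execRandom T₀ (randomizerProg.init [s 0, u.1, [u.2]])).support :=
    ⟨hj ▸ hjN, fun u => by simp [hanswer u]⟩
  have hrandomizer (u : X × Bool) :
      (execRandom T₀ (randomizerProg.init [s 0, u.1, [u.2]])).map (fun o => o.getD []) =
        (noisy (contribution m v u.1 u.2) k).map fun b => [b] := by
    rw [hanswer u, PMF.map_comp]
    rfl
  simp only [LocalSucceeds, execOracle, Cmd.step, toLocal]
  rw [dif_pos hdefined]
  simp only [hrandomizer]
  refine ⟨⟨hj, isLocalRandomizer_noisy _ hk hε, ?_⟩, fun h => ?_⟩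
  · rintro w ⟨u, hw⟩
    simp only [PMF.support_map, Set.mem_image] at hw
    obtain ⟨b, -, rfl⟩ := hw
    exact (hK b T (by omega)).1
  · rw [freshRun, ← PMF.map_bind, PMF.bind_map, PMF.toOuterMeasure_bind_apply, tsum_fintype,
      Fintype.sum_bool]
    simp only [uniform_bind_noisy_apply]
    have hprob := answerProb_nonneg c m v k
    rw [ENNReal.ofReal_add (mul_nonneg (hprob _) (hφ _)) (mul_nonneg (hprob _) (hφ _)),
      ENNReal.ofReal_mul (hprob _), ENNReal.ofReal_mul (hprob _)]
    exact add_le_add (mul_le_mul_right ((hK true T (by omega)).2 h) _)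
      (mul_le_mul_right ((hK false T (by omega)).2 h) _)

end

/-! ### Majority votes -/

theorem moment_step {γ g : ℝ} (hγ : 0 ≤ γ) (hg : γ ≤ g) :
    (1 / 2 + g) * (1 + γ)⁻¹ + (1 / 2 - g) * (1 + γ) ≤ 1 - γ ^ 2 := by
  rw [← div_eq_mul_inv, ← le_sub_iff_add_le, div_le_iff₀ (by linarith)]
  nlinarith [mul_nonneg hγ hγ, mul_nonneg (mul_nonneg hγ hγ) hγ,
    mul_nonneg (sub_nonneg.2 hg) hγ, mul_nonneg (mul_nonneg (sub_nonneg.2 hg) hγ) hγ]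

theorem one_le_pow_mul_inv_pow {x : ℝ} (hx : 1 ≤ x) {w r : ℕ} (h : r ≤ w) :
    1 ≤ x ^ w * x⁻¹ ^ r := by
  rw [inv_pow, ← pow_sub₀ x (by positivity) h]
  exact one_le_pow₀ hx

/-- A lower bound for the advantage of the correct answer over the wrong one in a noisy query with
`k` coins. -/
noncomputable def advantage (d k : ℕ) : ℝ := (1 / 2) ^ k / (4 * dim d)

theorem advantage_nonneg (d k : ℕ) : 0 ≤ advantage d k := by
  unfold advantage
  positivity

theorem advantage_le_one (d k : ℕ) : advantage d k ≤ 1 := by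
  unfold advantage
  rcases Nat.eq_zero_or_pos (dim d) with h | h
  · simp [h]
  · have hdim : (1 : ℝ) ≤ dim d := by exact_mod_cast h
    have hpow : ((1 : ℝ) / 2) ^ k ≤ 1 := pow_le_one₀ (by norm_num) (by norm_num)
    rw [div_le_one (by positivity)]
    linarith

/-- The exponential moment that bounds the probability of a wrong majority if `m` queries are
still to be asked and there were `p` answers `true` and `f` answers `false`. -/
noncomputable def potential (γ : ℝ) (b : Bool) (p f m : ℕ) : ℝ :=
  (1 + γ) ^ (if b then f else p) * (1 + γ)⁻¹ ^ (if b then p else f) * (1 - γ ^ 2) ^ m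

theorem potential_nonneg {γ : ℝ} (h0 : 0 ≤ γ) (h1 : γ ≤ 1) (b : Bool) (p f m : ℕ) :
    0 ≤ potential γ b p f m := by
  have : 0 ≤ 1 - γ ^ 2 := by nlinarith
  unfold potential
  positivity

theorem one_le_potential_zero {γ : ℝ} (hγ : 0 ≤ γ) {b : Bool} {p f : ℕ}
    (hwrong : decide (f < p) ≠ b) : 1 ≤ potential γ b p f 0 := by
  rw [potential, pow_zero, mul_one]
  refine one_le_pow_mul_inv_pow (by linarith) ?_
  cases b
  · simp at hwrong ⊢
    omega
  · simpa using hwrong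

theorem RevealsBit.answerProb_mul_potential_le {d : ℕ} {c : maskedParity.X d → Bool} {m b : Bool}
    {v : List Bool} (hb : RevealsBit d c m v b) (k p f t : ℕ) :
    answerProb c m v k true * potential (advantage d k) b (p + 1) f t
      + answerProb c m v k false * potential (advantage d k) b p (f + 1) t
      ≤ potential (advantage d k) b p f (t + 1) := by
  obtain ⟨g, hg, hright, hwrong⟩ := hb.exists_answerProb_eq k
  have hγ := advantage_nonneg d k
  have hmoment := moment_step hγ hg
  have hnonneg := potential_nonneg hγ (advantage_le_one d k) b p f t
  have hscaled := mul_le_mul_of_nonneg_left hmoment hnonneg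
  cases b
  · rw [Bool.not_false] at hwrong
    rw [hright, hwrong]
    simp only [potential, Bool.false_eq_true, if_false] at hscaled ⊢
    ring_nf at hscaled ⊢
    linarith
  · rw [Bool.not_true] at hwrong
    rw [hright, hwrong]
    simp only [potential, if_true] at hscaled ⊢
    ring_nf at hscaled ⊢
    linarith

theorem RevealsBit.answerProb_true_add_false {d : ℕ} {c : maskedParity.X d → Bool} {m b : Bool}
    {v : List Bool} (hb : RevealsBit d c m v b) (k : ℕ) :
    answerProb c m v k true + answerProb c m v k false = 1 := by
  obtain ⟨g, -, hright, hwrong⟩ := hb.exists_answerProb_eq k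
  cases b
  · rw [Bool.not_false] at hwrong
    linarith
  · rw [Bool.not_true] at hwrong
    linarith

/-- Put the query in register `0` to the next entry and count the answer. -/
def voteStep : Cmd :=
  .seq (.pop 9) (.seq .call (.seq (.push 1 true) (.test 2 .skip (.push 11 true) (.push 10 true))))

/-- Push the majority of the answers onto register `5`. -/
def voteEnd : Cmd :=
  .seq (dropLength 11 10) (.seq (.test 10 (.push 5 false) .skip (.push 5 true)) (clear 10))

/-- Find out a bit by a majority vote, with as many votes as register `8` says. -/
def voteProg : Cmd := .seq (prepend 8 6 9) (.seq (.loop 9 voteStep) voteEnd)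

/-- The stores that occur during a vote: `m` queries are still to be asked, and there were `p`
answers `true` and `f` answers `false`. -/
def voteStore (l0 : List Bool) (j : ℕ) (l2 l3 : List Bool) (i : ℕ) (l5 : List Bool) (k N m p f : ℕ)
    (tail : List (List Bool)) : Store :=
  st (l0 :: unary j :: l2 :: l3 :: List.replicate i false :: l5 :: [] :: unary k :: unary N ::
    unary m :: unary p :: unary f :: tail)

section

variable (l0 : List Bool) (j : ℕ) (l2 l3 : List Bool) (i : ℕ) (l5 : List Bool) (k N p f : ℕ)
  (tail : List (List Bool))

theorem runs_voteEnd :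
    Runs voteEnd (voteStore l0 j l2 l3 i l5 k N 0 p f tail)
      (voteStore l0 j l2 l3 i (decide (f < p) :: l5) k N 0 0 0 tail) (5 * (p + f) + 9) := by
  have hdrop : Runs (dropLength 11 10) (voteStore l0 j l2 l3 i l5 k N 0 p f tail)
      (voteStore l0 j l2 l3 i l5 k N 0 (p - f) 0 tail) (5 * f + 1) := by
    refine ((runs_dropLength (by decide) _).congr_right ?_).mono (by simp [voteStore, st_apply])
    simp [voteStore, update_st, st_apply, unary]
  have hpush : Runs (.test 10 (.push 5 false) .skip (.push 5 true))
      (voteStore l0 j l2 l3 i l5 k N 0 (p - f) 0 tail)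
      (voteStore l0 j l2 l3 i (decide (f < p) :: l5) k N 0 (p - f) 0 tail) 4 := by
    refine Cmd.runs_of_eval_eq rfl ?_ (by simp [Cmd.cost])
    by_cases hfp : f < p
    · obtain ⟨t, ht⟩ : ∃ t, p - f = t + 1 := ⟨p - f - 1, by omega⟩
      simp [Cmd.eval, st_apply, update_st, unary, List.replicate_succ, voteStore, ht, hfp]
    · have ht : p - f = 0 := by omega
      simp [Cmd.eval, st_apply, update_st, unary, voteStore, ht, hfp]
  have hclear : Runs (clear 10)
      (voteStore l0 j l2 l3 i (decide (f < p) :: l5) k N 0 (p - f) 0 tail)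
      (voteStore l0 j l2 l3 i (decide (f < p) :: l5) k N 0 0 0 tail) (5 * (p - f) + 1) :=
    (runs_clear_st rfl (by simp)).mono (by simp [st_apply])
  exact (hdrop.seq (hpush.seq hclear)).mono (by omega)

theorem runs_countAnswer (m : ℕ) (b : Bool) :
    Runs (.seq (.push 1 true) (.test 2 .skip (.push 11 true) (.push 10 true)))
      (Function.update (voteStore l0 j l2 l3 i l5 k N m p f tail) 2 [b])
      (voteStore l0 (j + 1) [b] l3 i l5 k N m (if b then p + 1 else p) (if b then f else f + 1)
        tail) 10 := by
  refine Cmd.runs_of_eval_eq rfl ?_ (by simp [Cmd.cost])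
  cases b <;> simp [Cmd.eval, st_apply, update_st, unary, voteStore, List.replicate_succ]

end

section

variable {d : ℕ} {c : maskedParity.X d → Bool} {ε : ℝ} {T₀ Ndb k : ℕ} {m : Bool}
  {v l2 l3 l5 : List Bool} {i N B j J : ℕ} {tail : List (List Bool)} {K : List Cmd} {φ : ℝ}
  {H' : Bool → Prop}

theorem ensures_voteStep (hk : k ≠ 0) (hε : 4 * (1 / 2) ^ k ≤ ε)
    (hT : 15 * v.length + 15 * k + 70 ≤ T₀) (hφ : 0 ≤ φ) (hj : j < Ndb) (H : Prop) (b : Bool)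
    (p f t : ℕ)
    (hK : ∀ b', Ensures execOracle B
      (K, voteStore (unary k ++ false :: m :: v) (j + 1) [b'] l3 i l5 k N t
        (if b' then p + 1 else p) (if b' then f else f + 1) tail)
      (LocalSucceeds c ε T₀ Ndb (H ∧ RevealsBit d c m v b)
        (φ + potential (advantage d k) b (if b' then p + 1 else p) (if b' then f else f + 1) t)
        (j + 1))) :
    Ensures execOracle (B + 20)
      (voteStep :: K, voteStore (unary k ++ false :: m :: v) j l2 l3 i l5 k N (t + 1) p f tail)
      (LocalSucceeds c ε T₀ Ndb (H ∧ RevealsBit d c m v b)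
        (φ + potential (advantage d k) b p f (t + 1)) j) := by
  have hpop : Runs (.pop 9)
      (voteStore (unary k ++ false :: m :: v) j l2 l3 i l5 k N (t + 1) p f tail)
      (voteStore (unary k ++ false :: m :: v) j l2 l3 i l5 k N t p f tail) 1 :=
    Cmd.runs_of_eval_eq rfl (by simp [Cmd.eval, st_apply, update_st, unary, voteStore]) le_rfl
  have hpotential (b' : Bool) := potential_nonneg (advantage_nonneg d k) (advantage_le_one d k) b
    (if b' then p + 1 else p) (if b' then f else f + 1) t
  have hcall := ensures_localSucceeds_call (c := c) (T₀ := T₀)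
    (s := voteStore (unary k ++ false :: m :: v) j l2 l3 i l5 k N t p f tail)
    rfl (length_unary j) hj hT hk hε (fun b' => add_nonneg hφ (hpotential b')) fun b' =>
      (runs_countAnswer _ _ _ _ _ _ _ _ _ _ _ _ _ _).ensures followsSteps_execOracle (hK b')
  have hstep := (((Reach.seq _ _ _ _).trans ((hpop _).trans (Reach.seq _ _ _ _))).ensures
    followsSteps_execOracle hcall).mono (show _ ≤ B + 20 by omega)
  refine fun T hBT => (hstep T hBT).mono id fun h => ?_
  have hmoment := h.2.answerProb_mul_potential_le k p f t
  have hsum := h.2.answerProb_true_add_false k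
  calc
    _ = (answerProb c m v k true + answerProb c m v k false) * φ +
        (answerProb c m v k true * potential (advantage d k) b (p + 1) f t
          + answerProb c m v k false * potential (advantage d k) b p (f + 1) t) := by
      simp only [if_true, Bool.false_eq_true, if_false]
      ring
    _ ≤ _ := by
      rw [hsum, one_mul]
      gcongr

theorem ensures_voteLoop (hk : k ≠ 0) (hε : 4 * (1 / 2) ^ k ≤ ε)
    (hT : 15 * v.length + 15 * k + 70 ≤ T₀) (hφ : 0 ≤ φ) (hJ : J ≤ Ndb)
    (hK : ∀ l2 b, Ensures execOracle B
      (K, voteStore (unary k ++ false :: m :: v) J l2 l3 i (b :: l5) k N 0 0 0 tail)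
      (LocalSucceeds c ε T₀ Ndb (H' b) φ J)) (b : Bool) {t : ℕ} (p f : ℕ) (hj : j + t = J)
    (l2 : List Bool) :
    Ensures execOracle (B + 5 * (p + f) + 30 * t + 10)
      (.loop 9 voteStep :: voteEnd :: K,
        voteStore (unary k ++ false :: m :: v) j l2 l3 i l5 k N t p f tail)
      (LocalSucceeds c ε T₀ Ndb (H' b ∧ RevealsBit d c m v b)
        (φ + potential (advantage d k) b p f t) j) := by
  induction t generalizing j p f l2 with
  | zero =>
    obtain rfl : j = J := hj
    have hend := (((Reach.loop_nil (r := 9) (c := voteStep) rfl).trans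
      (runs_voteEnd _ j l2 l3 i l5 k N p f tail K)).ensures followsSteps_execOracle
        (hK l2 (decide (f < p)))).mono (show _ ≤ B + 5 * (p + f) + 30 * 0 + 10 by omega)
    refine fun T hBT => ?_
    by_cases hright : decide (f < p) = b
    · refine (hend T hBT).mono (fun h => hright ▸ h.1) fun _ => ?_
      linarith [potential_nonneg (advantage_nonneg d k) (advantage_le_one d k) b p f 0]
    · refine (hend T hBT).of_one_le ?_ _
      linarith [one_le_potential_zero (advantage_nonneg d k) hright]
  | succ t ih =>
    have hstep := ensures_voteStep (l2 := l2) hk hε hT hφ (show j < Ndb by omega) (H' b) b p f t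
      fun b' => (ih (j := j + 1) (if b' then p + 1 else p) (if b' then f else f + 1) (by omega)
        [b']).mono (show _ ≤ B + 5 * (p + f + 1) + 30 * t + 10 by split_ifs <;> omega)
    exact ((Reach.loop_cons (List.cons_ne_nil _ _)).ensures followsSteps_execOracle
      hstep).mono (by omega)

theorem ensures_voteProg {H : Prop} (hk : k ≠ 0) (hε : 4 * (1 / 2) ^ k ≤ ε)
    (hT : 15 * v.length + 15 * k + 70 ≤ T₀) (hφ : 0 ≤ φ) (hJ : J ≤ Ndb) (hj : j + N = J)
    (hH : H → ∃ b, H' b ∧ RevealsBit d c m v b)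
    (hK : ∀ l2 b, Ensures execOracle B
      (K, voteStore (unary k ++ false :: m :: v) J l2 l3 i (b :: l5) k N 0 0 0 tail)
      (LocalSucceeds c ε T₀ Ndb (H' b) φ J)) (l2 : List Bool) :
    Ensures execOracle (B + (42 * N + 20))
      (voteProg :: K, voteStore (unary k ++ false :: m :: v) j l2 l3 i l5 k N 0 0 0 tail)
      (LocalSucceeds c ε T₀ Ndb H (φ + (1 - advantage d k ^ 2) ^ N) j) := by
  have hprepend : Runs (prepend 8 6 9)
      (voteStore (unary k ++ false :: m :: v) j l2 l3 i l5 k N 0 0 0 tail)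
      (voteStore (unary k ++ false :: m :: v) j l2 l3 i l5 k N N 0 0 tail) (12 * N + 3) :=
    ((runs_prepend_st rfl rfl (by simp)).congr_right (by simp [st_apply, voteStore, unary])).mono
      (by simp [st_apply])
  have hrun (b : Bool) := (((Reach.seq _ _ _ _).trans ((hprepend _).trans
    (Reach.seq _ _ _ _))).ensures followsSteps_execOracle
      (ensures_voteLoop hk hε hT hφ hJ hK b 0 0 hj l2)).mono
        (show _ ≤ B + (42 * N + 20) by omega)
  refine fun T hBT => ⟨(hrun true T hBT).1, fun h => ?_⟩
  obtain ⟨b, hb⟩ := hH h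
  have hpotential : potential (advantage d k) b 0 0 N = (1 - advantage d k ^ 2) ^ N := by
    simp [potential]
  exact hpotential ▸ (hrun b T hBT).2 hb

end

theorem learnsBit_voteProg {d : ℕ} {t : List Bool} (ht : t.length = dim d + 1) {ε : ℝ}
    {T₀ k : ℕ} (hk : k ≠ 0) (hε : 4 * (1 / 2) ^ k ≤ ε) (hT : 15 * dim d + 15 * k + 70 ≤ T₀)
    (N : ℕ) (l3 : List Bool) (tail : List (List Bool)) :
    LearnsBit voteProg (dim d) k (42 * N + 20) (fun i => unary (i * N)) l3 (unary N) tail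
      (fun _ => True) fun l => LocalSucceeds (fun x : maskedParity.X d => dot t x.1) ε T₀
        ((dim d + 1) * N) (dim d ≠ 0 ∧ l <:+ t)
        ((dim d + 1 - l.length : ℕ) * (1 - advantage d k ^ 2) ^ N) (l.length * N) := by
  intro l _ hl l2 i K B q hK
  have hγ := advantage_nonneg d k
  have hδ : 0 ≤ (1 - advantage d k ^ 2) ^ N :=
    pow_nonneg (by nlinarith [advantage_le_one d k]) N
  have hvote := ensures_voteProg (j := l.length * N) (H := dim d ≠ 0 ∧ l <:+ t) hk hε
    (show 15 * (nextQuery (dim d) l).2.length + 15 * k + 70 ≤ T₀ by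
      have := length_nextQuery_le hl
      omega)
    (mul_nonneg (Nat.cast_nonneg (dim d + 1 - (l.length + 1))) hδ)
    (Nat.mul_le_mul_right N (show l.length + 1 ≤ dim d + 1 by omega)) (by ring)
    (fun ⟨hd, hsuffix⟩ => (exists_cons_suffix hsuffix (by omega)).imp fun _ hb =>
      ⟨⟨hd, hb⟩, revealsBit_nextQuery hd ht hb⟩)
    (fun l2' b => hK l2' b trivial) l2
  refine fun T hBT => (hvote T hBT).mono id fun _ => le_of_eq ?_
  rw [show dim d + 1 - l.length = dim d + 1 - (l.length + 1) + 1 by omega]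
  push_cast
  ring

/-! ### The local learner -/

/-- Replace the number in register `8` by its square. -/
def squareProg : Cmd :=
  .seq (prepend 8 6 9) (.seq (forEach 9 fun _ => prepend 8 6 10) (.seq (clear 8) (moveRev 10 8)))

theorem runs_squareProg (l0 l1 l2 l3 l4 l5 l7 : List Bool) (tail : List (List Bool)) (N : ℕ) :
    Runs squareProg
      (st (l0 :: l1 :: l2 :: l3 :: l4 :: l5 :: [] :: l7 :: unary N :: [] :: [] :: tail))
      (st (l0 :: l1 :: l2 :: l3 :: l4 :: l5 :: [] :: l7 :: unary (N ^ 2) :: [] :: [] :: tail))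
      (20 * (N + 1) ^ 2) := by
  let S (n : ℕ) (l9 l10 : List Bool) : Store :=
    st (l0 :: l1 :: l2 :: l3 :: l4 :: l5 :: [] :: l7 :: unary n :: l9 :: l10 :: tail)
  have hcopy : Runs (prepend 8 6 9) (S N [] []) (S N (unary N) []) (12 * N + 3) :=
    ((runs_prepend_st rfl rfl (by simp)).congr_right (by simp [S, st_apply])).mono
      (by simp [st_apply])
  have hmul : Runs (forEach 9 fun _ => prepend 8 6 10) (S N (unary N) []) (S N [] (unary (N ^ 2)))
      ((12 * N + 7) * N + 1) := by
    have hloop := runs_forEach (a := 9) (B := 12 * N + 3) (f := fun _ => prepend 8 6 10)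
      (fun p l => S N l (unary (p.length * N))) (fun _ _ => rfl) (fun b p l => ?_) [] (unary N)
    · simpa [S, sq, unary] using hloop
    · rw [update_st (by simp)]
      refine ((runs_prepend_st (u := unary N) rfl rfl (by simp)).congr_right ?_).mono (by simp)
      simp [S, st_apply, unary, add_one_mul, add_comm]
  have hclear : Runs (clear 8) (S N [] (unary (N ^ 2))) (S 0 [] (unary (N ^ 2))) (5 * N + 1) :=
    (runs_clear_st rfl (by simp)).mono (by simp [st_apply])
  have hmove : Runs (moveRev 10 8) (S 0 [] (unary (N ^ 2))) (S (N ^ 2) [] []) (5 * N ^ 2 + 1) := by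
    refine ((runs_moveRev (by decide) _).congr_right ?_).mono (by simp [S, st_apply])
    simp [S, update_st, st_apply, unary]
  exact (hcopy.seq (hmul.seq (hclear.seq hmove))).mono (by nlinarith)

/-- The stores that occur during the preparations of the local learner. -/
def prepStore (d K A L k N a b s t : ℕ) : Store :=
  st [unary d, unary K, unary A, unary L, [], [], [], unary k, unary N, [], [], [], unary a,
    unary b, unary s, unary t]

/-- Add to register `7` the number of binary digits of the number in register `14`. -/
def sizeProg : Cmd :=
  .loop 14 (.seq (.pop 14) (.seq (.loop 14 (.seq (.pop 14) (.seq (.pop 14) (.push 15 true))))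
    (.seq (moveRev 15 14) (.push 7 true))))

section

variable (d K A L k N a b s t : ℕ)

theorem runs_halve :
    Runs (.loop 14 (.seq (.pop 14) (.seq (.pop 14) (.push 15 true))))
      (prepStore d K A L k N a b s t) (prepStore d K A L k N a b 0 ((s + 1) / 2 + t))
      (6 * s + 1) := by
  induction s using Nat.twoStepInduction generalizing t with
  | zero => exact ((Runs.loop_nil rfl).congr_right (by simp)).mono (by omega)
  | one =>
    refine (Runs.loop_cons (List.cons_ne_nil _ _) (Cmd.runs_of_eval_eq
      (s' := prepStore d K A L k N a b 0 (1 + t)) rfl ?_ le_rfl)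
      ((Runs.loop_nil rfl).congr_right (by simp))).mono (by simp [Cmd.cost])
    simp [Cmd.eval, st_apply, update_st, unary, prepStore, List.replicate_succ, add_comm 1]
  | more s ih _ =>
    refine ((Runs.loop_cons (List.cons_ne_nil _ _) (Cmd.runs_of_eval_eq
      (s' := prepStore d K A L k N a b s (t + 1)) rfl ?_ le_rfl)
      (ih (t + 1))).congr_right ?_).mono (by simp [Cmd.cost]; omega)
    · simp [Cmd.eval, st_apply, update_st, unary, prepStore, List.replicate_succ]
    · rw [show (s + 1) / 2 + (t + 1) = (s + 2 + 1) / 2 + t by omega]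

theorem size_eq_size_div_two_add_one {n : ℕ} (hn : n ≠ 0) : n.size = (n / 2).size + 1 := by
  rw [← Nat.bit_testBit_zero_shiftRight_one n] at hn
  conv_lhs => rw [← Nat.bit_testBit_zero_shiftRight_one n, Nat.size_bit hn]
  rfl

theorem runs_sizeProg :
    Runs sizeProg (prepStore d K A L k N a b s 0) (prepStore d K A L (s.size + k) N a b 0 0)
      (30 * s + 1) := by
  induction s using Nat.strong_induction_on generalizing k with
  | _ s ih =>
    rcases s with _ | s
    · exact ((Runs.loop_nil rfl).congr_right (by simp)).mono (by omega)
    set q := (s + 1) / 2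
    have hpop : Runs (.pop 14) (prepStore d K A L k N a b (s + 1) 0)
        (prepStore d K A L k N a b s 0) 1 :=
      Cmd.runs_of_eval_eq rfl (by simp [Cmd.eval, st_apply, update_st, unary, prepStore]) le_rfl
    have hhalve := runs_halve d K A L k N a b s 0
    have hmove : Runs (moveRev 15 14) (prepStore d K A L k N a b 0 q)
        (prepStore d K A L k N a b q 0) (5 * q + 1) := by
      refine ((runs_moveRev (by decide) _).congr_right ?_).mono (by simp [prepStore, st_apply])
      simp [prepStore, update_st, st_apply, unary]
    have hpush : Runs (.push 7 true) (prepStore d K A L k N a b q 0)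
        (prepStore d K A L (k + 1) N a b q 0) 1 :=
      Cmd.runs_of_eval_eq rfl
        (by simp [Cmd.eval, st_apply, update_st, unary, prepStore, List.replicate_succ]) le_rfl
    refine ((Runs.loop_cons (List.cons_ne_nil _ _) (hpop.seq (hhalve.seq (hmove.seq hpush)))
      (ih q (by omega) (k + 1))).congr_right ?_).mono (by omega)
    rw [size_eq_size_div_two_add_one s.succ_ne_zero, add_right_comm, add_assoc]

/-- Compute `4 * (d + K + L)` in register `13`, from `d`, `K` and `L` in the registers `0`, `1` and
`3`. -/
def sumProg : Cmd :=
  .seq (.seq (prepend 0 6 12) (.seq (moveRev 1 12) (moveRev 3 12)))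
    (.seq (.seq (prepend 12 6 13) (prepend 12 6 13)) (.seq (prepend 12 6 13) (prepend 12 6 13)))

theorem runs_sumProg :
    Runs sumProg (prepStore d K A L 0 0 0 0 0 0)
      (prepStore d 0 A 0 0 0 (d + K + L) (4 * (d + K + L)) 0 0) (60 * (d + K + L) + 30) := by
  have hd : Runs (prepend 0 6 12) (prepStore d K A L 0 0 0 0 0 0)
      (prepStore d K A L 0 0 d 0 0 0) (12 * d + 3) :=
    ((runs_prepend_st rfl rfl (by simp)).congr_right (by simp [st_apply, prepStore, unary])).mono
      (by simp [st_apply])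
  have hK : Runs (moveRev 1 12) (prepStore d K A L 0 0 d 0 0 0)
      (prepStore d 0 A L 0 0 (d + K) 0 0 0) (5 * K + 1) := by
    refine ((runs_moveRev (by decide) _).congr_right ?_).mono (by simp [prepStore, st_apply])
    simp [prepStore, update_st, st_apply, unary, add_comm]
  have hL : Runs (moveRev 3 12) (prepStore d 0 A L 0 0 (d + K) 0 0 0)
      (prepStore d 0 A 0 0 0 (d + K + L) 0 0 0) (5 * L + 1) := by
    refine ((runs_moveRev (by decide) _).congr_right ?_).mono (by simp [prepStore, st_apply])
    simp [prepStore, update_st, st_apply, unary, add_comm]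
  have hadd (a b : ℕ) : Runs (prepend 12 6 13) (prepStore d 0 A 0 0 0 a b 0 0)
      (prepStore d 0 A 0 0 0 a (a + b) 0 0) (12 * a + 3) :=
    ((runs_prepend_st rfl rfl (by simp)).congr_right (by simp [st_apply, prepStore, unary])).mono
      (by simp [st_apply])
  refine (((hd.seq (hK.seq hL)).seq (((hadd _ _).seq (hadd _ _)).seq
    ((hadd _ _).seq (hadd _ _)))).congr_right ?_).mono (by omega)
  congr 1
  ring

end

/-- With `S = 4 * (d + K + L)`, compute the number `S.size` of coins for each query and the number
`S ^ 8` of queries for each bit. -/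
def countsProg : Cmd :=
  .seq sumProg (.seq (.seq (prepend 13 6 14) sizeProg)
    (.seq (prepend 13 6 8) (.seq squareProg (.seq squareProg squareProg))))

theorem runs_countsProg (d A L : ℕ) {K : ℕ} (hK : K ≠ 0) :
    Runs countsProg (prepStore d K A L 0 0 0 0 0 0)
      (prepStore d 0 A 0 (4 * (d + K + L)).size ((4 * (d + K + L)) ^ 8) (d + K + L)
        (4 * (d + K + L)) 0 0) (500 * (4 * (d + K + L)) ^ 8) := by
  have hsum := runs_sumProg d K A L
  obtain ⟨R, hR⟩ : ∃ R, R = d + K + L := ⟨_, rfl⟩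
  obtain ⟨S, hS⟩ : ∃ S, S = 4 * R := ⟨_, rfl⟩
  rw [← hR, ← hS] at hsum ⊢
  have hcopyS : Runs (prepend 13 6 14) (prepStore d 0 A 0 0 0 R S 0 0)
      (prepStore d 0 A 0 0 0 R S S 0) (12 * S + 3) :=
    ((runs_prepend_st rfl rfl (by simp)).congr_right (by simp [st_apply, prepStore, unary])).mono
      (by simp [st_apply])
  have hsize := runs_sizeProg d 0 A 0 0 0 R S S
  have hcopyN : Runs (prepend 13 6 8) (prepStore d 0 A 0 S.size 0 R S 0 0)
      (prepStore d 0 A 0 S.size S R S 0 0) (12 * S + 3) :=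
    ((runs_prepend_st rfl rfl (by simp)).congr_right (by simp [st_apply, prepStore, unary])).mono
      (by simp [st_apply])
  have hsquare (N : ℕ) : Runs squareProg (prepStore d 0 A 0 S.size N R S 0 0)
      (prepStore d 0 A 0 S.size (N ^ 2) R S 0 0) (20 * (N + 1) ^ 2) :=
    runs_squareProg _ _ _ _ _ _ _ _ N
  have hrun := hsum.seq ((hcopyS.seq hsize).seq (hcopyN.seq ((hsquare _).seq
    ((hsquare _).seq (hsquare _)))))
  rw [← pow_mul, ← pow_mul] at hrun
  refine Runs.mono hrun ?_
  have hS1 : 1 ≤ S := by omega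
  have hle := Nat.le_self_pow (show 8 ≠ 0 by norm_num) S
  have hcost {N : ℕ} (hN : 1 ≤ N) (hNS : N ^ 2 ≤ S ^ 8) : 20 * (N + 1) ^ 2 ≤ 80 * S ^ 8 := by
    nlinarith
  have hcost1 := hcost hS1 (Nat.pow_le_pow_right hS1 (by norm_num))
  have hcost2 := hcost (Nat.one_le_pow 2 S hS1)
    (by rw [← pow_mul]; exact Nat.pow_le_pow_right hS1 (by norm_num))
  have hcost4 := hcost (Nat.one_le_pow 2 _ (Nat.one_le_pow 2 S hS1)) (by rw [← pow_mul, ← pow_mul])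
  norm_num only at *
  omega

/-- Prepare the registers of the local learner. -/
def localPrep : Cmd := .seq countsProg (.seq (.pop 0) (.seq halveProg (clear 1)))

theorem runs_localPrep (d A L : ℕ) {K : ℕ} (hK : K ≠ 0) :
    Runs localPrep (st ([unary d, unary K, unary A, unary L] ++ List.replicate 12 []))
      (mainStore [] (unary 0) (unary A) [] (dim d) [] (4 * (d + K + L)).size
        (unary ((4 * (d + K + L)) ^ 8)) [unary (d + K + L), unary (4 * (d + K + L)), [], []])
      (1000 * (4 * (d + K + L)) ^ 8) := by
  have hcounts := runs_countsProg d A L hK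
  obtain ⟨R, hR⟩ : ∃ R, R = d + K + L := ⟨_, rfl⟩
  obtain ⟨S, hS⟩ : ∃ S, S = 4 * R := ⟨_, rfl⟩
  rw [← hR, ← hS] at hcounts ⊢
  obtain ⟨N, hN⟩ : ∃ N, N = S ^ 8 := ⟨_, rfl⟩
  have hSN : S ≤ N := hN ▸ Nat.le_self_pow (by norm_num) S
  rw [← hN] at hcounts ⊢
  have hpop : Runs (.pop 0) (prepStore d 0 A 0 S.size N R S 0 0)
      (prepStore (d - 1) 0 A 0 S.size N R S 0 0) 1 :=
    Cmd.runs_of_eval_eq rfl (by simp [Cmd.eval, st_apply, update_st, unary, prepStore]) le_rfl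
  have hhalve : Runs halveProg (prepStore (d - 1) 0 A 0 S.size N R S 0 0)
      (mainStore [] (unary (8 * dim d)) (unary A) [] (dim d) [] S.size (unary N)
        [unary R, unary S, [], []]) (30 * d + 1) :=
    (runs_halveProg (d - 1) 0 0 (unary A) [] [[], [], unary S.size, unary N, [], [], [], unary R,
      unary S, [], []]).mono (by omega)
  have hclear : Runs (clear 1)
      (mainStore [] (unary (8 * dim d)) (unary A) [] (dim d) [] S.size (unary N)
        [unary R, unary S, [], []])
      (mainStore [] (unary 0) (unary A) [] (dim d) [] S.size (unary N)
        [unary R, unary S, [], []]) (40 * dim d + 1) :=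
    (runs_clear_st rfl (by simp)).mono (by simp [st_apply]; omega)
  refine (hcounts.seq (hpop.seq (hhalve.seq hclear))).mono ?_
  have hdim := two_mul_dim_le d
  omega

/-- The program of the local learner. -/
def localProg : Cmd := .seq localPrep (learnProg voteProg)

theorem two_pow_size_le {n : ℕ} (hn : n ≠ 0) : 2 ^ n.size ≤ 2 * n := by
  obtain ⟨k, hk⟩ := Nat.exists_eq_succ_of_ne_zero (Nat.size_pos.2 (Nat.pos_of_ne_zero hn)).ne'
  have : 2 ^ k ≤ n := Nat.lt_size.1 (by omega)
  rw [hk, pow_succ]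
  omega

theorem one_sub_sq_pow_le_exp {γ x : ℝ} {n : ℕ} (hγ : γ ^ 2 ≤ 1) (hx : x ≤ γ ^ 2 * n) :
    (1 - γ ^ 2) ^ n ≤ Real.exp (-x) :=
  calc (1 - γ ^ 2) ^ n ≤ Real.exp (-γ ^ 2) ^ n :=
        pow_le_pow_left₀ (by linarith) (Real.one_sub_le_exp_neg _) n
    _ = Real.exp (-(γ ^ 2 * n)) := by
        rw [← Real.exp_nat_mul]
        ring_nf
    _ ≤ Real.exp (-x) := Real.exp_le_exp.2 (neg_le_neg hx)

theorem exp_neg_le_of_logb_le {x β : ℝ} (hx : 0 ≤ x) (hβ : 0 < β)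
    (h : Real.logb 2 (1 / β) ≤ x) : Real.exp (-x) ≤ β := by
  rw [← Real.le_log_iff_exp_le hβ]
  rw [Real.logb, one_div, Real.log_inv, div_le_iff₀ (Real.log_pos one_lt_two)] at h
  nlinarith [Real.log_two_lt_d9]

section

variable {d S : ℕ}

theorem inv_sq_le_advantage (hd : dim d ≠ 0) (hS : 8 * dim d ≤ S) :
    1 / (S : ℝ) ^ 2 ≤ advantage d S.size := by
  have : (0 : ℝ) < dim d := Nat.cast_pos.2 (Nat.pos_of_ne_zero hd)
  have hpow : (2 : ℝ) ^ S.size ≤ 2 * S := by exact_mod_cast two_pow_size_le (n := S) (by omega)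
  have hdim : (8 : ℝ) * dim d ≤ S := by exact_mod_cast hS
  rw [advantage, one_div_pow, div_div]
  refine one_div_le_one_div_of_le (by positivity) ?_
  calc (2 : ℝ) ^ S.size * (4 * dim d) ≤ 2 * S * (4 * dim d) := by gcongr
    _ = S * (8 * dim d) := by ring
    _ ≤ S * S := by gcongr
    _ = S ^ 2 := by ring

theorem le_advantage_sq_mul_pow (hd : dim d ≠ 0) (hS : 8 * dim d ≤ S) :
    (S : ℝ) ≤ advantage d S.size ^ 2 * (S ^ 8 : ℕ) := by
  have hS1 : (1 : ℝ) ≤ S := by exact_mod_cast (by omega : 1 ≤ S)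
  have hadvantage := inv_sq_le_advantage hd hS
  calc (S : ℝ) ≤ S ^ 4 := le_self_pow₀ hS1 (by norm_num)
    _ = (1 / (S : ℝ) ^ 2) ^ 2 * (S : ℝ) ^ 8 := by field_simp
    _ ≤ advantage d S.size ^ 2 * (S ^ 8 : ℕ) := by
        push_cast
        gcongr

theorem failure_le {L : ℕ} (hd : dim d ≠ 0) (hS : 4 * (d + L) ≤ S) {β : ℝ} (hβ : 0 < β)
    (hL : Real.logb 2 (1 / β) ≤ L) :
    ((dim d + 1 : ℕ) : ℝ) * (1 - advantage d S.size ^ 2) ^ (S ^ 8) ≤ β := by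
  have hdim := two_mul_dim_le d
  have hsum : ((dim d + L : ℕ) : ℝ) ≤ S := Nat.cast_le.2 (by omega)
  have hsq : advantage d S.size ^ 2 ≤ 1 :=
    pow_le_one₀ (advantage_nonneg d _) (advantage_le_one d _)
  calc ((dim d + 1 : ℕ) : ℝ) * (1 - advantage d S.size ^ 2) ^ (S ^ 8)
      ≤ Real.exp (dim d) * Real.exp (-(dim d + L : ℕ)) := by
        refine mul_le_mul ?_ (one_sub_sq_pow_le_exp hsq
          (hsum.trans (le_advantage_sq_mul_pow hd (by omega)))) (by bound) (Real.exp_pos _).le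
        push_cast
        exact Real.add_one_le_exp _
    _ = Real.exp (-L) := by
        rw [← Real.exp_add]
        push_cast
        ring_nf
    _ ≤ β := exp_neg_le_of_logb_le (Nat.cast_nonneg L) hβ hL

end

/-- The parameter in terms of which the local learner measures its resources. -/
noncomputable def localParam (d : ℕ) (ε β : ℝ) : ℕ :=
  4 * (d + ⌈1 / ε⌉₊ + ⌈Real.logb 2 (1 / β)⌉₊)

/-- The size of the database of the local learner, which uses a new entry for each query. -/
noncomputable def localEntries (d : ℕ) (ε _α β : ℝ) : ℕ := (dim d + 1) * localParam d ε β ^ 8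

/-- The step bound of the machine of the local learner. -/
noncomputable def localTime (d : ℕ) (ε _α β : ℝ) : ℕ := 2000 * localParam d ε β ^ 9

section

variable {d : ℕ} {ε α β : ℝ}

theorem le_localParam (hε : 0 < ε) (β : ℝ) : 4 * (d + 1) ≤ localParam d ε β := by
  have : 0 < ⌈1 / ε⌉₊ := Nat.ceil_pos.2 (by positivity)
  unfold localParam
  omega

theorem localParam_le (hε : 0 < ε) (h : Admissible α β) {x : ℝ}
    (hx : d + 1 / ε + 1 / α + Real.logb 2 (1 / β) ≤ x) : (localParam d ε β : ℝ) ≤ 8 * (1 + x) := by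
  have hα := h.one_div_pos
  have hε' := one_div_pos.2 hε
  have hceilε := Nat.ceil_lt_add_one hε'.le
  have hβ := h.logb_pos
  have hceilβ := Nat.ceil_lt_add_one hβ.le
  have : (0 : ℝ) ≤ d := Nat.cast_nonneg d
  unfold localParam
  push_cast
  linarith

theorem localTime_le (hε : 0 < ε) (h : Admissible α β) {x : ℝ}
    (hx : d + 1 / ε + 1 / α + Real.logb 2 (1 / β) ≤ x) :
    (localTime d ε α β : ℝ) ≤ polyBound (2000 * 8 ^ 9) 9 x := by
  unfold localTime polyBound
  push_cast
  calc 2000 * (localParam d ε β : ℝ) ^ 9 ≤ 2000 * (8 * (1 + x)) ^ 9 := by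
        gcongr
        exact localParam_le hε h hx
    _ = _ := by ring

theorem localEntries_le_localTime (hε : 0 < ε) (α β : ℝ) :
    localEntries d ε α β ≤ localTime d ε α β := by
  have hparam := le_localParam (d := d) hε β
  have hdim := two_mul_dim_le d
  unfold localEntries localTime
  calc (dim d + 1) * localParam d ε β ^ 8 ≤ 2000 * localParam d ε β * localParam d ε β ^ 8 := by
        gcongr
        omega
    _ = 2000 * localParam d ε β ^ 9 := by ring

theorem four_mul_half_pow_size_le (hε : 0 < ε) :
    4 * (1 / 2) ^ (localParam d ε β).size ≤ ε := by
  obtain ⟨S, hS⟩ : ∃ S, S = localParam d ε β := ⟨_, rfl⟩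
  have hle : 4 * ⌈1 / ε⌉₊ ≤ S := by
    unfold localParam at hS
    omega
  have hpow : 4 * (1 / ε) ≤ 2 ^ S.size :=
    calc 4 * (1 / ε) ≤ ((4 * ⌈1 / ε⌉₊ : ℕ) : ℝ) := by
          push_cast
          gcongr
          exact Nat.le_ceil _
      _ ≤ ((2 ^ S.size : ℕ) : ℝ) := Nat.cast_le.2 (hle.trans S.lt_size_self.le)
      _ = 2 ^ S.size := by push_cast; rfl
  rw [← hS, one_div_pow, mul_one_div, div_le_iff₀ (by positivity)]
  rwa [mul_one_div, div_le_iff₀' hε] at hpow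

theorem localProg_cost_le {S k n : ℕ} (hn : 4 * (n + 1) ≤ S) (hk : k ≤ S) :
    1000 * S ^ 8 + ((n + 1) * (42 * S ^ 8 + 20 + 40 * (n + k + 2)) + 2) + 1 ≤ 2000 * S ^ 9 := by
  have hpow : S ≤ S ^ 8 := Nat.le_self_pow (by norm_num) S
  have hround : (n + 1) * (42 * S ^ 8 + 20 + 40 * (n + k + 2)) ≤ S * (200 * S ^ 8) := by
    gcongr <;> omega
  have hS : S * S ^ 8 = S ^ 9 := by ring
  have : 4 * S ^ 8 ≤ S ^ 9 := by
    rw [← hS]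
    gcongr
    omega
  rw [mul_left_comm, hS] at hround
  omega

theorem localSucceeds_localProg (hε : 0 < ε) (hβ : 0 < β) (α : ℝ) {t : List Bool}
    (ht : t.length = dim d + 1) :
    LocalSucceeds (fun x : maskedParity.X d => dot t x.1) ε (localTime d ε α β)
      (localEntries d ε α β) (dim d ≠ 0) β 0 (execOracle (localTime d ε α β)
        (localProg.init [unary d, unary ⌈1 / ε⌉₊, unary ⌈1 / α⌉₊,
          unary ⌈Real.logb 2 (1 / β)⌉₊])) := by
  have hprep := runs_localPrep d ⌈1 / α⌉₊ ⌈Real.logb 2 (1 / β)⌉₊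
    (Nat.ceil_pos.2 (one_div_pos.2 hε)).ne'
  have hfail := fun hd => failure_le (d := d) (S := localParam d ε β) hd
    (by unfold localParam; omega) hβ (Nat.le_ceil _)
  have hcoins := four_mul_half_pow_size_le (d := d) (β := β) hε
  have hparam := le_localParam (d := d) hε β
  have hdim := two_mul_dim_le d
  rw [show 4 * (d + ⌈1 / ε⌉₊ + ⌈Real.logb 2 (1 / β)⌉₊) = localParam d ε β from rfl] at hprep
  rw [Cmd.init_eq_st _ _ 12]
  unfold localTime localEntries
  set S := localParam d ε β
  have hsize : S.size ≤ S := Nat.size_le.2 Nat.lt_two_pow_self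
  have hS9 : S ≤ S ^ 9 := Nat.le_self_pow (by norm_num) S
  have hbit := learnsBit_voteProg ht (Nat.size_pos.2 (by omega)).ne' hcoins
    (by omega : 15 * dim d + 15 * S.size + 70 ≤ 2000 * S ^ 9) (S ^ 8) []
    [unary (d + ⌈1 / ε⌉₊ + ⌈Real.logb 2 (1 / β)⌉₊), unary S, [], []]
  have hlearn := hbit.ensures_learnProg (fun l _ hl => by
    rw [hl, Nat.sub_self, Nat.cast_zero, zero_mul]
    refine localSucceeds_output (by omega) (fun h => ?_) _
    rw [h.2.eq_of_length (hl.trans ht.symm)]) trivial (unary ⌈1 / α⌉₊)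
  simp only [List.length_nil, Nat.sub_zero, zero_mul] at hlearn
  have hrun := ((Reach.seq _ _ _ _).trans (hprep [learnProg voteProg])).ensures
    followsSteps_execOracle hlearn
  refine (hrun (2000 * S ^ 9) ?_).mono (fun hd => ⟨hd, t.nil_suffix⟩) hfail
  have hcost := localProg_cost_le (S := S) (n := dim d) (by omega) hsize
  omega

end

/-- The local learner for masked parities; `fun _ => false` stands for an undecodable hypothesis. -/
noncomputable def localLearner : LocalFamily maskedParity where
  n := localEntries
  alg d ε α β := (machineLocal maskedParity localProg randomizerProg evalProg localTime localEntries
    d ε α β).mapOutput fun o => o.getD fun _ => false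

theorem ofReal_one_sub_le_toOuterMeasure_map_getD {X : Type} [Fintype X]
    (p : PMF (Option (X → Bool))) {c : X → Bool} {α β : ℝ} (hα : 0 ≤ α) (hβ : 0 ≤ β)
    (h : p.toOuterMeasure {o | o ≠ some c} ≤ ENNReal.ofReal β) :
    ENNReal.ofReal (1 - β) ≤
      (p.map fun o => o.getD fun _ => false).toOuterMeasure {h | err c h ≤ α} := by
  have huniv : p.toOuterMeasure Set.univ = 1 :=
    (p.toOuterMeasure_apply_eq_one_iff _).2 (Set.subset_univ _)
  rw [PMF.toOuterMeasure_map_apply, ENNReal.ofReal_sub _ hβ, ENNReal.ofReal_one, ← huniv,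
    tsub_le_iff_right]
  calc p.toOuterMeasure Set.univ
      ≤ p.toOuterMeasure {some c} + p.toOuterMeasure {some c}ᶜ :=
        MeasureTheory.measure_univ_le_add_compl _
    _ ≤ _ := by
        refine add_le_add (MeasureTheory.OuterMeasure.mono _ ?_) h
        rintro _ rfl
        simpa [err_self] using hα

section

variable {d : ℕ} {ε α β : ℝ}

theorem singlePass_localProg (hε : 0 < ε) (hβ : 0 < β) (α : ℝ) :
    SinglePass ε (machineLocal maskedParity localProg randomizerProg evalProg localTime localEntries
      d ε α β) 0 :=
  (localSucceeds_localProg hε hβ α (List.length_replicate (a := false))).1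

theorem localLearner_learns (hε : 0 < ε) (h : Admissible α β) {c : maskedParity.X d → Bool}
    (hc : c ∈ maskedParity.concepts d) :
    ENNReal.ofReal (1 - β) ≤
      (localOutput (localLearner.alg d ε α β) fun _ => c).toOuterMeasure {h | err c h ≤ α} := by
  obtain ⟨hd, t, ht, rfl⟩ := maskedParity_mem_concepts.1 hc
  have hsucceeds := localSucceeds_localProg hε h.2.1 α ht
  have hfail := hsucceeds.2 hd
  rw [← hsucceeds.1.localOutput_eq] at hfail
  have hmap : localOutput (localLearner.alg d ε α β) (fun _ x => dot t x.1) =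
      (localOutput (machineLocal maskedParity localProg randomizerProg evalProg localTime
        localEntries d ε α β) fun _ x => dot t x.1).map fun o => o.getD fun _ => false := by
    simp only [localOutput, PMF.map_bind, localLearner, Alg.runLR_mapOutput]
    rfl
  rw [hmap]
  exact ofReal_one_sub_le_toOuterMeasure_map_getD _ h.1.1.le h.2.1.le hfail

theorem maskedParity_mem_effInteractiveLocal : maskedParity ∈ EffInteractiveLocal := by
  have htime {d : ℕ} {ε α β : ℝ} (hε : 0 < ε) (h : Admissible α β) (c : maskedParity.X d → Bool) :
      (localTime d ε α β : ℝ) ≤ polyBound (2000 * 8 ^ 9) 9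
        (d + maskedParity.size d c + 1 / ε + 1 / α + Real.logb 2 (1 / β)) :=
    localTime_le hε h (by linarith [(Nat.cast_nonneg _ : (0 : ℝ) ≤ maskedParity.size d c)])
  refine ⟨localLearner, ⟨2000 * 8 ^ 9, 9, fun d ε α β hε h => ⟨?_, ?_, fun c hc => ⟨?_, ?_⟩⟩⟩,
    localProg, randomizerProg, evalProg, localTime, 2000 * 8 ^ 9, 9, fun d ε α β hε h =>
      ⟨fun c _ => htime hε h c, (singlePass_localProg hε h.2.1 α).none_notMem, rfl⟩⟩
  · exact (Nat.cast_le.2 (localEntries_le_localTime hε α β)).trans (localTime_le hε h le_rfl)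
  · exact ((singlePass_localProg hε h.2.1 α).localWithin fun _ _ => rfl).mapOutput _
  · exact ((queriesWithin_toLocal _ _ _ _ _ _ _ _).mono (fun _ _ h => h)
      (Nat.le_floor (htime hε h c))).mapOutput _
  · exact localLearner_learns hε h hc

end

end PrivateLearning

theorem mainTheorem9 :
    (PrivateLearning.NonadaptiveSQ ⊂ PrivateLearning.AdaptiveSQ ∧
      PrivateLearning.NoninteractiveLocal ⊂ PrivateLearning.InteractiveLocal) ∧
    (PrivateLearning.EffNonadaptiveSQ ⊂ PrivateLearning.EffAdaptiveSQ ∧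
      PrivateLearning.EffNoninteractiveLocal ⊂ PrivateLearning.EffInteractiveLocal) := by
  have hSQ := PrivateLearning.maskedParity_mem_effAdaptiveSQ
  have hLocal := PrivateLearning.maskedParity_mem_effInteractiveLocal
  have hSQ' := PrivateLearning.maskedParity_not_mem_nonadaptiveSQ
  have hLocal' := PrivateLearning.maskedParity_not_mem_noninteractiveLocal
  refine ⟨⟨⟨?_, fun h => ?_⟩, ?_, fun h => ?_⟩, ⟨?_, fun h => ?_⟩, ?_, fun h => ?_⟩
  · exact fun C ⟨A, hA, _⟩ => ⟨A, hA⟩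
  · obtain ⟨A, hA, _⟩ := hSQ
    exact hSQ' (h ⟨A, hA⟩)
  · exact fun C ⟨A, hA, _⟩ => ⟨A, hA⟩
  · obtain ⟨A, hA, _⟩ := hLocal
    exact hLocal' (h ⟨A, hA⟩)
  · exact fun C ⟨A, hA, _, heff⟩ => ⟨A, hA, heff⟩
  · obtain ⟨A, hA, hna, _⟩ := h hSQ
    exact hSQ' ⟨A, hA, hna⟩
  · exact fun C ⟨A, hA, _, heff⟩ => ⟨A, hA, heff⟩
  · obtain ⟨A, hA, hna, _⟩ := h hLocal
    exact hLocal' ⟨A, hA, hna⟩
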